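/- Let $R$ be a commutative ring without zero-divisors such that $2\neq 0$ in $R$, let $G\subset R^\times$ be a subgroup of its group of units, and assume that $R$ has an involutive ring endomorphism $r\mapsto \overline r$ with $\overline{x}=x^{-1}$ for all $x\in G$. For an integer $g\ge 0$, let $F_g$ be the model compact connected oriented surface of genus $g$ with one boundary component, with base point $\star\in\partial F_g$, and let $(\alpha_1,\dots,\alpha_g,\beta_1,\dots,\beta_g)$ be its system of meridians and parallels: viewing $F_g$ as a disk with $2g$ bands attached along one side, whose feet occur along this side in the order $a_1,b_1,a_1,b_1,a_2,b_2,a_2,b_2,\dots,a_g,b_g,a_g,b_g$, the curve $\alpha_i$ (resp. $\beta_i$) is a simple closed curve running once through the band $a_i$ (resp. $b_i$) and otherwise lying in the disk; it is made into a loop based at $\star$ by an arc in the disk. For a path-connected space $X$ with base point $\star$, a subspace $Y\ni\star$ and a homomorphism $\varphi\colon H_1(X)\to G$, let $H_1^\varphi(X,Y)$ be the first homology of $R\otimes_{\mathbb Z[H_1(X)]}C(\widehat X,p^{-1}(Y))$, where $p\colon\widehat X\to X$ is the maximal abelian cover; for a loop $\gamma$ based at $\star$, let $\widehat\gamma$ be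 its lift starting at the preferred lift of $\star$. For a cobordism $M$ from $F_{g_-}$ to $F_{g_+}$ with boundary parametrizations $m_\pm\colon F_{g_\pm}\to M$ and for $\varphi\colon H_1(M)\to G$, set $\varphi_\pm:=\varphi\circ m_\pm$ and $$\mathsf{Mag}(M,\varphi):=\operatorname{cl}\Big(\ker\big((-m_-)\oplus m_+\colon H_1^{\varphi_-}(F_{g_-},\star)\oplus H_1^{\varphi_+}(F_{g_+},\star)\to H_1^{\varphi}(M,\star)\big)\Big),$$ where $\operatorname{cl}(A):=\{x : rx\in A \text{ for some } r\in R\setminus\{0\}\}$, and where the base points of the bottom and of the top are identified along the vertical segment of $\partial M$ that joins them. Let the lower handlebody $C_0^g$ be the cobordism from $F_0$ to $F_g$ obtained from $F_g\times[-1,1]$ by attaching $g$ $2$-handles along $\alpha_1\times\{-1\},\dots,\alpha_g\times\{-1\}$, and let the upper handlebody $C_g^0$ be the cobordism from $F_g$ to $F_0$ obtained from $F_g\times[-1,1]$ by attaching $g$ $2$-handles along $\beta_1\times\{1\},\dots,\beta_g\times\{1\}$. Note that $H_1^{\varphi}(F_0,\star)=0$ since $F_0$ is a disk. Then, for any homomorphism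 $\varphi\colon H_1(C_0^g)\to G$ inducing $\varphi_+\colon H_1(F_g)\to G$ on the top boundary, the submodule $\mathsf{Mag}(C_0^g,\varphi)$ of $H_1^{\varphi_+}(F_g,\star)$ is freely generated by $a_i^{\varphi_+}:=[1\otimes\widehat\alpha_i]$, $i=1,\dots,g$. Similarly, for any homomorphism $\varphi\colon H_1(C_g^0)\to G$ inducing $\varphi_-\colon H_1(F_g)\to G$ on the bottom boundary, the submodule $\mathsf{Mag}(C_g^0,\varphi)$ of $H_1^{\varphi_-}(F_g,\star)$ is freely generated by $b_i^{\varphi_-}:=[1\otimes\widehat\beta_i]$, $i=1,\dots,g$. -/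

import Mathlib

noncomputable section

namespace Magnus

open Set

/-! ## Homology with twisted coefficients -/

section Twisted

variable {X : Type*} [TopologicalSpace X]

/-- The standard topological `n`-simplex. -/
abbrev Simplex (n : ℕ) : Type := stdSimplex ℝ (Fin (n + 1))

/-- The `i`-th face inclusion `Δⁿ → Δⁿ⁺¹`, which omits the `i`-th vertex. -/
def coface (n : ℕ) (i : Fin (n + 2)) : C(Simplex n, Simplex (n + 1)) :=
  ⟨stdSimplex.map i.succAbove, stdSimplex.continuous_map _⟩

/-- The straight segment of `Δⁿ` from the vertex `i` to the vertex `j`. -/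
def vertexPath {n : ℕ} (i j : Fin (n + 1)) :
    Path (stdSimplex.vertex (S := ℝ) i) (stdSimplex.vertex (S := ℝ) j) where
  toFun t := stdSimplex.map ![i, j] (stdSimplexHomeomorphUnitInterval.symm t)
  continuous_toFun := (stdSimplex.continuous_map _).comp
    stdSimplexHomeomorphUnitInterval.symm.continuous
  source' := by
    have h : stdSimplexHomeomorphUnitInterval.symm 0 = stdSimplex.vertex (S := ℝ) (0 : Fin 2) := by
      rw [Homeomorph.symm_apply_eq]; exact stdSimplexHomeomorphUnitInterval_zero.symm
    rw [h, stdSimplex.map_vertex]; rfl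
  target' := by
    have h : stdSimplexHomeomorphUnitInterval.symm 1 = stdSimplex.vertex (S := ℝ) (1 : Fin 2) := by
      rw [Homeomorph.symm_apply_eq]; exact stdSimplexHomeomorphUnitInterval_one.symm
    rw [h, stdSimplex.map_vertex]; rfl

/-- The first integral homology group of a path-connected space `X` (written multiplicatively),
as the abelianized fundamental group. -/
abbrev H1 (X : Type*) [TopologicalSpace X] (x₀ : X) : Type _ :=
  Abelianization (FundamentalGroup X x₀)

/-- A singular `n`-simplex `σ` of `X` together with the homotopy class of a path in `X` from `x₀` to
the leading vertex of `σ`. By unique lifting, this is a singular `n`-simplex of the universal cover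
of `X` based at `x₀`; the preferred lift of `x₀` is the class of the constant path. -/
structure LiftedSimplex (x₀ : X) (n : ℕ) where
  simplex : C(Simplex n, X)
  start : Path.Homotopic.Quotient x₀ (simplex (stdSimplex.vertex 0))

variable {x₀ : X}

theorem trans_assoc' {a b c d : X} (p : Path.Homotopic.Quotient a b)
    (q : Path.Homotopic.Quotient b c) (r : Path.Homotopic.Quotient c d) :
    (p.trans q).trans r = p.trans (q.trans r) :=
  CategoryTheory.Category.assoc (obj := FundamentalGroupoid X)
    (W := ⟨a⟩) (X := ⟨b⟩) (Y := ⟨c⟩) (Z := ⟨d⟩) p q r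

theorem symm_trans_cancel {a b c : X} (p : Path.Homotopic.Quotient a b)
    (q : Path.Homotopic.Quotient b c) : p.symm.trans (p.trans q) = q := by
  let f : FundamentalGroupoid.mk a ⟶ FundamentalGroupoid.mk b := p
  let h : FundamentalGroupoid.mk b ⟶ FundamentalGroupoid.mk c := q
  change CategoryTheory.CategoryStruct.comp (CategoryTheory.Groupoid.inv f)
    (CategoryTheory.CategoryStruct.comp f h) = h
  simp

theorem map_trans' {Y : Type*} [TopologicalSpace Y] {a b c : X} (p : Path.Homotopic.Quotient a b)
    (q : Path.Homotopic.Quotient b c) (f : C(X, Y)) :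
    (p.trans q).map f = (p.map f).trans (q.map f) :=
  (FundamentalGroupoid.map f).map_comp (X := ⟨a⟩) (Y := ⟨b⟩) (Z := ⟨c⟩) p q

/-- The `i`-th face: the leading vertex is moved along the segment of the simplex that joins
the old leading vertex to the new one. -/
def LiftedSimplex.face {n : ℕ} (s : LiftedSimplex x₀ (n + 1)) (i : Fin (n + 2)) :
    LiftedSimplex x₀ n where
  simplex := s.simplex.comp (coface n i)
  start := (s.start.trans
      (.mk ((vertexPath 0 (i.succAbove 0)).map s.simplex.continuous))).cast rfl
    (congrArg s.simplex (stdSimplex.map_vertex i.succAbove 0))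

/-- The action of `π₁(X, x₀)` on simplices of the universal cover by deck transformations. -/
def LiftedSimplex.translate {n : ℕ} (l : FundamentalGroup X x₀) (s : LiftedSimplex x₀ n) :
    LiftedSimplex x₀ n where
  simplex := s.simplex
  start := (FundamentalGroup.toPath l).trans s.start

theorem LiftedSimplex.face_translate {n : ℕ} (l : FundamentalGroup X x₀)
    (s : LiftedSimplex x₀ (n + 1)) (i : Fin (n + 2)) :
    (s.translate l).face i = (s.face i).translate l := by
  obtain ⟨σ, γ⟩ := s
  have key : ∀ {a b c : X} (p : Path.Homotopic.Quotient x₀ x₀) (q : Path.Homotopic.Quotient x₀ a)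
      (r : Path.Homotopic.Quotient a b) (h : c = b),
      ((p.trans q).trans r).cast rfl h = p.trans ((q.trans r).cast rfl h) := by
    intro a b c p q r h
    subst h
    simp only [Path.Homotopic.Quotient.cast_rfl_rfl]
    exact trans_assoc' p q r
  simp only [face, translate]
  congr 1
  exact key _ _ _ _

variable {R : Type*} [CommRing R] {G : Subgroup Rˣ}

/-- The relations of `R ⊗_{ℤ[H₁(X)]} C_n(X̂, p⁻¹(A))` between the lifted `n`-simplices:
`1 ⊗ l s = φ(l) ⊗ s` for all `l`, and `1 ⊗ s = 0` if `s` lies over `A`. Since `φ` is trivial on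
commutators, the first relations identify lifts to the universal cover that have the same image in
the maximal abelian cover `X̂`. -/
def relations (A : Set X) (φ : H1 X x₀ →* G) (n : ℕ) : Submodule R (LiftedSimplex x₀ n →₀ R) :=
  Submodule.span R
    ({v | ∃ (l : FundamentalGroup X x₀) (s : LiftedSimplex x₀ n),
        v = Finsupp.single (s.translate l) 1 -
          Finsupp.single s (((φ (Abelianization.of l) : G) : Rˣ) : R)} ∪
      {v | ∃ s : LiftedSimplex x₀ n, range s.simplex ⊆ A ∧ v = Finsupp.single s 1})

/-- The twisted chain module `C_n^φ(X, A) = R ⊗_{ℤ[H₁(X)]} C_n(X̂, p⁻¹(A))` for `φ : H₁(X) → G ⊆ Rˣ`,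
where `p : X̂ → X` is the maximal abelian cover. -/
abbrev Chain (A : Set X) (φ : H1 X x₀ →* G) (n : ℕ) : Type _ :=
  (LiftedSimplex x₀ n →₀ R) ⧸ relations A φ n

/-- The alternating sum of the faces, on the free module on the lifted simplices. -/
def freeBoundary (R : Type*) [CommRing R] (x₀ : X) (n : ℕ) :
    (LiftedSimplex x₀ (n + 1) →₀ R) →ₗ[R] (LiftedSimplex x₀ n →₀ R) :=
  Finsupp.linearCombination R fun s =>
    ∑ i : Fin (n + 2), (-1 : R) ^ (i : ℕ) • Finsupp.single (s.face i) (1 : R)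

theorem relations_le_comap_freeBoundary (A : Set X) (φ : H1 X x₀ →* G) (n : ℕ) :
    relations A φ (n + 1) ≤ (relations A φ n).comap (freeBoundary R x₀ n) := by
  refine Submodule.span_le.2 ?_
  rintro v (⟨l, s, rfl⟩ | ⟨s, hs, rfl⟩)
  · simp only [freeBoundary, SetLike.mem_coe, Submodule.mem_comap, map_sub,
      Finsupp.linearCombination_single, one_smul, Finset.smul_sum, ← Finset.sum_sub_distrib]
    refine Submodule.sum_mem _ fun i _ => ?_
    rw [smul_comm, ← smul_sub]
    refine Submodule.smul_mem _ _ (Submodule.subset_span (Or.inl ⟨l, s.face i, ?_⟩))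
    rw [LiftedSimplex.face_translate, Finsupp.smul_single, smul_eq_mul, mul_one]
  · simp only [freeBoundary, SetLike.mem_coe, Submodule.mem_comap,
      Finsupp.linearCombination_single, one_smul]
    refine Submodule.sum_mem _ fun i _ => Submodule.smul_mem _ _
      (Submodule.subset_span (Or.inr ⟨s.face i, ?_, rfl⟩))
    rintro _ ⟨t, rfl⟩
    exact hs ⟨coface n i t, rfl⟩

/-- The boundary operator of the twisted chain complex. -/
def boundary (A : Set X) (φ : H1 X x₀ →* G) (n : ℕ) : Chain A φ (n + 1) →ₗ[R] Chain A φ n :=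
  Submodule.mapQ _ _ (freeBoundary R x₀ n) (relations_le_comap_freeBoundary A φ n)

/-- The twisted homology module `H₁^φ(X, A)`. -/
abbrev TwistedH1 (A : Set X) (φ : H1 X x₀ →* G) : Type _ :=
  LinearMap.ker (boundary A φ 0) ⧸
    (LinearMap.range (boundary A φ 1)).submoduleOf (LinearMap.ker (boundary A φ 0))

/-- A path, as a singular `1`-simplex. -/
def pathSimplex {x y : X} (p : Path x y) : C(Simplex 1, X) :=
  p.toContinuousMap.comp
    ⟨stdSimplexHomeomorphUnitInterval, stdSimplexHomeomorphUnitInterval.continuous⟩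

theorem pathSimplex_vertex_zero {x y : X} (p : Path x y) :
    pathSimplex p (stdSimplex.vertex 0) = x :=
  p.source

theorem pathSimplex_vertex_one {x y : X} (p : Path x y) :
    pathSimplex p (stdSimplex.vertex 1) = y :=
  p.target

/-- The lift of a loop to the cover that starts at the preferred lift of the base point. -/
def liftLoop (p : Path x₀ x₀) : LiftedSimplex x₀ 1 where
  simplex := pathSimplex p
  start := (Path.Homotopic.Quotient.refl x₀).cast rfl (pathSimplex_vertex_zero p)

theorem liftLoop_mem_ker (A : Set X) (φ : H1 X x₀ →* G) (hA : x₀ ∈ A) (p : Path x₀ x₀) :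
    (Submodule.Quotient.mk (Finsupp.single (liftLoop p) 1) : Chain A φ 1) ∈
      LinearMap.ker (boundary A φ 0) := by
  rw [LinearMap.mem_ker]
  refine (Submodule.Quotient.mk_eq_zero _).2 ?_
  simp only [freeBoundary, Finsupp.linearCombination_single, one_smul]
  refine Submodule.sum_mem _ fun i _ => Submodule.smul_mem _ _
    (Submodule.subset_span (Or.inr ⟨_, ?_, rfl⟩))
  rintro _ ⟨t, rfl⟩
  obtain rfl : t = stdSimplex.vertex 0 := Subsingleton.elim _ _
  have h : ((liftLoop p).face i).simplex (stdSimplex.vertex 0) =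
      pathSimplex p (stdSimplex.vertex (i.succAbove 0)) :=
    congrArg (pathSimplex p) (stdSimplex.map_vertex i.succAbove 0)
  rw [h]
  fin_cases i
  · exact (pathSimplex_vertex_one p).symm ▸ hA
  · exact (pathSimplex_vertex_zero p).symm ▸ hA

/-- The class `[1 ⊗ p̂]` in `H₁^φ(X, x₀)` of a loop `p` based at `x₀`, where `p̂` is the lift of `p`
that starts at the preferred lift of `x₀`. -/
def loopClass (φ : H1 X x₀ →* G) (p : Path x₀ x₀) : TwistedH1 {x₀} φ :=
  Submodule.Quotient.mk ⟨_, liftLoop_mem_ker {x₀} φ rfl p⟩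

variable {Y : Type*} [TopologicalSpace Y] {y₀ : Y}

/-- The homomorphism `H₁(X) → H₁(Y)` induced by a map `f`, where the base points are related by a
path from `y₀` to `f x₀`. -/
def H1.map (f : C(X, Y)) (w : Path y₀ (f x₀)) : H1 X x₀ →* H1 Y y₀ :=
  Abelianization.map
    ((FundamentalGroup.fundamentalGroupMulEquivOfPath w).symm.toMonoidHom.comp
      (FundamentalGroup.map f x₀))

/-- The map induced by `f` on lifted simplices, where the base points are related by a path from
`y₀` to `f x₀`. -/
def LiftedSimplex.map {n : ℕ} (f : C(X, Y)) (w : Path y₀ (f x₀)) (s : LiftedSimplex x₀ n) :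
    LiftedSimplex y₀ n where
  simplex := f.comp s.simplex
  start := (Path.Homotopic.Quotient.mk w).trans (s.start.map f)

theorem LiftedSimplex.map_translate {n : ℕ} (f : C(X, Y)) (w : Path y₀ (f x₀))
    (l : FundamentalGroup X x₀) (s : LiftedSimplex x₀ n) :
    (s.translate l).map f w = (s.map f w).translate
      ((FundamentalGroup.fundamentalGroupMulEquivOfPath w).symm (FundamentalGroup.map f x₀ l)) := by
  obtain ⟨σ, γ⟩ := s
  simp only [map, translate]
  congr 1
  change _ = ((Path.Homotopic.Quotient.mk w).trans
    (((FundamentalGroup.toPath l).map f).trans (Path.Homotopic.Quotient.mk w).symm)).trans _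
  rw [trans_assoc', trans_assoc', symm_trans_cancel, map_trans']

theorem LiftedSimplex.map_face {n : ℕ} (f : C(X, Y)) (w : Path y₀ (f x₀))
    (s : LiftedSimplex x₀ (n + 1)) (i : Fin (n + 2)) :
    (s.map f w).face i = (s.face i).map f w := by
  obtain ⟨σ, γ⟩ := s
  have key : ∀ {a b c : X} (q : Path.Homotopic.Quotient x₀ a)
      (r : Path.Homotopic.Quotient a b) (h : c = b) (h' : f c = f b),
      (((Path.Homotopic.Quotient.mk w).trans (q.map f)).trans (r.map f)).cast rfl h' =
        (Path.Homotopic.Quotient.mk w).trans (((q.trans r).cast rfl h).map f) := by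
    intro a b c q r h h'
    subst h
    simp only [Path.Homotopic.Quotient.cast_rfl_rfl]
    rw [trans_assoc', map_trans']
  simp only [map, face]
  congr 1
  exact key γ (.mk ((vertexPath 0 (i.succAbove 0)).map σ.continuous))
    (congrArg σ (stdSimplex.map_vertex i.succAbove 0)) _

/-- The map induced on the free modules on the lifted simplices. -/
def freeMap (R : Type*) [CommRing R] (f : C(X, Y)) (w : Path y₀ (f x₀)) (n : ℕ) :
    (LiftedSimplex x₀ n →₀ R) →ₗ[R] (LiftedSimplex y₀ n →₀ R) :=
  Finsupp.lmapDomain R R (LiftedSimplex.map f w)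

theorem relations_le_comap_freeMap {A : Set X} {B : Set Y} (φ : H1 Y y₀ →* G) (f : C(X, Y))
    (w : Path y₀ (f x₀)) (hf : MapsTo f A B) (n : ℕ) :
    relations A (φ.comp (H1.map f w)) n ≤ (relations B φ n).comap (freeMap R f w n) := by
  refine Submodule.span_le.2 ?_
  rintro v (⟨l, s, rfl⟩ | ⟨s, hs, rfl⟩)
  · simp only [freeMap, SetLike.mem_coe, Submodule.mem_comap, map_sub,
      Finsupp.lmapDomain_apply, Finsupp.mapDomain_single]
    refine Submodule.subset_span (Or.inl ⟨(FundamentalGroup.fundamentalGroupMulEquivOfPath w).symm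
      (FundamentalGroup.map f x₀ l), s.map f w, ?_⟩)
    rw [LiftedSimplex.map_translate]
    rfl
  · simp only [freeMap, SetLike.mem_coe, Submodule.mem_comap,
      Finsupp.lmapDomain_apply, Finsupp.mapDomain_single]
    refine Submodule.subset_span (Or.inr ⟨s.map f w, ?_, rfl⟩)
    rintro _ ⟨t, rfl⟩
    exact hf (hs ⟨t, rfl⟩)

theorem freeBoundary_freeMap (f : C(X, Y)) (w : Path y₀ (f x₀)) (n : ℕ)
    (v : LiftedSimplex x₀ (n + 1) →₀ R) :
    freeBoundary R y₀ n (freeMap R f w (n + 1) v) = freeMap R f w n (freeBoundary R x₀ n v) := by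
  induction v using Finsupp.induction_linear with
  | zero => simp
  | add a b ha hb => simp only [map_add, ha, hb]
  | single s r =>
    simp [freeMap, freeBoundary, Finsupp.mapDomain_single, LiftedSimplex.map_face, map_sum]

/-- The chain map induced by `f : (X, A) → (Y, B)`, where the coefficients of `X` are pulled back
from those of `Y`. -/
def chainMap {A : Set X} {B : Set Y} (φ : H1 Y y₀ →* G) (f : C(X, Y))
    (w : Path y₀ (f x₀)) (hf : MapsTo f A B) (n : ℕ) :
    Chain A (φ.comp (H1.map f w)) n →ₗ[R] Chain B φ n :=
  Submodule.mapQ _ _ (freeMap R f w n) (relations_le_comap_freeMap φ f w hf n)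

theorem boundary_chainMap {A : Set X} {B : Set Y} (φ : H1 Y y₀ →* G) (f : C(X, Y))
    (w : Path y₀ (f x₀)) (hf : MapsTo f A B) (n : ℕ)
    (c : Chain A (φ.comp (H1.map f w)) (n + 1)) :
    boundary B φ n (chainMap φ f w hf (n + 1) c) = chainMap φ f w hf n (boundary A _ n c) := by
  induction c using Submodule.Quotient.induction_on with
  | H v => exact congrArg Submodule.Quotient.mk (freeBoundary_freeMap f w n v)

/-- The linear map `H₁^{φ f}(X, A) → H₁^φ(Y, B)` induced by `f : (X, A) → (Y, B)`. -/
def TwistedH1.map {A : Set X} {B : Set Y} (φ : H1 Y y₀ →* G) (f : C(X, Y))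
    (w : Path y₀ (f x₀)) (hf : MapsTo f A B) :
    TwistedH1 A (φ.comp (H1.map f w)) →ₗ[R] TwistedH1 B φ :=
  Submodule.mapQ _ _
    ((chainMap φ f w hf 1).restrict fun c hc => by
      rw [LinearMap.mem_ker] at hc ⊢
      rw [boundary_chainMap, hc, map_zero])
    (by
      rintro ⟨c, hc⟩ ⟨d, rfl⟩
      exact ⟨chainMap φ f w hf 2 d, boundary_chainMap φ f w hf 1 d⟩)

end Twisted

/-! ## The model surfaces, with their meridians and parallels -/

/-- The rectangle `[0, 16 (g + 1)] × [-10, 0]` in the plane `ℂ = ℂ × {0}`. -/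
def InBase (g : ℕ) (p : ℂ × ℝ) : Prop :=
  0 ≤ p.1.re ∧ p.1.re ≤ 16 * (g + 1) ∧ -10 ≤ p.1.im ∧ p.1.im ≤ 0 ∧ p.2 = 0

/-- The centre of the `i`-th band of the first kind. -/
def centerA (i : ℕ) : ℝ := 16 * i + 8

/-- The centre of the `i`-th band of the second kind. -/
def centerB (i : ℕ) : ℝ := 16 * i + 11

/-- The linear map `x + i y ↦ x + 2 i y`. -/
def stretch (z : ℂ) : ℂ := ⟨z.re, 2 * z.im⟩

/-- The inverse of `stretch`. -/
def squash (z : ℂ) : ℂ := ⟨z.re, z.im / 2⟩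

/-- A half-annulus in the half-plane `y ≥ 0`, `h = 0`, which meets the rectangle along
`[c - 4, c - 2] ∪ [c + 2, c + 4]` where `c = 16 i + 8`. -/
def InBandA (i : ℕ) (p : ℂ × ℝ) : Prop :=
  0 ≤ p.1.im ∧ p.2 = 0 ∧ 2 ≤ ‖p.1 - centerA i‖ ∧ ‖p.1 - centerA i‖ ≤ 4

/-- A half-annulus (stretched in the `y`-direction) in the half-plane `y ≥ 0`, `h = y`, which meets
the rectangle along `[c - 1, c + 1] ∪ [c + 5, c + 7]` where `c = 16 i + 8`. -/
def InBandB (i : ℕ) (p : ℂ × ℝ) : Prop :=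
  0 ≤ p.1.im ∧ p.2 = p.1.im ∧ 2 ≤ ‖squash (p.1 - centerB i)‖ ∧ ‖squash (p.1 - centerB i)‖ ≤ 4

/-- The model surface `F_g`, compact, connected, orientable, of genus `g`, with one boundary
component: a disk (a rectangle) in `ℝ³` with `2 g` bands attached to its upper side. The feet of the
bands are met in the order `a₀, b₀, a₀, b₀, a₁, b₁, a₁, b₁, …` along this side, so that `F_g` is the
iterated boundary-connected sum of `g` copies of a torus with one hole. -/
def Surface (g : ℕ) : Type :=
  {p : ℂ × ℝ // InBase g p ∨ ∃ i : Fin g, InBandA i p ∨ InBandB i p}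

instance (g : ℕ) : TopologicalSpace (Surface g) :=
  instTopologicalSpaceSubtype

/-- The base point `⋆ ∈ ∂F_g`: the lower left corner of the rectangle. -/
def star (g : ℕ) : Surface g :=
  ⟨(⟨0, -10⟩, 0), Or.inl ⟨le_rfl, by positivity, le_rfl, by norm_num, rfl⟩⟩

/-- The interval `[-1, 1]`. -/
abbrev J : Type := Icc (-1 : ℝ) 1

/-- The point `-1` of `[-1, 1]`. -/
def jBot : J := ⟨-1, by norm_num⟩

/-- The point `0` of `[-1, 1]`. -/
def jMid : J := ⟨0, by norm_num⟩

/-- The point `1` of `[-1, 1]`. -/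
def jTop : J := ⟨1, by norm_num⟩

theorem norm_annulus (u : Circle) (t : J) : ‖((3 + (t : ℝ) / 2 : ℝ) : ℂ) * u‖ = 3 + (t : ℝ) / 2 := by
  have h := t.2.1
  rw [norm_mul, Circle.norm_coe, mul_one, Complex.norm_real, Real.norm_of_nonneg (by linarith)]

/-- An annulus in `F_g` with core the `i`-th meridian: the circle of centre `c` and radius `3` that
runs through the `i`-th band of the first kind and is closed up in the rectangle. -/
def annulusA (g : ℕ) (i : Fin g) : C(Circle × J, Surface g) where
  toFun x := ⟨(centerA i + ((3 + (x.2 : ℝ) / 2 : ℝ) : ℂ) * x.1, 0), by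
    have hi : ((i : ℕ) : ℝ) + 1 ≤ g := by exact_mod_cast i.2
    have hi0 : (0 : ℝ) ≤ (i : ℕ) := Nat.cast_nonneg _
    have ht := x.2.2
    have hn := norm_annulus x.1 x.2
    generalize ((3 + (x.2 : ℝ) / 2 : ℝ) : ℂ) * (x.1 : ℂ) = v at hn ⊢
    have hre := abs_le.1 (Complex.abs_re_le_norm v)
    have him := abs_le.1 (Complex.abs_im_le_norm v)
    rcases le_total v.im 0 with h | h
    · left
      simp only [InBase, centerA, Complex.add_re, Complex.add_im, Complex.ofReal_re,
        Complex.ofReal_im]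
      refine ⟨?_, ?_, ?_, ?_, trivial⟩ <;> linarith [ht.1, ht.2]
    · right
      refine ⟨i, Or.inl ⟨?_, rfl, ?_, ?_⟩⟩
      · simpa using h
      all_goals rw [add_sub_cancel_left, hn]; linarith [ht.1, ht.2]⟩
  continuous_toFun := by
    refine Continuous.subtype_mk ?_ _
    fun_prop

/-- An annulus in `F_g` with core the `i`-th parallel: the ellipse that runs through the `i`-th band
of the second kind and is closed up in the rectangle. -/
def annulusB (g : ℕ) (i : Fin g) : C(Circle × J, Surface g) where
  toFun x := ⟨(centerB i + stretch (((3 + (x.2 : ℝ) / 2 : ℝ) : ℂ) * x.1),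
      max 0 (stretch (((3 + (x.2 : ℝ) / 2 : ℝ) : ℂ) * x.1)).im), by
    have hi : ((i : ℕ) : ℝ) + 1 ≤ g := by exact_mod_cast i.2
    have hi0 : (0 : ℝ) ≤ (i : ℕ) := Nat.cast_nonneg _
    have ht := x.2.2
    have hn := norm_annulus x.1 x.2
    generalize ((3 + (x.2 : ℝ) / 2 : ℝ) : ℂ) * (x.1 : ℂ) = v at hn ⊢
    have hre := abs_le.1 (Complex.abs_re_le_norm v)
    have him := abs_le.1 (Complex.abs_im_le_norm v)
    rcases le_total v.im 0 with h | h
    · left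
      simp only [InBase, centerB, stretch, Complex.add_re, Complex.add_im, Complex.ofReal_re,
        Complex.ofReal_im]
      refine ⟨?_, ?_, ?_, ?_, max_eq_left ?_⟩ <;> linarith [ht.1, ht.2]
    · right
      have hs : squash (stretch v) = v := by simp [squash, stretch]
      refine ⟨i, Or.inr ⟨?_, ?_, ?_, ?_⟩⟩
      · simpa [stretch] using h
      · simpa [stretch] using h
      all_goals rw [add_sub_cancel_left, hs, hn]; linarith [ht.1, ht.2]⟩
  continuous_toFun := by
    have hs : Continuous stretch := by
      have : stretch = fun z : ℂ => (z.re : ℂ) + ((2 * z.im : ℝ) : ℂ) * Complex.I := by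
        funext z; exact (Complex.mk_eq_add_mul_I _ _)
      rw [this]; fun_prop
    refine Continuous.subtype_mk ?_ _
    fun_prop

theorem convex_inBase (g : ℕ) : Convex ℝ {p : ℂ × ℝ | InBase g p} := by
  rintro p ⟨h1, h2, h3, h4, h5⟩ q ⟨k1, k2, k3, k4, k5⟩ a b ha hb hab
  simp only [InBase, mem_ofPred_eq, Prod.fst_add, Prod.smul_fst, Complex.add_re, Complex.add_im,
    Complex.smul_re, Complex.smul_im, Prod.snd_add, Prod.smul_snd, smul_eq_mul, h5, k5]
  obtain rfl : b = 1 - a := by linarith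
  refine ⟨?_, ?_, ?_, ?_, by simp⟩ <;> nlinarith

/-- The straight segment between two points of the rectangle. -/
def baseSegment {g : ℕ} (p q : Surface g) (hp : InBase g p.1) (hq : InBase g q.1) : Path p q where
  toFun t := ⟨AffineMap.lineMap p.1 q.1 (t : ℝ), Or.inl ((convex_inBase g).lineMap_mem hp hq t.2)⟩
  continuous_toFun := Continuous.subtype_mk
    (AffineMap.lineMap_continuous.comp continuous_subtype_val) _
  source' := Subtype.ext (by simp)
  target' := Subtype.ext (by simp)

/-- The core of the `i`-th annulus of the first kind, run clockwise from its lowest point. -/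
def coreA (g : ℕ) (i : Fin g) :
    Path (annulusA g i (Circle.exp (-(Real.pi / 2)), jMid))
      (annulusA g i (Circle.exp (-(Real.pi / 2)), jMid)) where
  toFun t := annulusA g i (Circle.exp (-(Real.pi / 2) - 2 * Real.pi * t), jMid)
  continuous_toFun := by fun_prop
  source' := by simp
  target' := by simp

/-- The core of the `i`-th annulus of the second kind, run counterclockwise from its lowest point. -/
def coreB (g : ℕ) (i : Fin g) :
    Path (annulusB g i (Circle.exp (-(Real.pi / 2)), jMid))
      (annulusB g i (Circle.exp (-(Real.pi / 2)), jMid)) where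
  toFun t := annulusB g i (Circle.exp (-(Real.pi / 2) + 2 * Real.pi * t), jMid)
  continuous_toFun := by fun_prop
  source' := by simp
  target' := by simp

theorem exp_bottom : (Circle.exp (-(Real.pi / 2)) : ℂ) = -Complex.I := by
  rw [Circle.coe_exp]
  push_cast
  rw [neg_mul, Complex.exp_neg, Complex.exp_pi_div_two_mul_I, Complex.inv_I]

theorem inBase_coreA (g : ℕ) (i : Fin g) :
    InBase g (annulusA g i (Circle.exp (-(Real.pi / 2)), jMid)).1 := by
  have hi : ((i : ℕ) : ℝ) + 1 ≤ g := by exact_mod_cast i.2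
  have hi0 : (0 : ℝ) ≤ (i : ℕ) := Nat.cast_nonneg _
  have h : (annulusA g i (Circle.exp (-(Real.pi / 2)), jMid)).1 =
      ((centerA i : ℂ) + ((3 + (jMid : ℝ) / 2 : ℝ) : ℂ) * (Circle.exp (-(Real.pi / 2)) : ℂ), 0) := rfl
  rw [h, exp_bottom]
  simp only [InBase, centerA, jMid]
  refine ⟨?_, ?_, ?_, ?_, trivial⟩ <;> simp <;> linarith

theorem inBase_coreB (g : ℕ) (i : Fin g) :
    InBase g (annulusB g i (Circle.exp (-(Real.pi / 2)), jMid)).1 := by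
  have hi : ((i : ℕ) : ℝ) + 1 ≤ g := by exact_mod_cast i.2
  have hi0 : (0 : ℝ) ≤ (i : ℕ) := Nat.cast_nonneg _
  have h : (annulusB g i (Circle.exp (-(Real.pi / 2)), jMid)).1 =
      ((centerB i : ℂ) + stretch
          (((3 + (jMid : ℝ) / 2 : ℝ) : ℂ) * (Circle.exp (-(Real.pi / 2)) : ℂ)),
        max 0 (stretch
          (((3 + (jMid : ℝ) / 2 : ℝ) : ℂ) * (Circle.exp (-(Real.pi / 2)) : ℂ))).im) := rfl
  rw [h, exp_bottom]
  simp only [InBase, stretch, centerB, jMid]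
  refine ⟨?_, ?_, ?_, ?_, max_eq_left ?_⟩ <;> simp <;> linarith

theorem inBase_star (g : ℕ) : InBase g (star g).1 :=
  ⟨le_rfl, by change (0 : ℝ) ≤ _; positivity, le_rfl, by change (-10 : ℝ) ≤ 0; norm_num, rfl⟩

/-- The `i`-th meridian, as a loop based at `⋆`. -/
def loopA (g : ℕ) (i : Fin g) : Path (star g) (star g) :=
  ((baseSegment _ _ (inBase_star g) (inBase_coreA g i)).trans (coreA g i)).trans
    (baseSegment _ _ (inBase_star g) (inBase_coreA g i)).symm

/-- The `i`-th parallel, as a loop based at `⋆`. -/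
def loopB (g : ℕ) (i : Fin g) : Path (star g) (star g) :=
  ((baseSegment _ _ (inBase_star g) (inBase_coreB g i)).trans (coreB g i)).trans
    (baseSegment _ _ (inBase_star g) (inBase_coreB g i)).symm

/-! ## Cobordisms and the Magnus functor -/

/-- The part of the data of a cobordism `(M, m)` from `F_{g₋}` to `F_{g₊}` on which its value under
the Magnus functor depends: the space `M`, the parametrizations `m₋` and `m₊` of the bottom and of
the top, and the vertical segment `m(⋆ × [-1, 1])` of the side. -/
structure CobordismData (gBot gTop : ℕ) where
  M : Type
  [top : TopologicalSpace M]
  mBot : C(Surface gBot, M)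
  mTop : C(Surface gTop, M)
  side : Path (mBot (star gBot)) (mTop (star gTop))

attribute [instance] CobordismData.top

section Mag

variable {R : Type*} [CommRing R] {G : Subgroup Rˣ}

/-- The closure `{x | ∃ r ≠ 0, r x ∈ N}` of a submodule `N`. -/
def closure [IsDomain R] {H : Type*} [AddCommGroup H] [Module R H] (N : Submodule R H) :
    Submodule R H where
  carrier := {x | ∃ r : R, r ≠ 0 ∧ r • x ∈ N}
  zero_mem' := ⟨1, one_ne_zero, by simp⟩
  add_mem' := by
    rintro x y ⟨r, hr, hx⟩ ⟨s, hs, hy⟩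
    refine ⟨r * s, mul_ne_zero hr hs, ?_⟩
    rw [smul_add, mul_smul r s y, mul_comm, mul_smul s r x]
    exact N.add_mem (N.smul_mem s hx) (N.smul_mem r hy)
  smul_mem' := by
    rintro c x ⟨r, hr, hx⟩
    exact ⟨r, hr, by rw [smul_comm]; exact N.smul_mem c hx⟩

namespace CobordismData

variable {gBot gTop : ℕ} (C : CobordismData gBot gTop)

/-- `H₁(M)`, based at the lower end of the vertical segment. -/
abbrev H1M : Type := H1 C.M (C.mBot (star gBot))

/-- The homomorphism `φ₋ = φ ∘ m₋ : H₁(F_{g₋}) → G`. -/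
def phiBot (φ : C.H1M →* G) : H1 (Surface gBot) (star gBot) →* G :=
  φ.comp (H1.map C.mBot (Path.refl _))

/-- The homomorphism `φ₊ = φ ∘ m₊ : H₁(F_{g₊}) → G`. -/
def phiTop (φ : C.H1M →* G) : H1 (Surface gTop) (star gTop) →* G :=
  φ.comp (H1.map C.mTop C.side)

/-- The map `m₋ : H₁^{φ₋}(F_{g₋}, ⋆) → H₁^φ(M, ⋆)`. The base point of `M` is thickened to the
vertical segment `m(⋆ × [-1, 1])`, which contains the base points of the bottom and of the top. -/
def twistedBot (φ : C.H1M →* G) :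
    TwistedH1 {star gBot} (C.phiBot φ) →ₗ[R] TwistedH1 (range C.side) φ :=
  TwistedH1.map φ C.mBot (Path.refl _) (by rintro _ rfl; exact ⟨0, C.side.source⟩)

/-- The map `m₊ : H₁^{φ₊}(F_{g₊}, ⋆) → H₁^φ(M, ⋆)`. -/
def twistedTop (φ : C.H1M →* G) :
    TwistedH1 {star gTop} (C.phiTop φ) →ₗ[R] TwistedH1 (range C.side) φ :=
  TwistedH1.map φ C.mTop C.side (by rintro _ rfl; exact ⟨1, C.side.target⟩)

/-- The submodule `Mag(M, φ) = cl (ker ((-m₋) ⊕ m₊))` of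
`H₁^{φ₋}(F_{g₋}, ⋆) ⊕ H₁^{φ₊}(F_{g₊}, ⋆)`. -/
def Mag [IsDomain R] (φ : C.H1M →* G) :
    Submodule R (TwistedH1 {star gBot} (C.phiBot φ) × TwistedH1 {star gTop} (C.phiTop φ)) :=
  closure (LinearMap.ker ((-C.twistedBot φ).coprod (C.twistedTop φ)))

end CobordismData

end Mag

/-! ## The handlebodies -/

/-- The identification of `∂D² × [-1, 1]` in the `i`-th `2`-handle `D² × [-1, 1]` with the annulus
`c i` in `F_g × {e}`. -/
inductive HandleRel {g : ℕ} (c : Fin g → C(Circle × J, Surface g)) (e : J) :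
    (Surface g × J) ⊕ (Fin g × Metric.closedBall (0 : ℂ) 1 × J) →
      (Surface g × J) ⊕ (Fin g × Metric.closedBall (0 : ℂ) 1 × J) → Prop
  | glue (i : Fin g) (u : Circle) (t : J) :
      HandleRel c e (Sum.inl (c i (u, t), e))
        (Sum.inr (i, ⟨(u : ℂ), by simp [Circle.norm_coe]⟩, t))

/-- The space obtained from `F_g × [-1, 1]` by attaching `g` `2`-handles along the annuli
`c i × {e}`. -/
def Handlebody {g : ℕ} (c : Fin g → C(Circle × J, Surface g)) (e : J) : Type :=
  Quot (HandleRel c e)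

instance {g : ℕ} (c : Fin g → C(Circle × J, Surface g)) (e : J) :
    TopologicalSpace (Handlebody c e) :=
  inferInstanceAs (TopologicalSpace (Quot (HandleRel c e)))

/-- The image of `F_g × [-1, 1]` in the handlebody. -/
def Handlebody.cyl {g : ℕ} (c : Fin g → C(Circle × J, Surface g)) (e : J) :
    C(Surface g × J, Handlebody c e) where
  toFun x := Quot.mk _ (Sum.inl x)
  continuous_toFun := continuous_quot_mk.comp continuous_inl

/-- The inclusion `x ↦ (x, t)` of `F_g` as `F_g × {t}`. -/
def Handlebody.level {g : ℕ} (c : Fin g → C(Circle × J, Surface g)) (e t : J) :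
    C(Surface g, Handlebody c e) :=
  (Handlebody.cyl c e).comp ((ContinuousMap.id _).prodMk (ContinuousMap.const _ t))

/-- The vertical segment `⋆ × [-1, 1]`. -/
def Handlebody.side {g : ℕ} (c : Fin g → C(Circle × J, Surface g)) (e : J) :
    Path (Handlebody.level c e jBot (star g)) (Handlebody.level c e jTop (star g)) where
  toFun t := Handlebody.cyl c e (star g, ⟨2 * (t : ℝ) - 1, by
    have := t.2.1; have := t.2.2; constructor <;> linarith⟩)
  continuous_toFun := by fun_prop
  source' := by simp [Handlebody.level, jBot]
  target' := by
    simp only [Handlebody.level, jTop, ContinuousMap.comp_apply]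
    congr 3
    norm_num

/-- The handlebody underlying `C_0^g`: the `2`-handles are attached along the meridians in
`F_g × {-1}`. -/
abbrev LowerSpace (g : ℕ) : Type := Handlebody (annulusA g) jBot

/-- The handlebody underlying `C_g^0`: the `2`-handles are attached along the parallels in
`F_g × {1}`. -/
abbrev UpperSpace (g : ℕ) : Type := Handlebody (annulusB g) jTop

/-- The lower handlebody `C_0^g`. The top is `F_g × {1}`; the bottom is the disk obtained from
`F_g × {-1}` by surgery along the meridians, and `d` is its parametrization by the disk `F_0`
(unique up to isotopy; any continuous map `d` that preserves the base points is allowed here). -/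
def lowerHandlebody (g : ℕ) (d : C(Surface 0, LowerSpace g))
    (hd : d (star 0) = Handlebody.level (annulusA g) jBot jBot (star g)) : CobordismData 0 g where
  M := LowerSpace g
  mBot := d
  mTop := Handlebody.level (annulusA g) jBot jTop
  side := (Handlebody.side (annulusA g) jBot).cast hd rfl

/-- The upper handlebody `C_g^0`. The bottom is `F_g × {-1}`; the top is the disk obtained from
`F_g × {1}` by surgery along the parallels, and `d` is its parametrization by the disk `F_0`
(unique up to isotopy; any continuous map `d` that preserves the base points is allowed here). -/
def upperHandlebody (g : ℕ) (d : C(Surface 0, UpperSpace g))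
    (hd : d (star 0) = Handlebody.level (annulusB g) jTop jTop (star g)) : CobordismData g 0 where
  M := UpperSpace g
  mBot := Handlebody.level (annulusB g) jTop jBot
  mTop := d
  side := (Handlebody.side (annulusB g) jTop).cast rfl hd

end Magnus

end

noncomputable section

namespace Magnus

open Set

/-! ## Edges in the twisted chain complex -/

section Edges

variable {X : Type*} [TopologicalSpace X] {x₀ : X} {R : Type*} [CommRing R] {G : Subgroup Rˣ}

/-! The proof is a computation with fundamental groupoids. In the twisted 1-chains modulo
boundaries, a path with a chosen lift of its source has a class `edge`, which is invariant under
homotopy and additive under concatenation. Hence `loopClass` is a crossed homomorphism, `[p q] = [p]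
+ φ(p) [q]`. Coning off end points shows that its values span the twisted homology
(`span_loopClass_eq_top`), so a family of loops that generates the fundamental group yields a
generating family of the module.

Linear forms come from homomorphisms to the group of affine maps `x ↦ t + u x`: if the linear part
is `φ`, then the translation part is a crossed homomorphism and defines a form
(`exists_linearForm`). Such homomorphisms with arbitrary translation parts on the generators exist
as soon as the space maps to a wedge of circles and takes the generators to the circles, because the
groupoid of a wedge maps to any group with prescribed values on the circles
(`exists_wedge_holonomy`, the monodromy of a covering with two charts). The outcome is
`exists_wedge_form`.

The geometric input is as follows. The surface is a rectangle with `2g` one-handles, so the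
meridians and parallels generate its fundamental group, and collapsing the rectangle maps it to a
wedge of `2g` circles. They therefore form a basis of the twisted homology, which vanishes for the
disk. A handlebody is a cylinder with two-handles. These add no generators and make the attaching
curves (`kill`) contractible, and the collapse, with the circles of `kill` forgotten, extends over
the handles. So the map induced by the surface kills half of the basis and takes the other half
(`keep`) to a family with dual linear forms. Its kernel is the span of the killed half, and closing
it up adds nothing over a domain (`closure_ker_eq_span`). Exchanging `kill` and `keep` passes from
one handlebody to the other. -/

/-- The value of `φ` on the class of a loop, as an element of `R`. -/
def weight (φ : H1 X x₀ →* G) (l : Path.Homotopic.Quotient x₀ x₀) : R :=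
  ((φ (Abelianization.of (FundamentalGroup.fromPath l)) : G) : Rˣ)

/-- Multiplication in `FundamentalGroup` reverses concatenation; the order is lost because the
values of `φ` commute. -/
theorem weight_trans (φ : H1 X x₀ →* G) (l m : Path.Homotopic.Quotient x₀ x₀) :
    weight φ (l.trans m) = weight φ l * weight φ m := by
  have h : FundamentalGroup.fromPath (l.trans m) =
      FundamentalGroup.fromPath m * FundamentalGroup.fromPath l := rfl
  rw [weight, h, map_mul, map_mul, mul_comm]
  simp [weight]

theorem weight_refl (φ : H1 X x₀ →* G) : weight φ (.refl x₀) = 1 := by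
  have h : FundamentalGroup.fromPath (.refl x₀) = (1 : FundamentalGroup X x₀) := rfl
  rw [weight, h, map_one, map_one]
  simp

/-- The twisted `1`-chains modulo boundaries. -/
abbrev ChainModBoundaries (A : Set X) (φ : H1 X x₀ →* G) : Type _ :=
  Chain A φ 1 ⧸ LinearMap.range (boundary A φ 1)

/-- The class of a lifted `1`-simplex modulo boundaries. -/
def simplexClass (A : Set X) (φ : H1 X x₀ →* G) (s : LiftedSimplex x₀ 1) :
    ChainModBoundaries A φ :=
  Submodule.Quotient.mk (Submodule.Quotient.mk (Finsupp.single s (1 : R)))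

/-- A path `p` together with a class of paths from the base point to its source, as a lifted
`1`-simplex. -/
def liftPath {a b : X} (γ : Path.Homotopic.Quotient x₀ a) (p : Path a b) : LiftedSimplex x₀ 1 where
  simplex := pathSimplex p
  start := γ.cast rfl (pathSimplex_vertex_zero p)

/-- The class of a lifted path modulo boundaries. -/
def edge (A : Set X) (φ : H1 X x₀ →* G) {a b : X} (γ : Path.Homotopic.Quotient x₀ a)
    (p : Path a b) : ChainModBoundaries A φ :=
  simplexClass A φ (liftPath γ p)

/-- The path underlying a singular `1`-simplex. -/
def simplexPath (σ : C(Simplex 1, X)) :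
    Path (σ (stdSimplex.vertex 0)) (σ (stdSimplex.vertex 1)) :=
  (vertexPath 0 1).map σ.continuous

theorem pathSimplex_vertexPath_map {n : ℕ} (σ : C(Simplex n, X)) (i j : Fin (n + 1))
    (t : Simplex 1) :
    pathSimplex ((vertexPath i j).map σ.continuous) t = σ (stdSimplex.map ![i, j] t) := by
  change σ (stdSimplex.map ![i, j] (stdSimplexHomeomorphUnitInterval.symm
    (stdSimplexHomeomorphUnitInterval t))) = _
  rw [Homeomorph.symm_apply_apply]

theorem vertexPath_self {n : ℕ} (i : Fin (n + 1)) : vertexPath i i = Path.refl _ := by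
  ext1
  funext t
  have h2 : (![i, i] : Fin 2 → Fin (n + 1)) = fun _ => i := by ext k; fin_cases k <;> rfl
  change stdSimplex.map ![i, i] _ = _
  rw [h2]
  exact (stdSimplex.map_comp_apply (fun _ : Fin 2 => (0 : Fin 1)) (fun _ => i) _).symm.trans
    ((congrArg _ (Subsingleton.elim _ (stdSimplex.vertex 0))).trans (stdSimplex.map_vertex _ _))

theorem map_id_simplex (t : Simplex 1) : stdSimplex.map ![0, 1] t = t := by
  have : (![0, 1] : Fin 2 → Fin 2) = id := by ext i; fin_cases i <;> rfl
  rw [this, stdSimplex.map_id_apply]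

theorem LiftedSimplex.ext_of_eq {n : ℕ} {s s' : LiftedSimplex x₀ n} (h : s.simplex = s'.simplex)
    (hs : s.start = s'.start.cast rfl (by rw [h])) : s = s' := by
  obtain ⟨σ, γ⟩ := s
  obtain ⟨σ', γ'⟩ := s'
  obtain rfl : σ = σ' := h
  simp only [Path.Homotopic.Quotient.cast_rfl_rfl] at hs
  rw [hs]

theorem simplexClass_eq_edge (A : Set X) (φ : H1 X x₀ →* G) (s : LiftedSimplex x₀ 1) :
    simplexClass A φ s = edge A φ s.start (simplexPath s.simplex) := by
  unfold edge
  congr 1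
  refine LiftedSimplex.ext_of_eq ?_ ?_
  · ext t
    exact ((pathSimplex_vertexPath_map s.simplex 0 1 t).trans
      (congrArg s.simplex (map_id_simplex t))).symm
  · exact ((Path.Homotopic.Quotient.cast_cast _ _ _ _ _).trans
      (Path.Homotopic.Quotient.cast_rfl_rfl _)).symm

/-- The boundary of `s` vanishes in the quotient; the middle face carries the negative sign. -/
theorem simplexClass_face (A : Set X) (φ : H1 X x₀ →* G) (s : LiftedSimplex x₀ 2) :
    simplexClass A φ (s.face 0) + simplexClass A φ (s.face 2) =
      simplexClass A φ (s.face 1) := by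
  have h : (Submodule.Quotient.mk (boundary A φ 1 (Submodule.Quotient.mk (Finsupp.single s 1))) :
      ChainModBoundaries A φ) = 0 := (Submodule.Quotient.mk_eq_zero _).2 ⟨_, rfl⟩
  have h2 : boundary A φ 1 (Submodule.Quotient.mk (Finsupp.single s 1)) =
      Submodule.Quotient.mk (Finsupp.single (s.face 0) 1) -
        Submodule.Quotient.mk (Finsupp.single (s.face 1) 1) +
        Submodule.Quotient.mk (Finsupp.single (s.face 2) 1) := by
    rw [← Submodule.Quotient.mk_sub, ← Submodule.Quotient.mk_add]
    refine congrArg Submodule.Quotient.mk ?_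
    simp [freeBoundary, Fin.sum_univ_three, sub_eq_add_neg]
  rw [h2, Submodule.Quotient.mk_add, Submodule.Quotient.mk_sub] at h
  rw [← sub_eq_zero, ← h]
  simp only [simplexClass]
  abel

/-- Only face `0` loses the vertex `0`, so only its lift moves, along the edge from `0` to `1`; the
other two faces keep `γ`. -/
theorem edge_triangle_vertexPath (A : Set X) (φ : H1 X x₀ →* G) (σ : C(Simplex 2, X))
    (γ : Path.Homotopic.Quotient x₀ (σ (stdSimplex.vertex 0))) :
    edge A φ γ ((vertexPath 0 1).map σ.continuous) +
        edge A φ (γ.trans (.mk ((vertexPath 0 1).map σ.continuous)))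
          ((vertexPath 1 2).map σ.continuous) =
      edge A φ γ ((vertexPath 0 2).map σ.continuous) := by
  have key : ∀ (i : Fin 3) (a b : Fin 3) (h : i.succAbove = ![a, b])
      (δ : Path.Homotopic.Quotient x₀ (σ (stdSimplex.vertex a)))
      (_ : δ = γ.trans (.mk ((vertexPath 0 a).map σ.continuous))),
      simplexClass A φ (LiftedSimplex.face ⟨σ, γ⟩ i) =
        edge A φ δ ((vertexPath a b).map σ.continuous) := by
    intro i a b h δ hδ
    have h0 : i.succAbove 0 = a := congrFun h 0
    subst hδ
    unfold edge
    congr 1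
    refine LiftedSimplex.ext_of_eq ?_ ?_
    · ext t
      refine (?_ : _ = _).trans (pathSimplex_vertexPath_map σ a b t).symm
      rw [← h]; rfl
    · subst h0
      exact (Path.Homotopic.Quotient.cast_cast _ _ _ _ _).symm
  have hrefl : γ = γ.trans (.mk ((vertexPath 0 0).map σ.continuous)) := by
    rw [vertexPath_self]
    exact (Path.Homotopic.Quotient.trans_refl γ).symm
  have := simplexClass_face A φ (⟨σ, γ⟩ : LiftedSimplex x₀ 2)
  rw [key 0 1 2 (by ext i; fin_cases i <;> rfl) _ rfl,
    key 1 0 2 (by ext i; fin_cases i <;> rfl) γ hrefl,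
    key 2 0 1 (by ext i; fin_cases i <;> rfl) γ hrefl] at this
  rw [add_comm]
  exact this

/-- Here the end points agree with the vertices of `σ` only propositionally, which spares casts in
the applications. -/
theorem edge_triangle (A : Set X) (φ : H1 X x₀ →* G) (σ : C(Simplex 2, X)) {a b c : X}
    (γ : Path.Homotopic.Quotient x₀ a) (p : Path a b) (q : Path b c) (r : Path a c)
    (hp : ∀ t : Simplex 1, p (stdSimplexHomeomorphUnitInterval t) = σ (stdSimplex.map ![0, 1] t))
    (hq : ∀ t : Simplex 1, q (stdSimplexHomeomorphUnitInterval t) = σ (stdSimplex.map ![1, 2] t))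
    (hr : ∀ t : Simplex 1, r (stdSimplexHomeomorphUnitInterval t) = σ (stdSimplex.map ![0, 2] t)) :
    edge A φ γ p + edge A φ (γ.trans (.mk p)) q = edge A φ γ r := by
  have key : ∀ {u v : X} (s : Path u v) (i j : Fin 3),
      (∀ t : Simplex 1, s (stdSimplexHomeomorphUnitInterval t) = σ (stdSimplex.map ![i, j] t)) →
      ∀ t, s t = ((vertexPath i j).map σ.continuous) t := by
    intro u v s i j h t
    rw [← stdSimplexHomeomorphUnitInterval.apply_symm_apply t, h]
    exact (pathSimplex_vertexPath_map σ i j _).symm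
  have kp := key p 0 1 hp
  have kq := key q 1 2 hq
  have kr := key r 0 2 hr
  obtain rfl : a = σ (stdSimplex.vertex 0) := by rw [← p.source, kp, Path.source]
  obtain rfl : b = σ (stdSimplex.vertex 1) := by rw [← p.target, kp, Path.target]
  obtain rfl : c = σ (stdSimplex.vertex 2) := by rw [← q.target, kq, Path.target]
  obtain rfl : p = (vertexPath 0 1).map σ.continuous := Path.ext (funext kp)
  obtain rfl : q = (vertexPath 1 2).map σ.continuous := Path.ext (funext kq)
  obtain rfl : r = (vertexPath 0 2).map σ.continuous := Path.ext (funext kr)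
  exact edge_triangle_vertexPath A φ σ γ

/-- A constant triangle gives `e + e = e`. -/
theorem edge_refl (A : Set X) (φ : H1 X x₀ →* G) {a : X} (γ : Path.Homotopic.Quotient x₀ a) :
    edge A φ γ (Path.refl a) = 0 := by
  have h := edge_triangle A φ (ContinuousMap.const _ a) γ (Path.refl a) (Path.refl a) (Path.refl a)
    (fun _ => rfl) (fun _ => rfl) (fun _ => rfl)
  rw [Path.Homotopic.Quotient.mk_refl, Path.Homotopic.Quotient.trans_refl] at h
  exact add_eq_left.1 h

/-- The continuous map `Δ² → ℝ` that is affine with the values `0`, `u`, `v` at the vertices. -/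
def affineOnTriangle (u v : ℝ) : C(Simplex 2, ℝ) where
  toFun x := u * x 1 + v * x 2
  continuous_toFun := by
    have h (i : Fin 3) : Continuous fun x : Simplex 2 => x i :=
      (continuous_apply i).comp continuous_subtype_val
    exact (continuous_const.mul (h 1)).add (continuous_const.mul (h 2))

theorem affineOnTriangle_map (u v : ℝ) (i j : Fin 3) (t : Simplex 1) :
    affineOnTriangle u v (stdSimplex.map ![i, j] t) =
      ![0, u, v] i * (1 - (stdSimplexHomeomorphUnitInterval t : ℝ)) +
        ![0, u, v] j * (stdSimplexHomeomorphUnitInterval t : ℝ) := by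
  have h2 : t 0 + t 1 = 1 := stdSimplex.add_eq_one t
  have h3 : (stdSimplexHomeomorphUnitInterval t : ℝ) = t 1 := rfl
  rw [h3, ← h2, add_sub_cancel_right]
  change u * (stdSimplex.map ![i, j] t : Fin 3 → ℝ) 1 +
    v * (stdSimplex.map ![i, j] t : Fin 3 → ℝ) 2 = _
  simp only [stdSimplex.map_coe, FunOnFinite.linearMap_apply_apply, Finset.sum_filter,
    Fin.sum_univ_two]
  fin_cases i <;> fin_cases j <;> simp <;> ring_nf

/-- The concatenation, extended to the line and composed with the affine function with values `0`,
`1/2`, `1` at the vertices, is a degenerate triangle with edges `p`, `q` and `p.trans q`. -/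
theorem edge_trans (A : Set X) (φ : H1 X x₀ →* G) {a b c : X}
    (γ : Path.Homotopic.Quotient x₀ a) (p : Path a b) (q : Path b c) :
    edge A φ γ (p.trans q) = edge A φ γ p + edge A φ (γ.trans (.mk p)) q := by
  refine (edge_triangle A φ ((⟨(p.trans q).extend, (p.trans q).continuous_extend⟩ : C(ℝ, X)).comp
    (affineOnTriangle (1 / 2) 1)) γ p q (p.trans q) ?_ ?_ ?_).symm
  all_goals
    intro t
    simp only [ContinuousMap.comp_apply, ContinuousMap.coe_mk, affineOnTriangle_map]
    generalize stdSimplexHomeomorphUnitInterval t = s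
    have h0 := s.2.1
    have h1 := s.2.2
    simp only [Matrix.cons_val]
  · rw [Path.extend_apply _ (by constructor <;> linarith), Path.trans_apply,
      dif_pos (by simp; linarith)]
    congr 1
    ext
    simp
  -- At `s = 0` the parameter is exactly `1/2`, where the concatenation is computed by its first
  -- branch.
  · rcases eq_or_lt_of_le h0 with h | h
    · obtain rfl : s = 0 := Subtype.ext h.symm
      rw [q.source, Path.extend_apply _ (by norm_num), Path.trans_apply, dif_pos (by norm_num)]
      convert p.target.symm using 2
      ext
      norm_num
    rw [Path.extend_apply _ (by constructor <;> linarith), Path.trans_apply,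
      dif_neg (by simp; linarith)]
    congr 1
    ext
    simp
    ring
  · rw [← Path.extend_extends' (p.trans q)]
    congr 1
    ring

/-- The square of the homotopy is cut along its diagonal. Each of the two triangles has one constant
edge, so `p` and `q` both have the class of the diagonal `d`. -/
theorem edge_homotopic (A : Set X) (φ : H1 X x₀ →* G) {a b : X}
    (γ : Path.Homotopic.Quotient x₀ a) {p q : Path a b} (h : p.Homotopic q) :
    edge A φ γ p = edge A φ γ q := by
  obtain ⟨F⟩ := h
  let c : C(ℝ × ℝ, X) := F.toContinuousMap.comp
    ⟨fun x => (projIcc 0 1 zero_le_one x.1, projIcc 0 1 zero_le_one x.2), by fun_prop⟩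
  let d : Path a b :=
    { toFun t := F (t, t)
      continuous_toFun := by fun_prop
      source' := by simp
      target' := by simp }
  have hc (s t : ℝ) : c (s, t) = F (projIcc 0 1 zero_le_one s, projIcc 0 1 zero_le_one t) := rfl
  have h1 := edge_triangle A φ (c.comp ((affineOnTriangle 0 1).prodMk (affineOnTriangle 1 1)))
    γ p (Path.refl b) d
  have h2 := edge_triangle A φ (c.comp ((affineOnTriangle 1 1).prodMk (affineOnTriangle 0 1)))
    γ (Path.refl a) q d
  simp only [ContinuousMap.comp_apply, ContinuousMap.prod_eval, hc, affineOnTriangle_map,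
    Matrix.cons_val] at h1 h2
  rw [edge_refl, add_zero] at h1
  rw [edge_refl, zero_add, Path.Homotopic.Quotient.mk_refl,
    Path.Homotopic.Quotient.trans_refl] at h2
  rw [h1, h2]
  all_goals
    intro t
    generalize stdSimplexHomeomorphUnitInterval t = s
    simp [d]

theorem mk_single_translate (A : Set X) (φ : H1 X x₀ →* G) {n : ℕ} (l : FundamentalGroup X x₀)
    (s : LiftedSimplex x₀ n) :
    (Submodule.Quotient.mk (Finsupp.single (s.translate l) (1 : R)) : Chain A φ n) =
      weight φ (FundamentalGroup.toPath l) • Submodule.Quotient.mk (Finsupp.single s (1 : R)) := by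
  rw [← Submodule.Quotient.mk_smul, Submodule.Quotient.eq, Finsupp.smul_single, smul_eq_mul,
    mul_one]
  exact Submodule.subset_span (Or.inl ⟨l, s, rfl⟩)

theorem edge_translate (A : Set X) (φ : H1 X x₀ →* G) {a b : X}
    (l : Path.Homotopic.Quotient x₀ x₀) (γ : Path.Homotopic.Quotient x₀ a) (p : Path a b) :
    edge A φ (l.trans γ) p = weight φ l • edge A φ γ p := by
  have h : liftPath (l.trans γ) p = (liftPath γ p).translate (FundamentalGroup.fromPath l) := by
    have key : ∀ {c : X} (h : c = a), (l.trans γ).cast rfl h = l.trans (γ.cast rfl h) := by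
      intro c h
      subst h
      simp only [Path.Homotopic.Quotient.cast_rfl_rfl]
    exact congrArg (LiftedSimplex.mk (pathSimplex p)) (key (pathSimplex_vertex_zero p))
  rw [edge, simplexClass, h, mk_single_translate, Submodule.Quotient.mk_smul]
  rfl

theorem edge_symm (A : Set X) (φ : H1 X x₀ →* G) {a b : X}
    (γ : Path.Homotopic.Quotient x₀ a) (p : Path b a) :
    edge A φ γ p.symm = -edge A φ (γ.trans (.mk p.symm)) p := by
  have h := edge_trans A φ γ p.symm p
  rw [edge_homotopic A φ γ (Path.Homotopic.symm_trans p), edge_refl] at h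
  exact eq_neg_of_add_eq_zero_left h.symm

/-- The twisted homology is contained in the chains modulo boundaries. -/
def homologyToChains (A : Set X) (φ : H1 X x₀ →* G) :
    TwistedH1 A φ →ₗ[R] ChainModBoundaries A φ :=
  Submodule.mapQ _ _ (LinearMap.ker (boundary A φ 0)).subtype fun _ h => h

/-- The same boundaries are divided out on both sides, so a cycle that vanishes modulo boundaries
already vanishes in homology. Identities in homology can thus be checked on edges. -/
theorem homologyToChains_injective (A : Set X) (φ : H1 X x₀ →* G) :
    Function.Injective (homologyToChains A φ) := by
  rw [← LinearMap.ker_eq_bot, LinearMap.ker_eq_bot']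
  intro x
  induction x using Submodule.Quotient.induction_on with
  | H c =>
    intro h
    exact (Submodule.Quotient.mk_eq_zero _).2 
      ((Submodule.Quotient.mk_eq_zero (LinearMap.range (boundary A φ 1)) (x := c.1)).1 h)

theorem homologyToChains_loopClass (φ : H1 X x₀ →* G) (p : Path x₀ x₀) :
    homologyToChains {x₀} φ (loopClass φ p) = edge {x₀} φ (.refl x₀) p := rfl

theorem loopClass_homotopic (φ : H1 X x₀ →* G) {p q : Path x₀ x₀} (h : p.Homotopic q) :
    loopClass φ p = loopClass φ q :=
  homologyToChains_injective _ _ (edge_homotopic _ φ _ h)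

/-- The lift of the second loop starts where the lift of the first ends, at a translate of the
preferred base point; this produces the factor `weight`. -/
theorem loopClass_trans (φ : H1 X x₀ →* G) (p q : Path x₀ x₀) :
    loopClass φ (p.trans q) = loopClass φ p + weight φ (.mk p) • loopClass φ q := by
  apply homologyToChains_injective
  rw [map_add, map_smul]
  simp only [homologyToChains_loopClass]
  rw [edge_trans, ← edge_translate, Path.Homotopic.Quotient.trans_refl,
    Path.Homotopic.Quotient.refl_trans]

theorem loopClass_refl (φ : H1 X x₀ →* G) : loopClass φ (Path.refl x₀) = 0 := by
  apply homologyToChains_injective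
  rw [map_zero]
  exact edge_refl _ _ _

theorem loopClass_symm (φ : H1 X x₀ →* G) (p : Path x₀ x₀) :
    loopClass φ p.symm = -(weight φ (.mk p.symm) • loopClass φ p) := by
  have h := loopClass_trans φ p.symm p
  rw [loopClass_homotopic φ (Path.Homotopic.symm_trans p), loopClass_refl] at h
  exact eq_neg_of_add_eq_zero_left h.symm

variable {Y : Type*} [TopologicalSpace Y] {y₀ : Y}

/-- The preferred lift of `x₀` goes to the lift of `f x₀` determined by `w`. The image loop is based
at `f x₀`, so it is described by an edge rather than by a loop class at `y₀`. -/
theorem homologyToChains_map_loopClass {B : Set Y} (φ : H1 Y y₀ →* G) (f : C(X, Y))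
    (w : Path y₀ (f x₀)) (hf : MapsTo f {x₀} B) (p : Path x₀ x₀) :
    homologyToChains B φ (TwistedH1.map φ f w hf (loopClass _ p)) =
      edge B φ (.mk w) (p.map f.continuous) := by
  have h : (liftLoop p).map f w = liftPath (.mk w) (p.map f.continuous) := by
    refine LiftedSimplex.ext_of_eq rfl ?_
    have key : ∀ {c : X} (h : c = x₀) (h' : f c = f x₀), (Path.Homotopic.Quotient.mk w).trans
        (((Path.Homotopic.Quotient.refl x₀).cast rfl h).map f) =
        (Path.Homotopic.Quotient.mk w).cast rfl h' := by
      intro c h h'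
      subst h
      simp only [Path.Homotopic.Quotient.cast_rfl_rfl]
      exact Path.Homotopic.Quotient.trans_refl _
    exact (key (pathSimplex_vertex_zero p) (congrArg f (pathSimplex_vertex_zero p))).trans
      (Path.Homotopic.Quotient.cast_cast _ _ _ _ _).symm
  have h2 : homologyToChains B φ (TwistedH1.map φ f w hf (loopClass _ p)) =
      Submodule.Quotient.mk (Submodule.Quotient.mk
        (freeMap R f w 1 (Finsupp.single (liftLoop p) 1))) := rfl
  rw [h2, freeMap, Finsupp.lmapDomain_apply, Finsupp.mapDomain_single, h]
  rfl

/-- A linear map on the twisted `0`-chains relative to the base point, given by a family of paths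
from the base point to all points. -/
def coneMap (φ : H1 X x₀ →* G) (w : ∀ x : X, Path x₀ x) (hw : w x₀ = Path.refl x₀) :
    Chain {x₀} φ 0 →ₗ[R] ChainModBoundaries {x₀} φ :=
  Submodule.liftQ _ (Finsupp.linearCombination R fun s : LiftedSimplex x₀ 0 =>
    weight φ (s.start.trans (.symm (.mk (w (s.simplex (stdSimplex.vertex 0)))))) •
      edge {x₀} φ (.refl x₀) (w (s.simplex (stdSimplex.vertex 0)))) (by
    refine Submodule.span_le.2 ?_
    rintro v (⟨l, s, rfl⟩ | ⟨s, hs, rfl⟩)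
    · simp only [SetLike.mem_coe, LinearMap.mem_ker, map_sub, Finsupp.linearCombination_single,
        one_smul, LiftedSimplex.translate, Path.Homotopic.Quotient.trans_assoc]
      rw [weight_trans, mul_smul]
      exact sub_self _
    · simp only [SetLike.mem_coe, LinearMap.mem_ker, Finsupp.linearCombination_single, one_smul]
      have h : ∀ x, x = x₀ → edge {x₀} φ (.refl x₀) (w x) = 0 := by
        rintro x rfl
        rw [hw, edge_refl]
      rw [h _ (hs ⟨_, rfl⟩), smul_zero])

theorem coneMap_single (φ : H1 X x₀ →* G) (w : ∀ x : X, Path x₀ x) (hw : w x₀ = Path.refl x₀)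
    (s : LiftedSimplex x₀ 0) {x : X} (hx : x = s.simplex (stdSimplex.vertex 0))
    {δ : Path.Homotopic.Quotient x₀ x} (hδ : s.start.cast rfl hx = δ) :
    coneMap φ w hw (Submodule.Quotient.mk (Finsupp.single s 1)) =
      weight φ (δ.trans (.symm (.mk (w x)))) •
        edge {x₀} φ (.refl x₀) (w x) := by
  subst hx hδ
  refine (Submodule.liftQ_apply _ _ _).trans ?_
  simp

/-- The twisted homology of a path-connected space relative to its base point is generated by the
classes of loops. -/
theorem span_loopClass_eq_top [PathConnectedSpace X] (φ : H1 X x₀ →* G) :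
    Submodule.span R (range (loopClass φ)) = ⊤ := by
  classical
  obtain ⟨w, hw⟩ : ∃ w : ∀ x : X, Path x₀ x, w x₀ = Path.refl x₀ := by
    refine ⟨Function.update (fun x => PathConnectedSpace.somePath x₀ x) x₀ (Path.refl x₀), ?_⟩
    simp
  -- For a path `p` from `a` to `b`, subtracting the cone on the boundary closes `p` up to the loop
  -- `w a · p · (w b)⁻¹`. A cycle has zero boundary, so it is itself a combination of loop classes.
  have key : ∀ c : Chain {x₀} φ 1,
      (Submodule.Quotient.mk c : ChainModBoundaries {x₀} φ) -
        coneMap φ w hw (boundary {x₀} φ 0 c) ∈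
      Submodule.map (homologyToChains {x₀} φ) (Submodule.span R (range (loopClass φ))) := by
    intro c
    induction c using Submodule.Quotient.induction_on with
    | H v =>
      induction v using Finsupp.induction_linear with
      | zero => simp
      | add a b ha hb =>
        rw [Submodule.Quotient.mk_add, Submodule.Quotient.mk_add, map_add, map_add,
          add_sub_add_comm]
        exact Submodule.add_mem _ ha hb
      | single s r =>
        have hr : Finsupp.single s r = r • Finsupp.single s (1 : R) := by simp
        rw [hr, Submodule.Quotient.mk_smul, Submodule.Quotient.mk_smul, map_smul, map_smul,
          ← smul_sub]
        refine Submodule.smul_mem _ _ ?_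
        have hb : boundary {x₀} φ 0 (Submodule.Quotient.mk (Finsupp.single s 1)) =
            Submodule.Quotient.mk (Finsupp.single (s.face 0) 1) -
              Submodule.Quotient.mk (Finsupp.single (s.face 1) 1) := by
          rw [← Submodule.Quotient.mk_sub]
          refine congrArg Submodule.Quotient.mk ?_
          simp [freeBoundary, Fin.sum_univ_two, sub_eq_add_neg]
        obtain ⟨σ, γ⟩ := s
        have hp : simplexClass {x₀} φ ⟨σ, γ⟩ = edge {x₀} φ γ (simplexPath σ) :=
          simplexClass_eq_edge _ _ _
        generalize hq : simplexPath σ = p at hp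
        -- Face `0` is the end point of the edge, reached by `γ` and then `p`; face `1` is its
        -- source, reached by `γ`.
        have e0 : (LiftedSimplex.face ⟨σ, γ⟩ 0).start.cast rfl
            (congrArg σ (stdSimplex.map_vertex (Fin.succAbove 0) (0 : Fin 1))).symm =
            γ.trans (.mk p) := by
          rw [← hq]
          exact (Path.Homotopic.Quotient.cast_cast _ _ _ _ _).trans
            (Path.Homotopic.Quotient.cast_rfl_rfl _)
        have e1 : (LiftedSimplex.face ⟨σ, γ⟩ 1).start.cast rfl
            (congrArg σ (stdSimplex.map_vertex (Fin.succAbove 1) (0 : Fin 1))).symm = γ := by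
          refine (Path.Homotopic.Quotient.cast_cast _ _ _ _ _).trans
            ((Path.Homotopic.Quotient.cast_rfl_rfl _).trans ?_)
          change γ.trans (.mk ((vertexPath 0 0).map σ.continuous)) = γ
          rw [vertexPath_self]
          exact Path.Homotopic.Quotient.trans_refl γ
        have h0 := coneMap_single φ w hw (x := σ (stdSimplex.vertex 1)) _ _ e0
        have h1 := coneMap_single φ w hw (x := σ (stdSimplex.vertex 0)) _ _ e1
        rw [hb, map_sub, h0, h1]
        refine ⟨weight φ (γ.trans (.symm (.mk (w _)))) •
          loopClass φ (((w _).trans p).trans (w _).symm),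
          Submodule.smul_mem _ _ (Submodule.subset_span ⟨_, rfl⟩), ?_⟩
        rw [map_smul, homologyToChains_loopClass, edge_trans, edge_trans, smul_add, smul_add,
          edge_symm, smul_neg]
        simp only [← edge_translate]
        change _ = simplexClass {x₀} φ ⟨σ, γ⟩ - _
        rw [hp]
        simp only [Path.Homotopic.Quotient.mk_trans, Path.Homotopic.Quotient.mk_symm,
          Path.Homotopic.Quotient.trans_assoc, Path.Homotopic.Quotient.refl_trans,
          Path.Homotopic.Quotient.trans_refl, symm_trans_cancel,
          Path.Homotopic.Quotient.symm_trans]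
        abel
  rw [eq_top_iff]
  intro x _
  induction x using Submodule.Quotient.induction_on with
  | H c =>
    obtain ⟨y, hy, hyx⟩ := key c.1
    rw [LinearMap.mem_ker.1 c.2, map_zero, sub_zero] at hyx
    rwa [← homologyToChains_injective _ _ (a₂ := Submodule.Quotient.mk c) hyx]

instance (n : ℕ) : SimplyConnectedSpace (Simplex n) :=
  haveI : ContractibleSpace (Simplex n) :=
    (convex_stdSimplex ℝ (Fin (n + 1))).contractibleSpace ⟨_, (stdSimplex.vertex (S := ℝ) 0).2⟩
  inferInstance

/-- A multiplicative `lin` and a function `tr` on path classes with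
`tr (p * q) = tr p + lin p * tr q` define a linear form on chains modulo boundaries. -/
theorem exists_linearForm (A : Set X) (φ : H1 X x₀ →* G)
    (lin tr : ∀ {a b : X}, Path.Homotopic.Quotient a b → R)
    (hlin : ∀ {a b c : X} (p : Path.Homotopic.Quotient a b) (q : Path.Homotopic.Quotient b c),
      lin (p.trans q) = lin p * lin q)
    (htr : ∀ {a b c : X} (p : Path.Homotopic.Quotient a b) (q : Path.Homotopic.Quotient b c),
      tr (p.trans q) = tr p + lin p * tr q)
    (hφ : ∀ l : Path.Homotopic.Quotient x₀ x₀, weight φ l = lin l)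
    (hA : ∀ {a b : X} (p : Path a b), (∀ t, p t ∈ A) → tr (.mk p) = 0) :
    ∃ F : ChainModBoundaries A φ →ₗ[R] R, ∀ {a b : X} (γ : Path.Homotopic.Quotient x₀ a)
      (p : Path a b), F (edge A φ γ p) = lin γ * tr (.mk p) := by
  have lin_cast : ∀ {a b b' : X} (γ : Path.Homotopic.Quotient a b) (h : b' = b),
      lin (γ.cast rfl h) = lin γ := by
    rintro a b _ γ rfl
    rw [Path.Homotopic.Quotient.cast_rfl_rfl]
  have tr_congr : ∀ {a b a' b' : X} (p : Path a b) (p' : Path a' b'), (∀ t, p t = p' t) →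
      tr (.mk p) = tr (.mk p') := by
    intro a b a' b' p p' h
    obtain rfl : a = a' := by rw [← p.source, ← p'.source, h]
    obtain rfl : b = b' := by rw [← p.target, ← p'.target, h]
    rw [Path.ext (funext h)]
  -- The translation part along the edge is transported to the base point by the linear part along
  -- the lift.
  let val : LiftedSimplex x₀ 1 → R := fun s => lin s.start * tr (.mk (simplexPath s.simplex))
  let f : Chain A φ 1 →ₗ[R] R := Submodule.liftQ _ (Finsupp.linearCombination R val) (by
    refine Submodule.span_le.2 ?_
    rintro v (⟨l, s, rfl⟩ | ⟨s, hs, rfl⟩)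
    · simp only [SetLike.mem_coe, LinearMap.mem_ker, map_sub, Finsupp.linearCombination_single,
        one_smul, LiftedSimplex.translate, val]
      rw [hlin, ← hφ, mul_assoc]
      exact sub_self _
    · simp only [SetLike.mem_coe, LinearMap.mem_ker, Finsupp.linearCombination_single, one_smul,
        val]
      rw [hA _ fun t => hs ⟨_, rfl⟩, mul_zero])
  have f_single : ∀ s, f (Submodule.Quotient.mk (Finsupp.single s 1)) = val s := by
    intro s
    refine (Submodule.liftQ_apply _ _ _).trans ?_
    simp
  have f_boundary : ∀ c, f (boundary A φ 1 c) = 0 := by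
    intro c
    induction c using Submodule.Quotient.induction_on with
    | H v =>
      induction v using Finsupp.induction_linear with
      | zero => simp
      | add a b ha hb => rw [Submodule.Quotient.mk_add, map_add, map_add, ha, hb, add_zero]
      | single s r =>
        have hr : Finsupp.single s r = r • Finsupp.single s (1 : R) := by simp
        have hb : boundary A φ 1 (Submodule.Quotient.mk (Finsupp.single s 1)) =
            Submodule.Quotient.mk (Finsupp.single (s.face 0) 1) -
              Submodule.Quotient.mk (Finsupp.single (s.face 1) 1) +
              Submodule.Quotient.mk (Finsupp.single (s.face 2) 1) := by
          rw [← Submodule.Quotient.mk_sub, ← Submodule.Quotient.mk_add]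
          refine congrArg Submodule.Quotient.mk ?_
          simp [freeBoundary, Fin.sum_univ_three, sub_eq_add_neg]
        rw [hr, Submodule.Quotient.mk_smul, map_smul, map_smul, hb, map_add, map_sub, f_single,
          f_single, f_single]
        obtain ⟨σ, γ⟩ := s
        have key : ∀ (i : Fin 3) (a b : Fin 3) (_ : i.succAbove = ![a, b]),
            val (LiftedSimplex.face ⟨σ, γ⟩ i) =
              lin (γ.trans (.mk ((vertexPath 0 a).map σ.continuous))) *
                tr (.mk ((vertexPath a b).map σ.continuous)) := by
          intro i a b h
          have h0 : i.succAbove 0 = a := congrFun h 0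
          subst h0
          simp only [val, LiftedSimplex.face]
          rw [lin_cast]
          congr 1
          refine tr_congr _ _ fun t => congrArg σ ?_
          change stdSimplex.map i.succAbove (stdSimplex.map ![0, 1] _) = _
          rw [map_id_simplex, h]
          rfl
        -- The simplex is simply connected, so two edges compose to the third; the product rule for
        -- `tr` then cancels the alternating sum of the faces.
        have tri : (Path.Homotopic.Quotient.mk ((vertexPath 0 1).map σ.continuous)).trans
            (.mk ((vertexPath 1 2).map σ.continuous)) =
              .mk ((vertexPath 0 2).map σ.continuous) := by
          rw [← Path.Homotopic.Quotient.mk_trans, ← Path.map_trans]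
          exact Path.Homotopic.Quotient.eq.2
            ((SimplyConnectedSpace.paths_homotopic _ _).map σ)
        have h00 : γ.trans (.mk ((vertexPath 0 0).map σ.continuous)) = γ := by
          rw [vertexPath_self]
          exact Path.Homotopic.Quotient.trans_refl γ
        rw [key 0 1 2 (by ext i; fin_cases i <;> rfl), key 1 0 2 (by ext i; fin_cases i <;> rfl),
          key 2 0 1 (by ext i; fin_cases i <;> rfl), h00, ← tri, htr, hlin, smul_eq_mul]
        ring
  refine ⟨Submodule.liftQ _ f ?_, ?_⟩
  · rintro _ ⟨c, rfl⟩
    exact f_boundary c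
  · intro a b γ p
    refine (Submodule.liftQ_apply _ _ _).trans ((f_single _).trans ?_)
    simp only [val, liftPath]
    rw [lin_cast]
    congr 1
    refine tr_congr _ _ fun t => ?_
    change p (stdSimplexHomeomorphUnitInterval (stdSimplex.map ![0, 1]
      (stdSimplexHomeomorphUnitInterval.symm t))) = p t
    rw [map_id_simplex, Homeomorph.apply_symm_apply]

end Edges

/-! ## Induction on paths along open covers, and holonomy -/

section Holonomy

open Topology unitInterval

variable {Y : Type*} [TopologicalSpace Y]

/-- A property of paths that is invariant under homotopy and stable under concatenation holds for
all paths if it holds for the paths inside the members of an open cover. -/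
theorem path_induction_openCover {κ : Type*} (U : κ → Set Y) (hU : ∀ k, IsOpen (U k))
    (hcov : ∀ y, ∃ k, y ∈ U k) (P : ∀ {a b : Y}, Path a b → Prop)
    (homotopic : ∀ {a b : Y} (p q : Path a b), p.Homotopic q → P p → P q)
    (trans : ∀ {a b c : Y} (p : Path a b) (q : Path b c), P p → P q → P (p.trans q))
    (mem : ∀ k {a b : Y} (p : Path a b), (∀ t, p t ∈ U k) → P p)
    {a b : Y} (p : Path a b) : P p := by
  obtain ⟨t, ht0, htm, ⟨N, hN⟩, ht⟩ := exists_monotone_Icc_subset_open_cover_unitInterval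
    (c := fun k => p ⁻¹' U k) (fun k => (hU k).preimage p.continuous)
    (fun s _ => mem_iUnion.2 (hcov (p s)))
  -- Initial segments of a Lebesgue subdivision; for large `n` this is all of `p`, up to a cast of
  -- the end points.
  have key : ∀ n, P (p.subpath (t 0) (t n)) := by
    intro n
    induction n with
    | zero =>
      obtain ⟨k, hk⟩ := hcov (p (t 0))
      refine mem k _ fun s => ?_
      rw [Path.subpath_self]
      exact hk
    | succ n ih =>
      obtain ⟨k, hk⟩ := ht n
      refine homotopic _ _ ⟨Path.Homotopy.subpathTransSubpath p (t 0) (t n) (t (n + 1))⟩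
        (trans _ _ ih (mem k _ fun s => ?_))
      have hs : p.subpath (t n) (t (n + 1)) s ∈ range (p.subpath (t n) (t (n + 1))) := ⟨s, rfl⟩
      rw [Path.range_subpath_of_le _ _ _ (htm n.le_succ)] at hs
      obtain ⟨r, hr, hrs⟩ := hs
      rw [← hrs]
      exact hk hr
  have cast : ∀ {a b a' b' : Y} (q : Path a b) (ha : a' = a) (hb : b' = b),
      P (q.cast ha hb) → P q := by
    rintro a b _ _ q rfl rfl h
    exact h
  have h := key N
  rw [ht0, hN N le_rfl, Path.subpath_zero_one] at h
  exact cast _ _ _ h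

variable {Γ : Type*} [Group Γ]

/-- The transition functions of the covering with two charts and transition function `g`. -/
def twoChartTransition (g : Y → Γ) : Bool → Bool → Y → Γ
  | true, false => g
  | false, true => fun x => (g x)⁻¹
  | _, _ => fun _ => 1

/-- Two trivial charts with fibre `Γ`, glued over `U ∩ V` by the locally constant function `g`, form
a covering of `Y`. Its monodromy along a path is right multiplication by an element of `Γ`, which is
the holonomy. -/
theorem exists_holonomy (U V : Set Y) (hU : IsOpen U) (hV : IsOpen V) (hUV : ∀ x, x ∈ U ∨ x ∈ V)
    (g : Y → Γ) (hg : ∀ x ∈ U ∩ V, ∀ᶠ y in 𝓝 x, g y = g x) :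
    ∃ hol : ∀ {a b : Y}, Path.Homotopic.Quotient a b → Γ,
      (∀ {a b c : Y} (p : Path.Homotopic.Quotient a b) (q : Path.Homotopic.Quotient b c),
        hol (p.trans q) = hol p * hol q) ∧
      (∀ {a b : Y} (p : Path a b), (∀ t, p t ∈ U) → hol (.mk p) = 1) ∧
      (∀ {a b : Y} (p : Path a b), a ∈ U → b ∈ U → (∀ t, p t ∈ V) →
        hol (.mk p) = g a * (g b)⁻¹) := by
  classical
  let _ : TopologicalSpace Γ := ⊥
  have _ : DiscreteTopology Γ := ⟨rfl⟩
  let c := twoChartTransition g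
  let base : Bool → Set Y := fun i => cond i U V
  have hbase : ∀ i, IsOpen (base i) := by rintro (_ | _); exacts [hV, hU]
  have hloc : ∀ i j, ∀ x ∈ base i ∩ base j, ∀ᶠ y in 𝓝 x, c i j y = c i j x := by
    rintro (_ | _) (_ | _) x hx
    · exact Filter.Eventually.of_forall fun _ => rfl
    · filter_upwards [hg x hx.symm] with y hy
      simp [c, twoChartTransition, hy]
    · exact hg x hx
    · exact Filter.Eventually.of_forall fun _ => rfl
  let Z : FiberBundleCore Bool Y Γ :=
    { baseSet := base
      isOpen_baseSet := hbase
      indexAt := fun x => decide (x ∈ U)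
      mem_baseSet_at := fun x => by
        by_cases h : x ∈ U
        · simp [h, base]
        · simpa [h, base] using (hUV x).resolve_left h
      -- Transitions multiply on the right, so that monodromy commutes with left translations of the
      -- fibre.
      coordChange := fun i j x v => v * c i j x
      coordChange_self := by rintro (_ | _) x _ v <;> exact mul_one v
      continuousOn_coordChange := by
        rintro i j ⟨x, v⟩ ⟨hx, -⟩
        refine ContinuousAt.continuousWithinAt (continuousAt_prod_of_discrete_right.2 ?_)
        refine (continuousAt_const (y := v * c i j x)).congr ?_
        filter_upwards [hloc i j x hx] with y hy
        exact congrArg (v * ·) hy.symm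
      coordChange_comp := by
        rintro (_ | _) (_ | _) (_ | _) x _ v <;> simp [c, twoChartTransition] }
  have cov : IsCoveringMap Z.proj := FiberBundle.isCoveringMap
  -- Over one chart a path lifts with constant fibre coordinate; the two factors `c` convert from
  -- and to the preferred charts at the end points.
  have lift : ∀ (k : Bool) {a b : Y} (p : Path a b), (∀ t, p t ∈ base k) → ∀ v : Γ,
      cov.monodromy (.mk p) ⟨⟨a, v⟩, rfl⟩ =
        ⟨⟨b, v * c (decide (a ∈ U)) k a * c k (decide (b ∈ U)) b⟩, rfl⟩ := by
    intro k a b p hp v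
    have cancel : ∀ i j x, c i j x * c j i x = 1 := by
      rintro (_ | _) (_ | _) x <;> simp [c, twoChartTransition]
    let u : Γ := v * c (decide (a ∈ U)) k a
    let f : I → Z.TotalSpace := fun t => (Z.localTriv k).toOpenPartialHomeomorph.symm (p t, u)
    have hf : Continuous f :=
      (Z.localTriv k).toOpenPartialHomeomorph.continuousOn_symm.comp_continuous
        (p.continuous.prodMk continuous_const) fun t => (Z.mem_localTriv_target k _).2 (hp t)
    have hval : ∀ t x, p t = x → f t = ⟨x, u * c k (decide (x ∈ U)) x⟩ := by
      rintro t _ rfl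
      rfl
    let q : Path (⟨a, v⟩ : Z.TotalSpace)
        (⟨b, v * c (decide (a ∈ U)) k a * c k (decide (b ∈ U)) b⟩ : Z.TotalSpace) :=
      { toFun := f
        continuous_toFun := hf
        source' := by
          rw [hval 0 a p.source, mul_assoc, cancel, mul_one]
        target' := hval 1 b p.target }
    have hq : (Path.Homotopic.Quotient.mk q).map ⟨Z.proj, cov.continuous⟩ =
        Path.Homotopic.Quotient.mk p := rfl
    exact (congrArg (fun l => cov.monodromy l ⟨⟨a, v⟩, rfl⟩) hq).symm.trans
      (cov.monodromy_map (.mk q))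
  -- Being a right multiplication is stable under concatenation, so it is enough to treat paths
  -- inside one chart.
  have exi : ∀ {a b : Y} (p : Path.Homotopic.Quotient a b), ∃ m : Γ, ∀ v : Γ,
      cov.monodromy p ⟨⟨a, v⟩, rfl⟩ = ⟨⟨b, v * m⟩, rfl⟩ := by
    intro a b p
    induction p using Path.Homotopic.Quotient.ind with
    | mk p =>
      refine path_induction_openCover base hbase (fun y => ⟨_, Z.mem_baseSet_at y⟩)
        (fun {a b} p => ∃ m : Γ, ∀ v : Γ,
          cov.monodromy (.mk p) ⟨⟨a, v⟩, rfl⟩ = ⟨⟨b, v * m⟩, rfl⟩) ?_ ?_ ?_ p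
      · intro a b p q h hp
        rwa [← Path.Homotopic.Quotient.eq.2 h]
      · rintro a b c p q ⟨m, hm⟩ ⟨m', hm'⟩
        refine ⟨m * m', fun v => ?_⟩
        rw [Path.Homotopic.Quotient.mk_trans, cov.monodromy_trans_apply, hm, hm', mul_assoc]
      · intro k a b p hp
        refine ⟨c (decide (a ∈ U)) k a * c k (decide (b ∈ U)) b, fun v => ?_⟩
        rw [lift k p hp, mul_assoc]
  choose hol hhol using @exi
  have uniq : ∀ {a b : Y} (p : Path.Homotopic.Quotient a b) (m : Γ),
      cov.monodromy p ⟨⟨a, (1 : Γ)⟩, rfl⟩ = ⟨⟨b, m⟩, rfl⟩ → hol p = m := by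
    intro a b p m h
    rw [hhol p 1, one_mul] at h
    have h2 := congrArg Subtype.val h
    exact eq_of_heq (Bundle.TotalSpace.mk.inj h2).2
  refine ⟨hol, ?_, ?_, ?_⟩
  · intro a b c p q
    refine uniq _ _ ?_
    rw [cov.monodromy_trans_apply, hhol p, hhol q, one_mul]
  · intro a b p hp
    have ha : a ∈ U := p.source ▸ hp 0
    have hb : b ∈ U := p.target ▸ hp 1
    refine uniq _ _ ?_
    rw [lift true p hp]
    simp [ha, hb, c, twoChartTransition]
  · intro a b p ha hb hp
    refine uniq _ _ ?_
    rw [lift false p hp]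
    simp [ha, hb, c, twoChartTransition]

/-! ### Holonomy on a wedge of circles -/

/-- The wedge of circles indexed by `ι`, inside the product. -/
def Wedge (ι : Type*) : Type _ :=
  {θ : ι → Circle // ∀ i j, i ≠ j → θ i = 1 ∨ θ j = 1}

instance (ι : Type*) : TopologicalSpace (Wedge ι) := instTopologicalSpaceSubtype

theorem circle_eq_of_im_eq_zero (z : Circle) (h : (z : ℂ).im = 0) : z = 1 ∨ (z : ℂ) = -1 := by
  have h1 : Complex.normSq z = 1 := by rw [Complex.normSq_eq_norm_sq, Circle.norm_coe, one_pow]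
  rw [Complex.normSq_apply, h, mul_zero, add_zero, mul_self_eq_one_iff] at h1
  rcases h1 with h1 | h1
  · left
    ext
    apply Complex.ext <;> simp [h, h1]
  · right
    apply Complex.ext <;> simp [h, h1]

/-- The fundamental groupoid of a wedge of circles maps to any group, with prescribed values on the
circles. -/
theorem exists_wedge_holonomy {ι : Type*} [Finite ι] (γ : ι → Γ) :
    ∃ hol : ∀ {a b : Wedge ι}, Path.Homotopic.Quotient a b → Γ,
      (∀ {a b c : Wedge ι} (p : Path.Homotopic.Quotient a b) (q : Path.Homotopic.Quotient b c),
        hol (p.trans q) = hol p * hol q) ∧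
      (∀ {a b : Wedge ι} (p : Path a b), (∀ t i, ((p t).1 i : ℂ) ≠ -1) → hol (.mk p) = 1) ∧
      (∀ {a b : Wedge ι} (p : Path a b) (i : ι), 0 < (a.1 i : ℂ).im → (b.1 i : ℂ).im < 0 →
        (∀ t, (p t).1 i ≠ 1) → hol (.mk p) = (γ i)⁻¹) ∧
      (∀ {a b : Wedge ι} (p : Path a b) (i : ι), (a.1 i : ℂ).im < 0 → 0 < (b.1 i : ℂ).im →
        (∀ t, (p t).1 i ≠ 1) → hol (.mk p) = γ i) := by
  classical
  have hcont : ∀ i : ι, Continuous fun θ : Wedge ι => (θ.1 i : ℂ) := fun i =>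
    continuous_subtype_val.comp ((continuous_apply i).comp continuous_subtype_val)
  have hone : ∀ (θ : Wedge ι) (i j : ι), i ≠ j → (θ.1 i : ℂ).im ≠ 0 → (θ.1 j : ℂ).im = 0 := by
    intro θ i j hij hi
    rcases θ.2 i j hij with h | h
    · simp [h] at hi
    · simp [h]
  have hcont' : ∀ i : ι, Continuous fun θ : Wedge ι => θ.1 i := fun i =>
    (continuous_apply i).comp continuous_subtype_val
  -- `U` omits the points opposite to the wedge point, and `V` omits the wedge point. They meet in
  -- open half circles, on which `g` is constant: `γ i` on the lower half of the circle `i`, and `1`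
  -- on every upper half.
  let U : Set (Wedge ι) := {θ | ∀ i, (θ.1 i : ℂ) ≠ -1}
  let V : Set (Wedge ι) := {θ | ∃ i, θ.1 i ≠ 1}
  let g : Wedge ι → Γ := fun θ => if h : ∃ i, (θ.1 i : ℂ).im < 0 then γ h.choose else 1
  have hneg : ∀ θ i, (θ.1 i : ℂ).im < 0 → g θ = γ i := by
    intro θ i hi
    have h : ∃ i, (θ.1 i : ℂ).im < 0 := ⟨i, hi⟩
    have h2 : h.choose = i := by
      by_contra hne
      exact h.choose_spec.ne (hone θ i _ (Ne.symm hne) hi.ne)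
    simp only [g, dif_pos h, h2]
  have hpos : ∀ θ i, 0 < (θ.1 i : ℂ).im → g θ = 1 := by
    intro θ i hi
    refine dif_neg ?_
    rintro ⟨j, hj⟩
    by_cases hij : i = j
    · subst hij
      exact lt_asymm hi hj
    · exact hj.ne (hone θ i j hij hi.ne')
  have hU : IsOpen U := by
    have : U = ⋂ i, {θ : Wedge ι | (θ.1 i : ℂ) ≠ -1} := by ext; simp [U]
    rw [this]
    exact isOpen_iInter_of_finite fun i => isOpen_ne_fun (hcont i) continuous_const
  have hV : IsOpen V := by
    have : V = ⋃ i, {θ : Wedge ι | θ.1 i ≠ 1} := by ext; simp [V]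
    rw [this]
    exact isOpen_iUnion fun i => isOpen_ne_fun (hcont' i) continuous_const
  have memU : ∀ θ i, (θ.1 i : ℂ).im ≠ 0 → θ ∈ U := by
    intro θ i hi j hj
    by_cases hij : i = j
    · subst hij
      simp [hj] at hi
    · rcases θ.2 i j hij with h | h
      · simp [h] at hi
      · rw [h] at hj
        have := congrArg Complex.re hj
        norm_num at this
  obtain ⟨hol, h1, h2, h3⟩ := exists_holonomy U V hU hV (fun θ => by
    by_cases h : ∃ i, θ.1 i ≠ 1
    · exact Or.inr h
    · left
      intro i hi
      push Not at h
      rw [h i] at hi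
      have := congrArg Complex.re hi
      norm_num at this) g (by
    rintro θ ⟨hu, i, hi⟩
    have him : (θ.1 i : ℂ).im ≠ 0 := fun h0 =>
      (circle_eq_of_im_eq_zero _ h0).elim hi (hu i)
    have hc : Continuous fun θ : Wedge ι => (θ.1 i : ℂ).im := Complex.continuous_im.comp (hcont i)
    rcases him.lt_or_gt with h | h
    · filter_upwards [(isOpen_lt hc continuous_const).mem_nhds h] with y hy
      rw [hneg y i hy, hneg θ i h]
    · filter_upwards [(isOpen_lt continuous_const hc).mem_nhds h] with y hy
      rw [hpos y i hy, hpos θ i h])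
  refine ⟨hol, h1, h2, ?_, ?_⟩
  · intro a b p i ha hb hp
    refine (h3 p (memU a i ha.ne') (memU b i hb.ne) fun t => ⟨i, hp t⟩).trans ?_
    rw [hpos a i ha, hneg b i hb, one_mul]
  · intro a b p i ha hb hp
    refine (h3 p (memU a i ha.ne) (memU b i hb.ne') fun t => ⟨i, hp t⟩).trans ?_
    rw [hneg a i ha, hpos b i hb, inv_one, mul_one]

end Holonomy

/-! ## Attaching handles -/

section Square

open unitInterval

variable {Y : Type*} [TopologicalSpace Y]

/-- The two ways around a square are homotopic. -/
theorem mk_trans_eq_of_square (F : C(I × I, Y)) {a b c d : Y} (p : Path a b) (v : Path b d)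
    (u : Path a c) (q : Path c d) (hp : ∀ t, p t = F (0, t)) (hv : ∀ s, v s = F (s, 1))
    (hu : ∀ s, u s = F (s, 0)) (hq : ∀ t, q t = F (1, t)) :
    (Path.Homotopic.Quotient.mk p).trans (.mk v) =
      (Path.Homotopic.Quotient.mk u).trans (.mk q) := by
  have : ContractibleSpace I := (convex_Icc (0 : ℝ) 1).contractibleSpace ⟨0, by simp⟩
  obtain rfl : a = F (0, 0) := by rw [← p.source, hp]
  obtain rfl : b = F (0, 1) := by rw [← p.target, hp]
  obtain rfl : c = F (1, 0) := by rw [← q.source, hq]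
  obtain rfl : d = F (1, 1) := by rw [← q.target, hq]
  let x : Path (0 : I) 1 := ⟨ContinuousMap.id _, rfl, rfl⟩
  obtain rfl : p = ((Path.refl (0 : I)).prod x).map F.continuous := Path.ext (funext hp)
  obtain rfl : v = (x.prod (Path.refl (1 : I))).map F.continuous := Path.ext (funext hv)
  obtain rfl : u = (x.prod (Path.refl (0 : I))).map F.continuous := Path.ext (funext hu)
  obtain rfl : q = ((Path.refl (1 : I)).prod x).map F.continuous := Path.ext (funext hq)
  rw [← Path.Homotopic.Quotient.mk_trans, ← Path.Homotopic.Quotient.mk_trans, ← Path.map_trans,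
    ← Path.map_trans]
  exact Path.Homotopic.Quotient.eq.2 ((SimplyConnectedSpace.paths_homotopic _ _).map F)

end Square

section Handles

open Topology unitInterval Metric

variable {X Y ι E T : Type*} [TopologicalSpace X] [TopologicalSpace Y] [TopologicalSpace ι]
  [NormedAddCommGroup E] [TopologicalSpace T]

/-- `Y` is obtained from `X` by attaching the handles `{i} × D × T`, where `D` is the unit ball of
`E`, along the maps `f` from `{i} × ∂D × T` to `X`. -/
structure IsHandleAttachment (j : C(X, Y)) (k : C(ι × closedBall (0 : E) 1 × T, Y))
    (f : C(ι × sphere (0 : E) 1 × T, X)) : Prop where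
  isQuotientMap : IsQuotientMap (Sum.elim j k)
  glue : ∀ i (u : sphere (0 : E) 1) t, k (i, ⟨u, sphere_subset_closedBall u.2⟩, t) = j (f (i, u, t))
  injective : Function.Injective j
  norm_eq_one : ∀ x z, k z = j x → ‖(z.2.1 : E)‖ = 1
  injective_of_norm_lt : ∀ z z', ‖(z.2.1 : E)‖ < 1 → k z = k z' → z = z'

namespace IsHandleAttachment

variable {j : C(X, Y)} {k : C(ι × closedBall (0 : E) 1 × T, Y)}
  {f : C(ι × sphere (0 : E) 1 × T, X)}

theorem glue_of_norm (h : IsHandleAttachment j k f) {z : ι × closedBall (0 : E) 1 × T}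
    (hz : ‖(z.2.1 : E)‖ = 1) :
    k z = j (f (z.1, ⟨z.2.1, mem_sphere_zero_iff_norm.2 hz⟩, z.2.2)) :=
  h.glue z.1 ⟨z.2.1, mem_sphere_zero_iff_norm.2 hz⟩ z.2.2

/-- Points are identified in `Y` only through the gluing of the boundaries of the handles, so
compatibility there is enough to descend. -/
theorem exists_lift (h : IsHandleAttachment j k f) {Z : Type*} [Nonempty Z] (G₀ : X → Z)
    (G₁ : ι × closedBall (0 : E) 1 × T → Z)
    (hG : ∀ i (u : sphere (0 : E) 1) t,
      G₁ (i, ⟨u, sphere_subset_closedBall u.2⟩, t) = G₀ (f (i, u, t))) :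
    ∃ G : Y → Z, (∀ x, G (j x) = G₀ x) ∧ (∀ z, G (k z) = G₁ z) := by
  have hG' : ∀ z : ι × closedBall (0 : E) 1 × T, ∀ x, k z = j x → G₁ z = G₀ x := by
    intro z x hzx
    have hz := h.norm_eq_one x z hzx
    rw [h.glue_of_norm hz] at hzx
    rw [← h.injective hzx]
    exact hG z.1 ⟨z.2.1, mem_sphere_zero_iff_norm.2 hz⟩ z.2.2
  have hfac : (Sum.elim G₀ G₁).FactorsThrough (Sum.elim j k) := by
    rintro (x | z) (x' | z') hq
    · rw [h.injective hq]
    · exact (hG' z' x hq.symm).symm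
    · exact hG' z x' hq
    · have hq' : k z = k z' := hq
      rcases lt_or_eq_of_le (mem_closedBall_zero_iff.1 z.2.1.2) with hz | hz
      · rw [h.injective_of_norm_lt z z' hz hq']
      · rw [h.glue_of_norm hz] at hq'
        rw [Sum.elim_inr, Sum.elim_inr, hG' z' _ hq'.symm]
        exact hG z.1 ⟨z.2.1, mem_sphere_zero_iff_norm.2 hz⟩ z.2.2
  refine ⟨Function.extend (Sum.elim j k) (Sum.elim G₀ G₁) fun _ => Classical.arbitrary Z, ?_, ?_⟩
  · exact fun x => hfac.extend_apply _ (Sum.inl x)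
  · exact fun z => hfac.extend_apply _ (Sum.inr z)

/-- A quotient map stays a quotient map over an open set, so continuity is tested on the pieces. -/
theorem continuousOn (h : IsHandleAttachment j k f) {Z : Type*} [TopologicalSpace Z] {G : Y → Z}
    {s : Set Y} (hs : IsOpen s)
    (h₀ : ContinuousOn (fun x => G (j x)) (j ⁻¹' s))
    (h₁ : ContinuousOn (fun z => G (k z)) (k ⁻¹' s)) : ContinuousOn G s := by
  rw [h.isQuotientMap.continuousOn_isOpen_iff hs]
  rintro (x | z) hx
  · exact (IsOpenEmbedding.inl.continuousAt_iff.1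
      (h₀.continuousAt ((hs.preimage j.continuous).mem_nhds hx))).continuousWithinAt
  · exact (IsOpenEmbedding.inr.continuousAt_iff.1
      (h₁.continuousAt ((hs.preimage k.continuous).mem_nhds hx))).continuousWithinAt

theorem continuous (h : IsHandleAttachment j k f) {Z : Type*} [TopologicalSpace Z] {G : Y → Z}
    (h₀ : Continuous fun x => G (j x)) (h₁ : Continuous fun z => G (k z)) : Continuous G := by
  rw [h.isQuotientMap.continuous_iff]
  refine continuous_sum_dom.2 ⟨h₀, h₁⟩

theorem surj (h : IsHandleAttachment j k f) (y : Y) : (∃ x, j x = y) ∨ ∃ z, k z = y := by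
  obtain ⟨x | z, rfl⟩ := h.isQuotientMap.surjective y
  exacts [Or.inl ⟨x, rfl⟩, Or.inr ⟨z, rfl⟩]

variable [NormedSpace ℝ E]

/-- The radial push of the unit ball that is the radial retraction outside of the ball of
radius `1 / 2` at time `1`. -/
def push : C(I × closedBall (0 : E) 1, closedBall (0 : E) 1) where
  toFun x := ⟨(max ‖(x.2 : E)‖ (1 + (x.1 : ℝ))⁻¹)⁻¹ • (x.2 : E), by
    have h0 : 0 < (1 + (x.1 : ℝ))⁻¹ := inv_pos.2 (by linarith [x.1.2.1])
    rw [mem_closedBall_zero_iff, norm_smul, norm_inv, Real.norm_of_nonneg (by positivity),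
      inv_mul_le_one₀ (lt_max_of_lt_right h0)]
    exact le_max_left _ _⟩
  continuous_toFun := by
    refine Continuous.subtype_mk (Continuous.smul (Continuous.inv₀ (Continuous.max (by fun_prop)
      (Continuous.inv₀ (by fun_prop) fun x => ?_)) fun x => ?_) (by fun_prop)) _
    · have := x.1.2.1
      positivity
    · have : 0 < (1 + (x.1 : ℝ))⁻¹ := inv_pos.2 (by linarith [x.1.2.1])
      positivity

theorem push_zero (z : closedBall (0 : E) 1) : push (0, z) = z := by
  ext
  have := mem_closedBall_zero_iff.1 z.2
  simp [push, this]

theorem push_of_norm_eq_one (s : I) (z : closedBall (0 : E) 1) (hz : ‖(z : E)‖ = 1) :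
    push (s, z) = z := by
  ext
  have : (1 + (s : ℝ))⁻¹ ≤ 1 := inv_le_one_of_one_le₀ (by linarith [s.2.1])
  simp [push, hz, this]

theorem push_one (z : closedBall (0 : E) 1) (hz : 1 / 2 ≤ ‖(z : E)‖) :
    (push (1, z) : E) = ‖(z : E)‖⁻¹ • (z : E) := by
  have : (1 + ((1 : I) : ℝ))⁻¹ ≤ ‖(z : E)‖ := by norm_num at hz ⊢; exact hz
  simp only [push, ContinuousMap.coe_mk]
  rw [max_eq_left this]

/-- A property of paths that is invariant under homotopy and stable under concatenation holds for
all paths if it holds for the paths that lift to `X` or to the handles. -/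
theorem path_induction [Nonempty X] (h : IsHandleAttachment j k f)
    (P : ∀ {a b : Y}, Path a b → Prop)
    (homotopic : ∀ {a b : Y} (p q : Path a b), p.Homotopic q → P p → P q)
    (trans : ∀ {a b c : Y} (p : Path a b) (q : Path b c), P p → P q → P (p.trans q))
    (hj : ∀ {a b : Y} (p : Path a b) (q : C(I, X)), (∀ t, p t = j (q t)) → P p)
    (hk : ∀ {a b : Y} (p : Path a b) (q : C(I, ι × closedBall (0 : E) 1 × T)),
      (∀ t, p t = k (q t)) → P p)
    {a b : Y} (p : Path a b) : P p := by
  classical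
  -- `ν` is the radius in the handles: `{1 / 2 < ν}` is `X` with open collars, and `{ν < 1}`
  -- consists of the open handles.
  obtain ⟨ν, hν₀, hν₁⟩ := h.exists_lift (fun _ => (1 : ℝ)) (fun z => ‖(z.2.1 : E)‖)
    fun i u t => mem_sphere_zero_iff_norm.1 u.2
  have hν : Continuous ν := h.continuous (by simp only [hν₀]; fun_prop)
    (by simp only [hν₁]; fun_prop)
  have : Nonempty C(I, Y) := ⟨ContinuousMap.const I a⟩
  -- `r y` is the whole track of `y` under the radial push. With values in `C(I, Y)`, continuity
  -- follows from the quotient property of `Y` alone, without multiplying the quotient map by `I`.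
  obtain ⟨r, hr₀, hr₁⟩ := h.exists_lift (fun x => ContinuousMap.const I (j x))
    (fun z => k.comp ((ContinuousMap.const I z.1).prodMk
      ((push.comp ((ContinuousMap.id I).prodMk (ContinuousMap.const I z.2.1))).prodMk
        (ContinuousMap.const I z.2.2)))) fun i u t => by
      ext s
      simp only [ContinuousMap.comp_apply, ContinuousMap.prod_eval, ContinuousMap.const_apply,
        ContinuousMap.id_apply]
      rw [push_of_norm_eq_one _ _ (mem_sphere_zero_iff_norm.1 u.2), h.glue]
  have hr : Continuous r := by
    refine h.continuous ?_ ?_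
    · simp only [hr₀]
      exact ContinuousMap.continuous_const'.comp j.continuous
    · simp only [hr₁]
      refine ContinuousMap.continuous_of_continuous_uncurry _ ?_
      simp only [Function.uncurry_def, ContinuousMap.comp_apply, ContinuousMap.prod_eval,
        ContinuousMap.const_apply, ContinuousMap.id_apply]
      fun_prop
  -- `ρ` is the radial retraction of the collars to `X`; its value at the centres is irrelevant, as
  -- it is used only where `1 / 2 < ν`.
  obtain ⟨ρ, hρ₀, hρ₁⟩ := h.exists_lift (fun x => x) (fun z => if hz : (z.2.1 : E) = 0 then
      Classical.arbitrary X else f (z.1, ⟨‖(z.2.1 : E)‖⁻¹ • (z.2.1 : E), by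
        simp [norm_smul, hz]⟩, z.2.2)) fun i u t => by
      have hu := mem_sphere_zero_iff_norm.1 u.2
      have hu0 : (u : E) ≠ 0 := by
        intro h0
        simp [h0] at hu
      simp [hu0, hu]
  have hρ : ContinuousOn ρ {y | 1 / 2 < ν y} := by
    refine h.continuousOn (isOpen_lt continuous_const hν) ?_ ?_
    · simp only [hρ₀]
      exact continuousOn_id
    · simp only [hρ₁]
      rw [continuousOn_iff_continuous_domRestrict]
      have hne : ∀ z : k ⁻¹' {y | 1 / 2 < ν y}, ‖(z.1.2.1 : E)‖ ≠ 0 := by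
        intro z h0
        have hz : 1 / 2 < ν (k z.1) := z.2
        rw [hν₁, h0] at hz
        norm_num at hz
      have heq : (k ⁻¹' {y | 1 / 2 < ν y}).domRestrict (fun z => if hz : (z.2.1 : E) = 0 then
          Classical.arbitrary X else f (z.1, ⟨‖(z.2.1 : E)‖⁻¹ • (z.2.1 : E), by
            simp [norm_smul, hz]⟩, z.2.2)) = fun z => f (z.1.1,
          ⟨‖(z.1.2.1 : E)‖⁻¹ • (z.1.2.1 : E), by simp [norm_smul, hne z]⟩, z.1.2.2) := by
        funext z
        exact dif_neg fun h0 => hne z (by rw [h0, norm_zero])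
      rw [heq]
      refine f.continuous.comp (Continuous.prodMk (by fun_prop) (Continuous.prodMk
        (Continuous.subtype_mk (Continuous.smul (Continuous.inv₀ (by fun_prop) hne) (by fun_prop))
          _) (by fun_prop)))
  have hr_zero : ∀ y, r y 0 = y := by
    intro y
    rcases h.surj y with ⟨x, rfl⟩ | ⟨z, rfl⟩
    · rw [hr₀]
      rfl
    · rw [hr₁]
      simp [push_zero]
  have hr_one : ∀ y, 1 / 2 < ν y → r y 1 = j (ρ y) := by
    intro y hy
    rcases h.surj y with ⟨x, rfl⟩ | ⟨z, rfl⟩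
    · rw [hr₀, hρ₀]
      rfl
    · rw [hν₁] at hy
      have hz : (z.2.1 : E) ≠ 0 := by
        intro h0
        rw [h0, norm_zero] at hy
        norm_num at hy
      rw [hr₁, hρ₁, dif_neg hz, ← h.glue]
      simp only [ContinuousMap.comp_apply, ContinuousMap.prod_eval, ContinuousMap.const_apply,
        ContinuousMap.id_apply]
      congr 3
      exact Subtype.ext (push_one _ hy.le)
  -- A track is constant in `X` or stays in one handle; `τ` makes room for reversed tracks.
  have hP : ∀ (y : Y) (τ : C(I, I)) {a b : Y} (w : Path a b), (∀ s, w s = r y (τ s)) → P w := by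
    intro y τ a b w hw
    rcases h.surj y with ⟨x, rfl⟩ | ⟨z, rfl⟩
    · refine hj w (ContinuousMap.const I x) fun s => ?_
      rw [hw, hr₀]
      rfl
    · refine hk w (((ContinuousMap.const I z.1).prodMk
        ((push.comp ((ContinuousMap.id I).prodMk (ContinuousMap.const I z.2.1))).prodMk
        (ContinuousMap.const I z.2.2))).comp τ) fun s => ?_
      rw [hw, hr₁]
      rfl
  refine path_induction_openCover (fun i : Bool => cond i {y | 1 / 2 < ν y} {y | ν y < 1}) ?_ ?_ P
    homotopic trans ?_ p
  · rintro (_ | _)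
    · exact isOpen_lt hν continuous_const
    · exact isOpen_lt continuous_const hν
  · intro y
    by_cases hy : ν y < 1
    · exact ⟨false, hy⟩
    · refine ⟨true, ?_⟩
      change 1 / 2 < ν y
      linarith
  · rintro (_ | _) a b p hp
    · change ∀ t, ν (p t) < 1 at hp
      have hz : ∀ y, ν y < 1 → ∃ z, k z = y := by
        intro y hy
        rcases h.surj y with ⟨x, rfl⟩ | ⟨z, rfl⟩
        · rw [hν₀] at hy
          exact absurd hy (lt_irrefl _)
        · exact ⟨z, rfl⟩
      obtain ⟨z₀, -⟩ := hz _ (hp 0)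
      have : Nonempty (ι × closedBall (0 : E) 1 × T) := ⟨z₀⟩
      -- `κ` inverts `k` on the open handles; the default value `z₀` is never met on `p`.
      obtain ⟨κ, hκ₀, hκ₁⟩ := h.exists_lift (fun _ => z₀)
        (fun z => if ‖(z.2.1 : E)‖ < 1 then z else z₀) fun i u t => by
          simp [mem_sphere_zero_iff_norm.1 u.2]
      have hκ : ContinuousOn κ {y | ν y < 1} := by
        refine h.continuousOn (isOpen_lt hν continuous_const) ?_ ?_
        · simp only [hκ₀]
          exact continuousOn_const
        · refine continuousOn_id.congr fun z hz => ?_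
          have hz' : ν (k z) < 1 := hz
          rw [hν₁] at hz'
          simp [hκ₁, hz']
      refine hk p ⟨fun t => κ (p t), hκ.comp_continuous p.continuous hp⟩ fun t => ?_
      obtain ⟨z, hz⟩ := hz _ (hp t)
      have hz1 := hp t
      rw [← hz, hν₁] at hz1
      simp only [ContinuousMap.coe_mk]
      rw [← hz, hκ₁, if_pos hz1]
    · change ∀ t, 1 / 2 < ν (p t) at hp
      -- Pushing `p` sweeps out a square whose far side `m` lies in `X`, so `p` is homotopic to a
      -- track, then `m`, then a reversed track.
      let F : C(I × I, Y) := ⟨fun x => r (p x.2) x.1,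
        (ContinuousMap.continuous_uncurry_of_continuous
          ⟨fun t => r (p t), hr.comp p.continuous⟩).comp continuous_swap⟩
      let q : C(I, X) := ⟨fun t => ρ (p t), hρ.comp_continuous p.continuous hp⟩
      have edge : ∀ (c : Y), 1 / 2 < ν c → ∃ u : Path c (j (ρ c)), ∀ s, u s = r c s :=
        fun c hc => ⟨⟨r c, hr_zero c, hr_one c hc⟩, fun _ => rfl⟩
      have ha : 1 / 2 < ν a := p.source ▸ hp 0
      have hb : 1 / 2 < ν b := p.target ▸ hp 1
      obtain ⟨u, hu⟩ := edge a ha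
      obtain ⟨v, hv⟩ := edge b hb
      let m : Path (j (ρ a)) (j (ρ b)) :=
        { toContinuousMap := j.comp q
          source' := congrArg (fun y => j (ρ y)) p.source
          target' := congrArg (fun y => j (ρ y)) p.target }
      have hsq := mk_trans_eq_of_square F p v u m (fun t => (hr_zero _).symm)
        (fun s => (hv s).trans (congrArg (fun y => r y s) p.target.symm))
        (fun s => (hu s).trans (congrArg (fun y => r y s) p.source.symm))
        (fun t => (hr_one _ (hp t)).symm)
      refine homotopic ((u.trans m).trans v.symm) p (Path.Homotopic.Quotient.eq.1 ?_)
        (trans _ _ (trans _ _ (hP a (ContinuousMap.id I) u hu) (hj m q fun _ => rfl))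
          (hP b ⟨unitInterval.symm, continuous_symm⟩ v.symm fun s => hv _))
      rw [Path.Homotopic.Quotient.mk_trans, Path.Homotopic.Quotient.mk_trans, ← hsq,
        Path.Homotopic.Quotient.mk_symm, Path.Homotopic.Quotient.trans_assoc,
        Path.Homotopic.Quotient.trans_symm, Path.Homotopic.Quotient.trans_refl]

end IsHandleAttachment

end Handles

/-! ### Generators of the fundamental groupoid after attaching handles -/

section Generation

open Topology unitInterval Metric

variable {X Y ι E T : Type*} [TopologicalSpace X] [TopologicalSpace Y] [TopologicalSpace ι]
  [NormedAddCommGroup E] [TopologicalSpace T]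

namespace IsHandleAttachment

variable {j : C(X, Y)} {k : C(ι × closedBall (0 : E) 1 × T, Y)}
  {f : C(ι × sphere (0 : E) 1 × T, X)}

theorem trans_apply_of_handle (i : ι) {a b d : Y} (p : Path a b) (q : Path b d)
    {z₀ z₁ z₂ : closedBall (0 : E) 1 × T} (c : Path z₀ z₁) (c' : Path z₁ z₂)
    (hp : ∀ t, p t = k (i, c t)) (hq : ∀ t, q t = k (i, c' t)) (t : I) :
    (p.trans q) t = k (i, (c.trans c') t) := by
  simp only [Path.trans_apply]
  split_ifs
  · exact hp _
  · exact hq _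

/-- Reference paths to the points of `Y`: the paths `w₀` to the points of `X`, and these paths
followed by a path in a handle. -/
inductive ReferencePath (j : C(X, Y)) (k : C(ι × closedBall (0 : E) 1 × T, Y))
    (f : C(ι × sphere (0 : E) 1 × T, X)) (e : ι → sphere (0 : E) 1 × T) {y₀ : Y}
    (w₀ : ∀ x, Path.Homotopic.Quotient y₀ (j x)) : ∀ y, Path.Homotopic.Quotient y₀ y → Prop
  | base (x : X) : ReferencePath j k f e w₀ (j x) (w₀ x)
  | handle (i : ι) (y : Y) (p : Path (j (f (i, e i))) y) (c : C(I, closedBall (0 : E) 1 × T))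
      (hc : c 0 = (⟨(e i).1, sphere_subset_closedBall (e i).1.2⟩, (e i).2))
      (hp : ∀ t, p t = k (i, c t)) :
      ReferencePath j k f e w₀ y ((w₀ (f (i, e i))).trans (.mk p))

variable [NormedSpace ℝ E]

/-- A single handle `D × T` is contractible. -/
theorem mk_eq_mk_of_handle [ContractibleSpace T] (i : ι) {a b : Y} (p p' : Path a b)
    (c c' : C(I, closedBall (0 : E) 1 × T)) (hp : ∀ t, p t = k (i, c t))
    (hp' : ∀ t, p' t = k (i, c' t)) (h0 : c 0 = c' 0) (h1 : c 1 = c' 1) :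
    Path.Homotopic.Quotient.mk p = .mk p' := by
  have : ContractibleSpace (closedBall (0 : E) 1) :=
    (convex_closedBall (0 : E) 1).contractibleSpace ⟨0, by simp⟩
  obtain rfl : a = k (i, c 0) := by rw [← p.source, hp]
  obtain rfl : b = k (i, c 1) := by rw [← p.target, hp]
  let γ : Path (c 0) (c 1) := ⟨c, rfl, rfl⟩
  let γ' : Path (c 0) (c 1) := ⟨c', h0.symm, h1.symm⟩
  let ki : C(closedBall (0 : E) 1 × T, Y) := ⟨fun z => k (i, z), by fun_prop⟩
  obtain rfl : p = γ.map ki.continuous := Path.ext (funext hp)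
  obtain rfl : p' = γ'.map ki.continuous := Path.ext (funext hp')
  exact Path.Homotopic.Quotient.eq.2 ((SimplyConnectedSpace.paths_homotopic γ γ').map ki)

/-- The half of van Kampen's theorem that concerns generators: reference paths to a given point are
unique up to `S`, so closing up paths by them is compatible with concatenation up to `S`. The
hypothesis `hH` asks for a crossing of the handle into each path component of `∂D × T`. For a band
there are two components, and the crossing to the far one is a genuine generator; if `∂D × T` is
path connected, a constant crossing serves. -/
theorem generation [DiscreteTopology ι] [ContractibleSpace T] (h : IsHandleAttachment j k f)
    {y₀ : Y} (S : Path.Homotopic.Quotient y₀ y₀ → Prop) (S_refl : S (.refl y₀))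
    (S_trans : ∀ l m, S l → S m → S (l.trans m)) (S_symm : ∀ l, S l → S l.symm)
    (w₀ : ∀ x, Path.Homotopic.Quotient y₀ (j x))
    (hX : ∀ {x x' : X} (q : Path x x'),
      S (((w₀ x).trans (.mk (q.map j.continuous))).trans (w₀ x').symm))
    (e : ι → sphere (0 : E) 1 × T)
    (hH : ∀ i (u : sphere (0 : E) 1 × T), ∃ u' : sphere (0 : E) 1 × T, Joined u' u ∧
      ∃ (p : Path (j (f (i, e i))) (j (f (i, u')))) (c : C(I, closedBall (0 : E) 1 × T)),
        c 0 = (⟨(e i).1, sphere_subset_closedBall (e i).1.2⟩, (e i).2) ∧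
        c 1 = (⟨u'.1, sphere_subset_closedBall u'.1.2⟩, u'.2) ∧
        (∀ t, p t = k (i, c t)) ∧
        S (((w₀ (f (i, e i))).trans (.mk p)).trans (w₀ (f (i, u'))).symm))
    {x x' : X} (p : Path (j x) (j x')) : S (((w₀ x).trans (.mk p)).trans (w₀ x').symm) := by
  have chain : ∀ {a b c : Y} (α : Path.Homotopic.Quotient y₀ a) (p : Path.Homotopic.Quotient a b)
      (β : Path.Homotopic.Quotient y₀ b) (q : Path.Homotopic.Quotient b c)
      (γ : Path.Homotopic.Quotient y₀ c), S ((α.trans p).trans β.symm) →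
      S ((β.trans q).trans γ.symm) → S ((α.trans (p.trans q)).trans γ.symm) := by
    intro a b c α p β q γ h1 h2
    convert S_trans _ _ h1 h2 using 1
    simp only [Path.Homotopic.Quotient.trans_assoc, symm_trans_cancel]
  have flip : ∀ {a : Y} (α β : Path.Homotopic.Quotient y₀ a), S (α.trans β.symm) →
      S (β.trans α.symm) := by
    intro a α β h1
    convert S_symm _ h1 using 1
    induction α using Path.Homotopic.Quotient.ind with | mk α =>
    induction β using Path.Homotopic.Quotient.ind with | mk β =>
    simp only [← Path.Homotopic.Quotient.mk_symm, ← Path.Homotopic.Quotient.mk_trans,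
      Path.trans_symm, Path.symm_symm]
  -- If a reference path through a handle ends in `X`, its part in the handle is homotopic to the
  -- crossing supplied by `hH` followed by a path `δ` in the attaching region, and `hX` applies to
  -- `δ`.
  have hF : ∀ {y : Y} (α : Path.Homotopic.Quotient y₀ y), ReferencePath j k f e w₀ y α →
      ∀ x (hx : y = j x), S (α.trans ((w₀ x).cast rfl hx).symm) := by
    intro y α hα x hx
    cases hα with
    | base x' =>
      obtain rfl := h.injective hx
      simpa using S_refl
    | handle i y p c hc hp =>
      subst hx
      have h1 : k (i, c 1) = j x := by rw [← hp, p.target]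
      have hn := h.norm_eq_one _ _ h1
      let u : sphere (0 : E) 1 × T := (⟨(c 1).1, mem_sphere_zero_iff_norm.2 hn⟩, (c 1).2)
      obtain rfl : f (i, u) = x := h.injective ((h.glue_of_norm hn).symm.trans h1)
      obtain ⟨u', ⟨d⟩, p', c', hc0, hc1, hp', hS⟩ := hH i u
      let δ : Path (f (i, u')) (f (i, u)) :=
        d.map (f := fun v => f (i, v)) (by fun_prop)
      have hpp : Path.Homotopic.Quotient.mk p =
          (Path.Homotopic.Quotient.mk p').trans (.mk (δ.map j.continuous)) := by
        have hincl : Continuous fun v : sphere (0 : E) 1 × T =>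
          ((⟨v.1, sphere_subset_closedBall v.1.2⟩, v.2) : closedBall (0 : E) 1 × T) := by fun_prop
        let γ₁ : Path _ _ := ⟨c', hc0, hc1⟩
        let γ₂ := d.map hincl
        rw [← Path.Homotopic.Quotient.mk_trans]
        exact mk_eq_mk_of_handle i p _ c (γ₁.trans γ₂).toContinuousMap hp
          (trans_apply_of_handle i p' _ γ₁ γ₂ hp' fun t => (h.glue i (d t).1 (d t).2).symm)
          (hc.trans (γ₁.trans γ₂).source.symm) (γ₁.trans γ₂).target.symm
      rw [Path.Homotopic.Quotient.cast_rfl_rfl, hpp]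
      exact chain _ _ _ _ _ hS (hX δ)
  -- Over `X`, both reference paths are compared with `w₀`. Elsewhere the end point is interior to a
  -- handle, so both paths run through the same handle, where they are homotopic.
  have hC : ∀ {y : Y} (α β : Path.Homotopic.Quotient y₀ y), ReferencePath j k f e w₀ y α →
      ReferencePath j k f e w₀ y β → S (α.trans β.symm) := by
    intro y α β hα hβ
    by_cases hy : ∃ x, y = j x
    · obtain ⟨x, hx⟩ := hy
      have h1 := hF α hα x hx
      have h2 := flip _ _ (hF β hβ x hx)
      convert S_trans _ _ h1 h2 using 1
      simp only [Path.Homotopic.Quotient.trans_assoc, symm_trans_cancel]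
    · cases hα with
      | base x => exact absurd ⟨x, rfl⟩ hy
      | handle i y p c hc hp =>
        cases hβ with
        | base x => exact absurd ⟨x, rfl⟩ hy
        | handle i' y p' c' hc' hp' =>
          have hn : ‖((c 1).1 : E)‖ < 1 := by
            refine lt_of_le_of_ne (mem_closedBall_zero_iff.1 (c 1).1.2) fun hn => hy ?_
            exact ⟨_, p.target.symm.trans ((hp 1).trans (h.glue_of_norm (z := (i, c 1)) hn))⟩
          have heq := h.injective_of_norm_lt (i, c 1) (i', c' 1) hn
            (by rw [← hp, ← hp', p.target, p'.target])
          obtain ⟨rfl, h1⟩ := Prod.ext_iff.1 heq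
          rw [mk_eq_mk_of_handle i p p' c c' hp hp' (hc.trans hc'.symm) h1,
            Path.Homotopic.Quotient.trans_symm]
          exact S_refl
  have hne : ∀ i z, ∃ (p : Path (j (f (i, e i))) (k (i, z))) (c : Path
      ((⟨(e i).1, sphere_subset_closedBall (e i).1.2⟩, (e i).2) : closedBall (0 : E) 1 × T) z),
      ∀ t, p t = k (i, c t) := by
    intro i z
    have : ContractibleSpace (closedBall (0 : E) 1) :=
      (convex_closedBall (0 : E) 1).contractibleSpace ⟨0, by simp⟩
    let c := PathConnectedSpace.somePath
      ((⟨(e i).1, sphere_subset_closedBall (e i).1.2⟩, (e i).2) : closedBall (0 : E) 1 × T) z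
    exact ⟨⟨⟨fun t => k (i, c t), by fun_prop⟩,
      (congrArg (fun z => k (i, z)) c.source).trans (h.glue i (e i).1 (e i).2),
      congrArg (fun z => k (i, z)) c.target⟩, c, fun _ => rfl⟩
  have key : ∃ α β, ReferencePath j k f e w₀ _ α ∧ ReferencePath j k f e w₀ _ β ∧
      S ((α.trans (.mk p)).trans β.symm) := by
    have : Nonempty X := ⟨x⟩
    refine h.path_induction (fun {a b} p => ∃ α β, ReferencePath j k f e w₀ a α ∧
      ReferencePath j k f e w₀ b β ∧ S ((α.trans (.mk p)).trans β.symm)) ?_ ?_ ?_ ?_ p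
    · intro a b p q hpq hP
      rwa [← Path.Homotopic.Quotient.eq.2 hpq]
    · rintro a b c p q ⟨α, β, hα, hβ, h1⟩ ⟨β', γ, hβ', hγ, h2⟩
      refine ⟨α, γ, hα, hγ, ?_⟩
      rw [Path.Homotopic.Quotient.mk_trans]
      refine chain _ _ β _ _ h1 ?_
      convert S_trans _ _ (hC β β' hβ hβ') h2 using 1
      simp only [Path.Homotopic.Quotient.trans_assoc, symm_trans_cancel]
    · intro a b p q hq
      obtain rfl : a = j (q 0) := by rw [← p.source, hq]
      obtain rfl : b = j (q 1) := by rw [← p.target, hq]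
      refine ⟨_, _, .base (q 0), .base (q 1), ?_⟩
      let q' : Path (q 0) (q 1) := ⟨q, rfl, rfl⟩
      obtain rfl : p = q'.map j.continuous := Path.ext (funext hq)
      exact hX q'
    · intro a b p q hq
      -- The index set is discrete, so a path in the handles stays in one of them.
      have hconst : ∀ t, (q t).1 = (q 0).1 := fun t =>
        PreconnectedSpace.constant inferInstance (f := fun t => (q t).1) (by fun_prop)
      have hq' : ∀ t, p t = k ((q 0).1, (q t).2) := fun t => by rw [hq, ← hconst t]
      obtain rfl : a = k ((q 0).1, (q 0).2) := by rw [← p.source, hq']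
      obtain ⟨p₀, c₀, hc₀⟩ := hne (q 0).1 (q 0).2
      let q₂ : Path (q 0).2 (q 1).2 := ⟨⟨fun t => (q t).2, by fun_prop⟩, rfl, rfl⟩
      refine ⟨_, _, .handle _ _ p₀ c₀.toContinuousMap c₀.source hc₀,
        .handle _ _ (p₀.trans p) (c₀.trans q₂).toContinuousMap (c₀.trans q₂).source
          (trans_apply_of_handle _ p₀ p c₀ q₂ hc₀ hq'), ?_⟩
      rw [Path.Homotopic.Quotient.mk_trans, ← Path.Homotopic.Quotient.trans_assoc,
        Path.Homotopic.Quotient.trans_symm]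
      exact S_refl
  obtain ⟨α, β, hα, hβ, hS⟩ := key
  have h1 := hC _ _ (.base x) hα
  have h2 := hC _ _ hβ (.base x')
  convert S_trans _ _ (S_trans _ _ h1 hS) h2 using 1
  simp only [Path.Homotopic.Quotient.trans_assoc, symm_trans_cancel]

end IsHandleAttachment

end Generation

/-! ## The surface as a rectangle with one-handles -/

section SurfaceHandles

open Topology unitInterval Metric

/-- The rectangle in `F_g`. -/
def Base (g : ℕ) : Type := {p : ℂ × ℝ // InBase g p}

instance (g : ℕ) : TopologicalSpace (Base g) := instTopologicalSpaceSubtype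

/-- The inclusion of the rectangle in `F_g`. -/
def baseIncl (g : ℕ) : C(Base g, Surface g) where
  toFun p := ⟨p.1, Or.inl p.2⟩
  continuous_toFun := Continuous.subtype_mk continuous_subtype_val _

instance (g : ℕ) : CompactSpace (Base g) := by
  have h : {p : ℂ × ℝ | InBase g p} =
      (Icc (0 : ℝ) (16 * (g + 1)) ×ℂ Icc (-10 : ℝ) 0) ×ˢ ({0} : Set ℝ) := by
    ext p
    simp only [InBase, mem_ofPred_eq, mem_prod, Complex.mem_reProdIm, mem_Icc, mem_singleton_iff]
    tauto
  refine isCompact_iff_compactSpace.1 ?_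
  change IsCompact {p : ℂ × ℝ | InBase g p}
  rw [h]
  exact (isCompact_Icc.reProdIm isCompact_Icc).prod isCompact_singleton

instance (g : ℕ) : ContractibleSpace (Base g) :=
  (convex_inBase g).contractibleSpace ⟨_, inBase_star g⟩

instance (g : ℕ) : T2Space (Surface g) := inferInstanceAs (T2Space (Subtype _))

/-- The index set of the bands: `inl i` is the `i`-th band of the first kind and `inr i` is the
`i`-th band of the second kind. -/
abbrev BandIndex (g : ℕ) : Type := Fin g ⊕ Fin g

/-- The centre of a band. -/
def bandCenter {g : ℕ} : BandIndex g → ℝ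
  | .inl i => centerA i
  | .inr i => centerB i

/-- The stretching factor of a band in the `y`-direction. -/
def bandStretch {g : ℕ} : BandIndex g → ℝ
  | .inl _ => 1
  | .inr _ => 2

/-- The stretching factor of a band in the vertical direction. -/
def bandHeight {g : ℕ} : BandIndex g → ℝ
  | .inl _ => 0
  | .inr _ => 2

/-- The point of a band with polar coordinates `(t, (z, w))`, where `z ^ 2 + w ^ 2 = 1`. -/
def bandPoint {g : ℕ} (b : BandIndex g) (z w t : ℝ) : ℂ × ℝ :=
  (⟨bandCenter b + t * z, bandStretch b * (t * w)⟩, bandHeight b * (t * w))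

theorem norm_polar {z w t : ℝ} (h : z ^ 2 + w ^ 2 = 1) (ht : 0 ≤ t) :
    ‖(⟨t * z, t * w⟩ : ℂ)‖ = t := by
  rw [← sq_eq_sq₀ (norm_nonneg _) ht, Complex.sq_norm, Complex.normSq_mk]
  linear_combination t ^ 2 * h

theorem bandPoint_mem {g : ℕ} (b : BandIndex g) {z w t : ℝ} (h : z ^ 2 + w ^ 2 = 1) (hw : 0 ≤ w)
    (ht : t ∈ Icc (2 : ℝ) 4) :
    InBase g (bandPoint b z w t) ∨ ∃ i : Fin g, InBandA i (bandPoint b z w t) ∨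
      InBandB i (bandPoint b z w t) := by
  have ht0 : 0 ≤ t := by linarith [ht.1]
  right
  rcases b with i | i
  · have hn : ‖(bandPoint (Sum.inl i) z w t).1 - centerA i‖ = t := by
      refine Eq.trans (congrArg _ ?_) (norm_polar h ht0)
      apply Complex.ext <;> simp [bandPoint, bandCenter, bandStretch]
    refine ⟨i, Or.inl ⟨?_, ?_, ?_, ?_⟩⟩
    · simp only [bandPoint, bandStretch]
      positivity
    · simp [bandPoint, bandHeight]
    · rw [hn]; exact ht.1
    · rw [hn]; exact ht.2
  · have hn : ‖squash ((bandPoint (Sum.inr i) z w t).1 - centerB i)‖ = t := by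
      refine Eq.trans (congrArg _ ?_) (norm_polar h ht0)
      apply Complex.ext <;> simp [bandPoint, bandCenter, bandStretch, squash]
    refine ⟨i, Or.inr ⟨?_, ?_, ?_, ?_⟩⟩
    · simp only [bandPoint, bandStretch]
      positivity
    · simp [bandPoint, bandHeight, bandStretch]
    · rw [hn]; exact ht.1
    · rw [hn]; exact ht.2

theorem sq_add_sqrt_sq {z : ℝ} (hz : z ∈ closedBall (0 : ℝ) 1) : z ^ 2 + √(1 - z ^ 2) ^ 2 = 1 := by
  have h := mem_closedBall_zero_iff.1 hz
  have : z ^ 2 ≤ 1 := by rw [← sq_abs, sq_le_one_iff₀ (abs_nonneg z)]; exact h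
  rw [Real.sq_sqrt (by linarith)]
  ring

/-- The parametrization of the bands. -/
def bandMap (g : ℕ) : C(BandIndex g × closedBall (0 : ℝ) 1 × Icc (2 : ℝ) 4, Surface g) where
  toFun x := ⟨bandPoint x.1 x.2.1 √(1 - (x.2.1 : ℝ) ^ 2) x.2.2,
    bandPoint_mem x.1 (sq_add_sqrt_sq x.2.1.2) (Real.sqrt_nonneg _) x.2.2.2⟩
  continuous_toFun := by
    refine Continuous.subtype_mk ?_ _
    have h : ∀ F : BandIndex g → ℝ, Continuous F := fun F => continuous_of_discreteTopology
    have hmk : Continuous fun p : ℝ × ℝ => (⟨p.1, p.2⟩ : ℂ) :=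
      Complex.equivRealProdCLM.symm.continuous
    have h1 := h bandCenter
    have h2 := h bandStretch
    have h3 := h bandHeight
    unfold bandPoint
    refine Continuous.prodMk (hmk.comp (Continuous.prodMk ?_ ?_)) ?_ <;> fun_prop

theorem bandCenter_bounds {g : ℕ} (b : BandIndex g) :
    8 ≤ bandCenter b ∧ bandCenter b + 5 ≤ 16 * g := by
  rcases b with i | i
  all_goals
    have hi : ((i : ℕ) : ℝ) + 1 ≤ g := by exact_mod_cast i.2
    have hi0 : (0 : ℝ) ≤ (i : ℕ) := Nat.cast_nonneg _
    simp only [bandCenter, centerA, centerB]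
    constructor <;> linarith

/-- This covers the lower halves of the annuli and, with `w = 0`, the feet of the bands. The lowest
point has ordinate `-8`, above the bottom `-10` of the rectangle. -/
theorem inBase_bandPoint {g : ℕ} (b : BandIndex g) {z w t : ℝ} (h : z ^ 2 + w ^ 2 = 1)
    (hw : w ≤ 0) (ht : t ∈ Icc (2 : ℝ) 4) :
    InBase g (⟨bandCenter b + t * z, bandStretch b * (t * w)⟩, 0) := by
  obtain ⟨h1, h2⟩ := bandCenter_bounds b
  have hz : |z| ≤ 1 := abs_le_one_iff_mul_self_le_one.2 (by nlinarith)
  have hw' : |w| ≤ 1 := abs_le_one_iff_mul_self_le_one.2 (by nlinarith)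
  rw [abs_le] at hz hw'
  have ht1 := ht.1
  have ht2 := ht.2
  have hs : 0 ≤ bandStretch b ∧ bandStretch b ≤ 2 := by
    rcases b with i | i <;> simp [bandStretch]
  refine ⟨?_, ?_, ?_, ?_, rfl⟩
  · change 0 ≤ bandCenter b + t * z
    nlinarith
  · change bandCenter b + t * z ≤ 16 * (g + 1)
    nlinarith
  · change -10 ≤ bandStretch b * (t * w)
    nlinarith [mul_nonneg hs.1 (by linarith : (0 : ℝ) ≤ t)]
  · change bandStretch b * (t * w) ≤ 0
    exact mul_nonpos_of_nonneg_of_nonpos hs.1 (mul_nonpos_of_nonneg_of_nonpos (by linarith) hw)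

/-- The attaching map of the bands. -/
def bandFoot (g : ℕ) : C(BandIndex g × sphere (0 : ℝ) 1 × Icc (2 : ℝ) 4, Base g) where
  toFun x := ⟨(⟨bandCenter x.1 + x.2.2 * x.2.1, bandStretch x.1 * (x.2.2 * 0)⟩, 0),
    inBase_bandPoint x.1 (by
      have h := mem_sphere_zero_iff_norm.1 x.2.1.2
      rw [Real.norm_eq_abs] at h
      rw [← sq_abs, h]
      norm_num) le_rfl x.2.2.2⟩
  continuous_toFun := by
    refine Continuous.subtype_mk ?_ _
    have h : ∀ F : BandIndex g → ℝ, Continuous F := fun F => continuous_of_discreteTopology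
    have hmk : Continuous fun p : ℝ × ℝ => (⟨p.1, p.2⟩ : ℂ) :=
      Complex.equivRealProdCLM.symm.continuous
    have h1 := h bandCenter
    have h2 := h bandStretch
    refine Continuous.prodMk (hmk.comp (Continuous.prodMk ?_ ?_)) ?_ <;> fun_prop

theorem bandStretch_pos {g : ℕ} (b : BandIndex g) : 0 < bandStretch b := by
  rcases b with i | i <;> simp [bandStretch]

/-- The height separates the two kinds of bands, as it is zero on the first and positive in the
interior of the second. Within one kind the centres are at least `16` apart, while a band extends at
most `4` to each side. -/
theorem bandPoint_injective {g : ℕ} {b b' : BandIndex g} {z w t z' w' t' : ℝ}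
    (h : z ^ 2 + w ^ 2 = 1) (hw : 0 < w) (ht : t ∈ Icc (2 : ℝ) 4)
    (h' : z' ^ 2 + w' ^ 2 = 1) (ht' : t' ∈ Icc (2 : ℝ) 4)
    (heq : bandPoint b z w t = bandPoint b' z' w' t') : b = b' ∧ z = z' ∧ t = t' := by
  have e1 : bandCenter b + t * z = bandCenter b' + t' * z' :=
    congrArg (fun p : ℂ × ℝ => p.1.re) heq
  have e2 : bandStretch b * (t * w) = bandStretch b' * (t' * w') :=
    congrArg (fun p : ℂ × ℝ => p.1.im) heq
  have e3 : bandHeight b * (t * w) = bandHeight b' * (t' * w') := congrArg Prod.snd heq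
  have hz : |z| ≤ 1 := abs_le_one_iff_mul_self_le_one.2 (by nlinarith)
  have hz' : |z'| ≤ 1 := abs_le_one_iff_mul_self_le_one.2 (by nlinarith)
  rw [abs_le] at hz hz'
  have ht1 := ht.1
  have ht2 := ht.2
  have ht1' := ht'.1
  have ht2' := ht'.2
  have hpos : 0 < t * w := by positivity
  have hb : b = b' := by
    have b1 : -4 ≤ t * z ∧ t * z ≤ 4 := by constructor <;> nlinarith
    have b2 : -4 ≤ t' * z' ∧ t' * z' ≤ 4 := by constructor <;> nlinarith
    have aux : ∀ i i' : Fin g, (16 * (i : ℕ) : ℝ) + t * z = 16 * (i' : ℕ) + t' * z' → i = i' := by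
      intro i i' hii
      have h1 : ((i : ℕ) : ℝ) < (i' : ℕ) + 1 := by linarith [b1.1, b2.2]
      have h2 : ((i' : ℕ) : ℝ) < (i : ℕ) + 1 := by linarith [b1.2, b2.1]
      have h3 : (i : ℕ) < i' + 1 := by exact_mod_cast h1
      have h4 : (i' : ℕ) < i + 1 := by exact_mod_cast h2
      ext
      omega
    rcases b with i | i <;> rcases b' with i' | i' <;>
      simp only [bandCenter, centerA, centerB, bandStretch, bandHeight] at e1 e2 e3
    · rw [aux i i' (by linarith)]
    · linarith
    · linarith
    · rw [aux i i' (by linarith)]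
  subst hb
  have e4 : t * z = t' * z' := by linarith
  have e5 : t * w = t' * w' := mul_left_cancel₀ (bandStretch_pos b).ne' e2
  have e6 : t = t' := by
    rw [← norm_polar h (by linarith : 0 ≤ t), ← norm_polar h' (by linarith : 0 ≤ t'), e4, e5]
  subst e6
  exact ⟨rfl, mul_left_cancel₀ (by linarith : t ≠ 0) e4, rfl⟩

/-- Polar coordinates: `t` is the norm and `z` the cosine of the argument. -/
theorem exists_bandPoint {g : ℕ} (b : BandIndex g) {v : ℂ} (h2 : 2 ≤ ‖v‖) (h4 : ‖v‖ ≤ 4)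
    (him : 0 ≤ v.im) : ∃ z : closedBall (0 : ℝ) 1, ∃ t : Icc (2 : ℝ) 4,
      (bandMap g (b, z, t)).1 =
        (⟨bandCenter b + v.re, bandStretch b * v.im⟩, bandHeight b * v.im) := by
  have h0 : 0 < ‖v‖ := by linarith
  have hz : v.re / ‖v‖ ∈ closedBall (0 : ℝ) 1 := by
    rw [mem_closedBall_zero_iff, Real.norm_eq_abs, abs_div, abs_norm, div_le_one h0]
    exact Complex.abs_re_le_norm v
  have hw : √(1 - (v.re / ‖v‖) ^ 2) = v.im / ‖v‖ := by
    have h1 := Complex.sq_norm v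
    rw [Complex.normSq_apply] at h1
    have h3 : 1 - (v.re / ‖v‖) ^ 2 = (v.im / ‖v‖) ^ 2 := by
      field_simp
      linarith
    rw [h3, Real.sqrt_sq (by positivity)]
  refine ⟨⟨_, hz⟩, ⟨‖v‖, h2, h4⟩, ?_⟩
  change bandPoint b (v.re / ‖v‖) √(1 - (v.re / ‖v‖) ^ 2) ‖v‖ = _
  rw [hw, bandPoint, mul_div_cancel₀ _ h0.ne', mul_div_cancel₀ _ h0.ne']

/-- The quotient property is automatic: the pieces are compact and the surface is Hausdorff, so the
map is closed. -/
theorem isHandleAttachment_surface (g : ℕ) :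
    IsHandleAttachment (baseIncl g) (bandMap g) (bandFoot g) where
  isQuotientMap := by
    have hc : Continuous (Sum.elim (baseIncl g) (bandMap g)) :=
      continuous_sum_dom.2 ⟨(baseIncl g).continuous, (bandMap g).continuous⟩
    refine hc.isClosedMap.isQuotientMap hc ?_
    rintro ⟨p, hp | ⟨i, ⟨him, hh, h2, h4⟩ | ⟨him, hh, h2, h4⟩⟩⟩
    · exact ⟨Sum.inl ⟨p, hp⟩, rfl⟩
    · obtain ⟨z, t, hzt⟩ := exists_bandPoint (g := g) (Sum.inl i) h2 h4 (by simpa using him)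
      refine ⟨Sum.inr (Sum.inl i, z, t), Subtype.ext (hzt.trans ?_)⟩
      refine Prod.ext (Complex.ext ?_ ?_) ?_ <;> simp [bandCenter, bandStretch, bandHeight, hh]
    · obtain ⟨z, t, hzt⟩ := exists_bandPoint (g := g) (Sum.inr i) h2 h4
        (by simp only [squash, Complex.sub_im, Complex.ofReal_im]; linarith)
      refine ⟨Sum.inr (Sum.inr i, z, t), Subtype.ext (hzt.trans ?_)⟩
      refine Prod.ext (Complex.ext ?_ ?_) ?_ <;>
        simp [bandCenter, bandStretch, bandHeight, hh, squash] <;> ring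
  glue := by
    intro b u t
    have h := mem_sphere_zero_iff_norm.1 u.2
    rw [Real.norm_eq_abs] at h
    have h0 : √(1 - (u : ℝ) ^ 2) = 0 := by rw [← sq_abs, h]; simp
    apply Subtype.ext
    change bandPoint b u √(1 - (u : ℝ) ^ 2) t = _
    rw [h0]
    change _ = ((⟨bandCenter b + t * u, bandStretch b * (t * 0)⟩, 0) : ℂ × ℝ)
    simp [bandPoint]
  injective := by
    intro x y hxy
    exact Subtype.ext (congrArg (fun p : Surface g => p.1) hxy)
  norm_eq_one := by
    rintro x ⟨b, z, t⟩ hxz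
    have h1 : bandStretch b * (t * √(1 - (z : ℝ) ^ 2)) = x.1.1.im :=
      congrArg (fun p : Surface g => p.1.1.im) hxz
    have h2 : x.1.1.im ≤ 0 := x.2.2.2.2.1
    have h3 : √(1 - (z : ℝ) ^ 2) ≤ 0 := by
      have ht := t.2.1
      by_contra hw
      push Not at hw
      have := mul_pos (bandStretch_pos b) (mul_pos (by linarith : (0 : ℝ) < t) hw)
      linarith
    have h4 := Real.sqrt_eq_zero'.1 (le_antisymm h3 (Real.sqrt_nonneg _))
    have h5 := mem_closedBall_zero_iff.1 z.2
    refine le_antisymm h5 ?_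
    rw [Real.norm_eq_abs, ← one_le_sq_iff_one_le_abs]
    linarith
  injective_of_norm_lt := by
    rintro ⟨b, z, t⟩ ⟨b', z', t'⟩ hz heq
    have hw : 0 < √(1 - (z : ℝ) ^ 2) := by
      rw [Real.norm_eq_abs, ← sq_lt_one_iff_abs_lt_one] at hz
      exact Real.sqrt_pos.2 (by linarith)
    obtain ⟨rfl, h2, h3⟩ := bandPoint_injective (sq_add_sqrt_sq z.2) hw t.2 (sq_add_sqrt_sq z'.2)
      t'.2 (congrArg (fun p : Surface g => p.1) heq)
    rw [Subtype.ext h2, Subtype.ext h3]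

end SurfaceHandles

/-! ## The meridians and parallels generate the fundamental group -/

section RealPaths

open unitInterval

variable {Y Z : Type*} [TopologicalSpace Y] [TopologicalSpace Z]

/-- Two paths with the same end points that factor through a simply connected space, with the same
end points there, are homotopic. -/
theorem mk_eq_mk_of_factor [SimplyConnectedSpace Z] (c : C(Z, Y)) {a b : Y} (p p' : Path a b)
    (u u' : C(I, Z)) (hp : ∀ t, p t = c (u t)) (hp' : ∀ t, p' t = c (u' t)) (h0 : u 0 = u' 0)
    (h1 : u 1 = u' 1) : Path.Homotopic.Quotient.mk p = .mk p' := by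
  obtain rfl : a = c (u 0) := by rw [← p.source, hp]
  obtain rfl : b = c (u 1) := by rw [← p.target, hp]
  let γ : Path (u 0) (u 1) := ⟨u, rfl, rfl⟩
  let γ' : Path (u 0) (u 1) := ⟨u', h0.symm, h1.symm⟩
  obtain rfl : p = γ.map c.continuous := Path.ext (funext hp)
  obtain rfl : p' = γ'.map c.continuous := Path.ext (funext hp')
  exact Path.Homotopic.Quotient.eq.2 ((SimplyConnectedSpace.paths_homotopic γ γ').map c)

/-- A path which is the restriction of a map `c` from the line can be split into arcs of `c`. -/
theorem mk_eq_trans_of_real (c : C(ℝ, Y)) (s₀ s₁ s₂ : ℝ) {x y z : Y} (p : Path x z) (q : Path x y)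
    (r : Path y z) (hp : ∀ t : I, p t = c (s₀ + t * (s₂ - s₀)))
    (hq : ∀ t : I, q t = c (s₀ + t * (s₁ - s₀))) (hr : ∀ t : I, r t = c (s₁ + t * (s₂ - s₁))) :
    Path.Homotopic.Quotient.mk p = (Path.Homotopic.Quotient.mk q).trans (.mk r) := by
  let arc : ∀ a b : ℝ, Path a b := fun a b =>
    ⟨⟨fun t : I => a + t * (b - a), by fun_prop⟩, by simp, by simp⟩
  rw [← Path.Homotopic.Quotient.mk_trans]
  refine mk_eq_mk_of_factor c p (q.trans r) (arc s₀ s₂).toContinuousMap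
    ((arc s₀ s₁).trans (arc s₁ s₂)).toContinuousMap hp (fun t => ?_) ?_ ?_
  · change (q.trans r) t = c (((arc s₀ s₁).trans (arc s₁ s₂)) t)
    simp only [Path.trans_apply]
    split_ifs
    · exact hq _
    · exact hr _
  · exact (arc s₀ s₂).source.trans ((arc s₀ s₁).trans (arc s₁ s₂)).source.symm
  · exact (arc s₀ s₂).target.trans ((arc s₀ s₁).trans (arc s₁ s₂)).target.symm

end RealPaths

/-! ### Loops through the bands of the surface -/

section SurfaceLoops

open Topology unitInterval Metric

variable {g : ℕ}

instance : ContractibleSpace (Icc (2 : ℝ) 4) :=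
  (convex_Icc (2 : ℝ) 4).contractibleSpace ⟨2, by norm_num⟩

/-- The annuli around the meridians and the parallels. -/
def bandAnnulus (g : ℕ) : BandIndex g → C(Circle × J, Surface g)
  | .inl i => annulusA g i
  | .inr i => annulusB g i

theorem bandAnnulus_val (b : BandIndex g) (u : Circle) (t : J) :
    (bandAnnulus g b (u, t)).1 =
      (⟨bandCenter b + (3 + (t : ℝ) / 2) * (u : ℂ).re,
        bandStretch b * ((3 + (t : ℝ) / 2) * (u : ℂ).im)⟩,
        bandHeight b * max 0 ((3 + (t : ℝ) / 2) * (u : ℂ).im)) := by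
  rcases b with i | i
  · change (((centerA i : ℂ) + ((3 + (t : ℝ) / 2 : ℝ) : ℂ) * u, 0) : ℂ × ℝ) = _
    refine Prod.ext (Complex.ext ?_ ?_) ?_
    · rw [Complex.add_re, Complex.ofReal_re, Complex.re_ofReal_mul]; rfl
    · rw [Complex.add_im, Complex.ofReal_im, Complex.im_ofReal_mul]; simp [bandStretch]
    · simp [bandHeight]
  · change (((centerB i : ℂ) + stretch (((3 + (t : ℝ) / 2 : ℝ) : ℂ) * u),
      max 0 (stretch (((3 + (t : ℝ) / 2 : ℝ) : ℂ) * u)).im) : ℂ × ℝ) = _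
    refine Prod.ext (Complex.ext ?_ ?_) ?_
    · simp only [Complex.add_re, Complex.ofReal_re, stretch, Complex.re_ofReal_mul]; rfl
    · simp only [Complex.add_im, Complex.ofReal_im, stretch, Complex.im_ofReal_mul, zero_add]; rfl
    · simp only [stretch, Complex.im_ofReal_mul, bandHeight]
      rw [mul_max_of_nonneg _ _ (by norm_num : (0 : ℝ) ≤ 2), mul_zero]

theorem circle_re_sq_add_im_sq (u : Circle) : (u : ℂ).re ^ 2 + (u : ℂ).im ^ 2 = 1 := by
  have h : Complex.normSq u = 1 := by rw [Complex.normSq_eq_norm_sq, Circle.norm_coe, one_pow]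
  rw [Complex.normSq_apply] at h
  linarith

theorem radius_mem (t : J) : 3 + (t : ℝ) / 2 ∈ Icc (2 : ℝ) 4 := by
  have h1 := t.2.1
  have h2 := t.2.2
  constructor <;> linarith

theorem radius_pos (t : J) : 0 < 3 + (t : ℝ) / 2 := by linarith [(radius_mem t).1]

theorem inBase_bandAnnulus (b : BandIndex g) {u : Circle} (t : J) (h : (u : ℂ).im ≤ 0) :
    InBase g (bandAnnulus g b (u, t)).1 := by
  rw [bandAnnulus_val, max_eq_left (mul_nonpos_of_nonneg_of_nonpos (radius_pos t).le h), mul_zero]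
  exact inBase_bandPoint b (circle_re_sq_add_im_sq u) h (radius_mem t)

theorem re_mem_closedBall (u : Circle) : (u : ℂ).re ∈ closedBall (0 : ℝ) 1 := by
  rw [mem_closedBall_zero_iff, Real.norm_eq_abs, ← Circle.norm_coe u]
  exact Complex.abs_re_le_norm _

/-- The upper half of the annulus runs inside the band, with the real part as coordinate along the
core and the radius as coordinate across it. -/
theorem bandAnnulus_eq_bandMap (b : BandIndex g) {u : Circle} (t : J) (h : 0 ≤ (u : ℂ).im) :
    bandAnnulus g b (u, t) = bandMap g (b, ⟨_, re_mem_closedBall u⟩, ⟨_, radius_mem t⟩) := by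
  apply Subtype.ext
  rw [bandAnnulus_val, max_eq_right (mul_nonneg (radius_pos t).le h)]
  change _ = bandPoint b (u : ℂ).re √(1 - (u : ℂ).re ^ 2) (3 + (t : ℝ) / 2)
  have hs : 1 - (u : ℂ).re ^ 2 = (u : ℂ).im ^ 2 := by linarith [circle_re_sq_add_im_sq u]
  rw [hs, Real.sqrt_sq h]
  rfl

/-- The rectangle is convex. -/
theorem mk_eq_mk_of_inBase {a b : Surface g} (p q : Path a b) (hp : ∀ t, InBase g (p t).1)
    (hq : ∀ t, InBase g (q t).1) : Path.Homotopic.Quotient.mk p = .mk q := by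
  refine mk_eq_mk_of_factor (baseIncl g) p q ⟨fun t => ⟨(p t).1, hp t⟩, ?_⟩
    ⟨fun t => ⟨(q t).1, hq t⟩, ?_⟩ (fun _ => rfl) (fun _ => rfl)
    (Subtype.ext (congrArg (fun x : Surface g => x.1) (p.source.trans q.source.symm)))
    (Subtype.ext (congrArg (fun x : Surface g => x.1) (p.target.trans q.target.symm)))
  · exact Continuous.subtype_mk (continuous_subtype_val.comp p.continuous) _
  · exact Continuous.subtype_mk (continuous_subtype_val.comp q.continuous) _

theorem inBase_trans {x y z : Surface g} (p : Path x y) (q : Path y z) (hp : ∀ t, InBase g (p t).1)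
    (hq : ∀ t, InBase g (q t).1) (t : I) : InBase g ((p.trans q) t).1 := by
  rw [Path.trans_apply]
  split_ifs
  exacts [hp _, hq _]

/-- The class of the segment from `⋆` to a point of the rectangle. -/
def baseClass (x : Base g) : Path.Homotopic.Quotient (star g) (baseIncl g x) :=
  .mk (baseSegment _ _ (inBase_star g) x.2)

theorem inBase_baseSegment {p q : Surface g} (hp : InBase g p.1) (hq : InBase g q.1) (t : I) :
    InBase g (baseSegment p q hp hq t).1 :=
  (convex_inBase g).lineMap_mem hp hq t.2

/-- The left end point of the core of a handle. -/
def leftFoot : sphere (0 : ℝ) 1 × Icc (2 : ℝ) 4 := (⟨-1, by simp⟩, ⟨3, by norm_num⟩)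

/-- The right end point of the core of a handle. -/
def rightFoot : sphere (0 : ℝ) 1 × Icc (2 : ℝ) 4 := (⟨1, by simp⟩, ⟨3, by norm_num⟩)

/-- The core of a handle. -/
def handleCore : C(I, closedBall (0 : ℝ) 1 × Icc (2 : ℝ) 4) where
  toFun r := (⟨2 * (r : ℝ) - 1, by
    have h1 := r.2.1
    have h2 := r.2.2
    rw [mem_closedBall_zero_iff, Real.norm_eq_abs, abs_le]
    constructor <;> linarith⟩, ⟨3, by norm_num⟩)
  continuous_toFun := by
    refine Continuous.prodMk (Continuous.subtype_mk ?_ _) continuous_const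
    fun_prop

theorem handleCore_zero :
    handleCore 0 = (⟨leftFoot.1, sphere_subset_closedBall leftFoot.1.2⟩, leftFoot.2) := by
  refine Prod.ext (Subtype.ext ?_) rfl
  simp [handleCore, leftFoot]

theorem handleCore_one :
    handleCore 1 = (⟨rightFoot.1, sphere_subset_closedBall rightFoot.1.2⟩, rightFoot.2) := by
  refine Prod.ext (Subtype.ext ?_) rfl
  simp [handleCore, rightFoot]
  norm_num

/-- The core of a band. -/
def bandPath (b : BandIndex g) :
    Path (baseIncl g (bandFoot g (b, leftFoot))) (baseIncl g (bandFoot g (b, rightFoot))) where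
  toFun r := bandMap g (b, handleCore r)
  continuous_toFun := by fun_prop
  source' := by
    rw [handleCore_zero]
    exact (isHandleAttachment_surface g).glue b _ _
  target' := by
    rw [handleCore_one]
    exact (isHandleAttachment_surface g).glue b _ _

/-- The class of the loop that runs through a band. -/
def bandLoop (b : BandIndex g) : Path.Homotopic.Quotient (star g) (star g) :=
  ((baseClass _).trans (.mk (bandPath b))).trans (baseClass _).symm

/-- The circle around a band, run clockwise from its lowest point. -/
def bandCircle (b : BandIndex g) : C(ℝ, Surface g) where
  toFun s := bandAnnulus g b (Circle.exp (-(Real.pi / 2) - 2 * Real.pi * s), jMid)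
  continuous_toFun := by fun_prop

theorem bottom_re (s : ℝ) : (Circle.exp (-(Real.pi / 2) - 2 * Real.pi * s) : ℂ).re =
    -Real.sin (2 * Real.pi * s) := by
  rw [Circle.coe_exp, Complex.exp_ofReal_mul_I_re, ← Real.cos_neg, neg_sub, sub_neg_eq_add,
    Real.cos_add_pi_div_two]

theorem bottom_im (s : ℝ) : (Circle.exp (-(Real.pi / 2) - 2 * Real.pi * s) : ℂ).im =
    -Real.cos (2 * Real.pi * s) := by
  rw [Circle.coe_exp, Complex.exp_ofReal_mul_I_im, ← neg_neg (Real.sin _), ← Real.sin_neg, neg_sub,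
    sub_neg_eq_add, Real.sin_add_pi_div_two]

theorem inBase_bandCircle (b : BandIndex g) {s : ℝ} (h : 0 ≤ Real.cos (2 * Real.pi * s)) :
    InBase g (bandCircle b s).1 :=
  inBase_bandAnnulus b _ (by rw [bottom_im]; linarith)

theorem cos_nonneg_of_le_quarter {s : ℝ} (h0 : 0 ≤ s) (h1 : s ≤ 1 / 4) :
    0 ≤ Real.cos (2 * Real.pi * s) := by
  have := Real.pi_pos
  refine Real.cos_nonneg_of_mem_Icc ⟨?_, ?_⟩ <;> nlinarith

theorem cos_nonneg_of_three_quarters_le {s : ℝ} (h0 : 3 / 4 ≤ s) (h1 : s ≤ 1) :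
    0 ≤ Real.cos (2 * Real.pi * s) := by
  have := Real.pi_pos
  rw [← Real.cos_sub_two_pi]
  refine Real.cos_nonneg_of_mem_Icc ⟨?_, ?_⟩ <;> nlinarith

theorem cos_nonpos_of_mem_middle {s : ℝ} (h0 : 1 / 4 ≤ s) (h1 : s ≤ 3 / 4) :
    Real.cos (2 * Real.pi * s) ≤ 0 := by
  have := Real.pi_pos
  refine Real.cos_nonpos_of_pi_div_two_le_of_le ?_ ?_ <;> nlinarith

/-- A loop that runs once around a band, joined to `⋆` in the rectangle, runs through the band. -/
theorem mk_eq_bandLoop (b : BandIndex g) {x : Surface g} (w : Path (star g) x) (p : Path x x)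
    (hw : ∀ t, InBase g (w t).1) (hp : ∀ t : I, p t = bandCircle b t) :
    ((Path.Homotopic.Quotient.mk w).trans (.mk p)).trans (Path.Homotopic.Quotient.mk w).symm =
      bandLoop b := by
  have hx0 : x = bandCircle b 0 := by rw [← p.source, hp]; rfl
  have hx1 : x = bandCircle b 1 := by rw [← p.target, hp]; rfl
  -- Clockwise from its lowest point, the circle reaches the left foot at `1/4` and the right foot
  -- at `3/4`; it is in the band between these times and in the rectangle otherwise.
  have hmid : ∀ s : ℝ, 1 / 4 ≤ s → s ≤ 3 / 4 → bandCircle b s = bandMap g (b,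
      ⟨_, re_mem_closedBall (Circle.exp (-(Real.pi / 2) - 2 * Real.pi * s))⟩, leftFoot.2) := by
    intro s h0 h1
    refine (bandAnnulus_eq_bandMap b jMid ?_).trans ?_
    · rw [bottom_im]; linarith [cos_nonpos_of_mem_middle h0 h1]
    · congr 3
      exact Subtype.ext (by simp [leftFoot, jMid])
  have hl : baseIncl g (bandFoot g (b, leftFoot)) = bandCircle b (1 / 4) := by
    rw [hmid _ le_rfl (by norm_num), ← (isHandleAttachment_surface g).glue]
    congr 3
    refine Subtype.ext ?_
    change (-1 : ℝ) = (Circle.exp (-(Real.pi / 2) - 2 * Real.pi * (1 / 4)) : ℂ).re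
    rw [bottom_re, show 2 * Real.pi * (1 / 4) = Real.pi / 2 by ring, Real.sin_pi_div_two]
  have hr : baseIncl g (bandFoot g (b, rightFoot)) = bandCircle b (3 / 4) := by
    rw [hmid _ (by norm_num) le_rfl, ← (isHandleAttachment_surface g).glue]
    congr 3
    refine Subtype.ext ?_
    change (1 : ℝ) = (Circle.exp (-(Real.pi / 2) - 2 * Real.pi * (3 / 4)) : ℂ).re
    rw [bottom_re, show 2 * Real.pi * (3 / 4) = Real.pi / 2 + Real.pi by ring, Real.sin_add_pi,
      Real.sin_pi_div_two, neg_neg]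
  let q₁ : Path x (baseIncl g (bandFoot g (b, leftFoot))) :=
    ⟨⟨fun t : I => bandCircle b (0 + t * (1 / 4 - 0)), by fun_prop⟩, by simp [hx0], by simp [hl]⟩
  let q₂ : Path (baseIncl g (bandFoot g (b, leftFoot))) (baseIncl g (bandFoot g (b, rightFoot))) :=
    ⟨⟨fun t : I => bandCircle b (1 / 4 + t * (3 / 4 - 1 / 4)), by fun_prop⟩, by simp [hl],
      by simp [hr]⟩
  let q₃ : Path (baseIncl g (bandFoot g (b, rightFoot))) x :=
    ⟨⟨fun t : I => bandCircle b (3 / 4 + t * (1 - 3 / 4)), by fun_prop⟩, by simp [hr],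
      by simp [hx1]⟩
  let q₂₃ : Path (baseIncl g (bandFoot g (b, leftFoot))) x :=
    ⟨⟨fun t : I => bandCircle b (1 / 4 + t * (1 - 1 / 4)), by fun_prop⟩, by simp [hl],
      by simp [hx1]⟩
  have e1 : Path.Homotopic.Quotient.mk p = (Path.Homotopic.Quotient.mk q₁).trans (.mk q₂₃) :=
    mk_eq_trans_of_real (bandCircle b) 0 (1 / 4) 1 p q₁ q₂₃ (fun t => by simp [hp])
      (fun _ => rfl) fun _ => rfl
  have e2 : Path.Homotopic.Quotient.mk q₂₃ = (Path.Homotopic.Quotient.mk q₂).trans (.mk q₃) :=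
    mk_eq_trans_of_real (bandCircle b) (1 / 4) (3 / 4) 1 q₂₃ q₂ q₃ (fun _ => rfl)
      (fun _ => rfl) fun _ => rfl
  have e3 : Path.Homotopic.Quotient.mk q₂ = .mk (bandPath b) := by
    refine IsHandleAttachment.mk_eq_mk_of_handle (k := bandMap g) b q₂ (bandPath b)
      ⟨fun t : I => (⟨_, re_mem_closedBall
        (Circle.exp (-(Real.pi / 2) - 2 * Real.pi * (1 / 4 + t * (3 / 4 - 1 / 4))))⟩,
          leftFoot.2), ?_⟩ handleCore (fun t => hmid _ ?_ ?_) (fun _ => rfl) ?_ ?_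
    · refine Continuous.prodMk (Continuous.subtype_mk ?_ _) continuous_const
      fun_prop
    · linarith [t.2.1]
    · linarith [t.2.2]
    · refine Prod.ext (Subtype.ext ?_) rfl
      change (Circle.exp
        (-(Real.pi / 2) - 2 * Real.pi * (1 / 4 + ((0 : I) : ℝ) * (3 / 4 - 1 / 4)))
          : ℂ).re = 2 * ((0 : I) : ℝ) - 1
      rw [bottom_re, Set.Icc.coe_zero,
        show 2 * Real.pi * (1 / 4 + 0 * (3 / 4 - 1 / 4)) = Real.pi / 2 by ring, Real.sin_pi_div_two]
      norm_num
    · refine Prod.ext (Subtype.ext ?_) rfl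
      change (Circle.exp
        (-(Real.pi / 2) - 2 * Real.pi * (1 / 4 + ((1 : I) : ℝ) * (3 / 4 - 1 / 4)))
          : ℂ).re = 2 * ((1 : I) : ℝ) - 1
      rw [bottom_re, Set.Icc.coe_one,
        show 2 * Real.pi * (1 / 4 + 1 * (3 / 4 - 1 / 4)) = Real.pi / 2 + Real.pi by ring,
        Real.sin_add_pi, Real.sin_pi_div_two]
      norm_num
  have e4 : (Path.Homotopic.Quotient.mk w).trans (.mk q₁) = baseClass _ := by
    rw [← Path.Homotopic.Quotient.mk_trans]
    refine mk_eq_mk_of_inBase _ _ (inBase_trans _ _ hw fun t => ?_) (inBase_baseSegment _ _)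
    refine inBase_bandCircle b (cos_nonneg_of_le_quarter ?_ ?_) <;> linarith [t.2.1, t.2.2]
  have e5 : (Path.Homotopic.Quotient.mk q₃).trans (Path.Homotopic.Quotient.mk w).symm =
      (baseClass (bandFoot g (b, rightFoot))).symm := by
    change (Path.Homotopic.Quotient.mk q₃).trans (Path.Homotopic.Quotient.mk w.symm) = .mk _
    rw [← Path.Homotopic.Quotient.mk_trans]
    refine mk_eq_mk_of_inBase _ _ (inBase_trans _ _ (fun t => ?_) fun t => hw _)
      fun t => inBase_baseSegment (inBase_star g) (bandFoot g (b, rightFoot)).2 (σ t)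
    refine inBase_bandCircle b (cos_nonneg_of_three_quarters_le ?_ ?_) <;> linarith [t.2.1, t.2.2]
  rw [e1, e2, e3, bandLoop, ← e4, ← e5]
  simp only [Path.Homotopic.Quotient.trans_assoc]

theorem mk_loopA (i : Fin g) : Path.Homotopic.Quotient.mk (loopA g i) = bandLoop (Sum.inl i) :=
  mk_eq_bandLoop (Sum.inl i) (baseSegment _ _ (inBase_star g) (inBase_coreA g i)) (coreA g i)
    (inBase_baseSegment _ _) fun _ => rfl

/-- Parallels are run counterclockwise, against `bandCircle`, hence the inverse. -/
theorem mk_loopB_symm (i : Fin g) :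
    Path.Homotopic.Quotient.mk (loopB g i).symm = bandLoop (Sum.inr i) := by
  rw [← mk_eq_bandLoop (Sum.inr i) (baseSegment _ _ (inBase_star g) (inBase_coreB g i))
    (coreB g i).symm (inBase_baseSegment _ _) ?_]
  · rw [loopB, Path.trans_symm, Path.trans_symm, Path.symm_symm, Path.Homotopic.Quotient.mk_trans,
      Path.Homotopic.Quotient.mk_trans, Path.Homotopic.Quotient.trans_assoc]
    rfl
  · intro t
    change annulusB g i (Circle.exp (-(Real.pi / 2) + 2 * Real.pi * (σ t : I)), jMid) =
      annulusB g i (Circle.exp (-(Real.pi / 2) - 2 * Real.pi * t), jMid)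
    congr 2
    rw [unitInterval.coe_symm_eq, ← Circle.exp_sub_two_pi]
    congr 1
    ring

/-- A set of loops of `F_g` that contains the loops through the bands and is closed under the group
operations contains all loops. -/
theorem surface_loop_induction (S : Path.Homotopic.Quotient (star g) (star g) → Prop)
    (S_refl : S (.refl _)) (S_trans : ∀ l m, S l → S m → S (l.trans m))
    (S_symm : ∀ l, S l → S l.symm) (hS : ∀ b, S (bandLoop b))
    (l : Path.Homotopic.Quotient (star g) (star g)) : S l := by
  induction l using Path.Homotopic.Quotient.ind with
  | mk p =>
  have hbase : ∀ {x x' : Base g} (q : Path x x'), (baseClass x).trans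
      (.mk (q.map (baseIncl g).continuous)) = baseClass x' := by
    intro x x' q
    rw [baseClass, baseClass, ← Path.Homotopic.Quotient.mk_trans]
    exact mk_eq_mk_of_inBase _ _ (inBase_trans _ _ (inBase_baseSegment _ _) fun t => (q t).2)
      (inBase_baseSegment _ _)
  let x₀ : Base g := ⟨_, inBase_star g⟩
  have hx₀ : baseClass x₀ = .refl _ :=
    mk_eq_mk_of_inBase (baseSegment _ _ (inBase_star g) x₀.2) (Path.refl (star g))
      (inBase_baseSegment _ _) fun _ => inBase_star g
  -- The rectangle contributes only trivial loops. The sphere `∂D` consists of two points, so from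
  -- the left foot one either crosses the band, which gives `bandLoop b`, or stays put.
  have key := (isHandleAttachment_surface g).generation S S_refl S_trans S_symm baseClass
    (fun {x x'} q => by
      rw [hbase q, Path.Homotopic.Quotient.trans_symm]; exact S_refl) (fun _ => leftFoot) (by
      rintro b ⟨⟨u, hu⟩, t⟩
      have hj : ∀ v : sphere (0 : ℝ) 1, Joined (v, (⟨3, by norm_num⟩ : Icc (2 : ℝ) 4)) (v, t) :=
        fun v => ⟨(Path.refl v).prod (PathConnectedSpace.somePath _ _)⟩
      have hu' := mem_sphere_zero_iff_norm.1 hu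
      rw [Real.norm_eq_abs] at hu'
      rcases eq_or_eq_neg_of_abs_eq hu' with rfl | rfl
      · exact ⟨rightFoot, hj _, bandPath b, handleCore, handleCore_zero, handleCore_one,
          fun _ => rfl, hS b⟩
      · refine ⟨leftFoot, hj _, Path.refl _, ContinuousMap.const _
          (⟨leftFoot.1, sphere_subset_closedBall leftFoot.1.2⟩, leftFoot.2), rfl, rfl,
          fun _ => ((isHandleAttachment_surface g).glue b _ _).symm, ?_⟩
        rw [Path.Homotopic.Quotient.mk_refl, Path.Homotopic.Quotient.trans_refl,
          Path.Homotopic.Quotient.trans_symm]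
        exact S_refl) (x := x₀) (x' := x₀) p
  rw [hx₀] at key
  exact (congrArg S ((Path.Homotopic.Quotient.trans_refl _).trans
    (Path.Homotopic.Quotient.refl_trans (.mk p)))).mp key

instance (g : ℕ) : PathConnectedSpace (Surface g) where
  nonempty := ⟨star g⟩
  joined := by
    have hb : ContractibleSpace (closedBall (0 : ℝ) 1) :=
      (convex_closedBall (0 : ℝ) 1).contractibleSpace ⟨0, by simp⟩
    have hstar : ∀ x, Joined (star g) x := by
      intro x
      rcases (isHandleAttachment_surface g).surj x with ⟨y, rfl⟩ | ⟨⟨b, z⟩, rfl⟩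
      · exact ⟨baseSegment _ _ (inBase_star g) y.2⟩
      · have h1 : Joined (star g) (baseIncl g (bandFoot g (b, leftFoot))) :=
          ⟨baseSegment _ _ (inBase_star g) (bandFoot g (b, leftFoot)).2⟩
        rw [← (isHandleAttachment_surface g).glue] at h1
        let p := PathConnectedSpace.somePath ((⟨leftFoot.1, sphere_subset_closedBall leftFoot.1.2⟩,
          leftFoot.2) : closedBall (0 : ℝ) 1 × Icc (2 : ℝ) 4) z
        exact h1.trans ⟨p.map (f := fun z => bandMap g (b, z)) (by fun_prop)⟩
    exact fun x y => (hstar x).symm.trans (hstar y)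

end SurfaceLoops

/-! ## Linear forms on twisted homology -/

section WedgeForms

open Topology unitInterval

/-- The group of affine transformations `x ↦ tr + lin * x` of a ring. -/
@[ext]
structure AffineUnit (R : Type*) [CommRing R] where
  lin : Rˣ
  tr : R

namespace AffineUnit

variable {R : Type*} [CommRing R]

instance : Mul (AffineUnit R) := ⟨fun a b => ⟨a.lin * b.lin, a.tr + a.lin * b.tr⟩⟩
instance : One (AffineUnit R) := ⟨⟨1, 0⟩⟩
instance : Inv (AffineUnit R) := ⟨fun a => ⟨a.lin⁻¹, -(((a.lin⁻¹ : Rˣ) : R) * a.tr)⟩⟩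

theorem mul_lin (a b : AffineUnit R) : (a * b).lin = a.lin * b.lin := rfl
theorem mul_tr (a b : AffineUnit R) : (a * b).tr = a.tr + a.lin * b.tr := rfl
theorem one_lin : (1 : AffineUnit R).lin = 1 := rfl
theorem one_tr : (1 : AffineUnit R).tr = 0 := rfl

instance : Group (AffineUnit R) :=
  Group.ofLeftAxioms
    (fun a b c => AffineUnit.ext (mul_assoc _ _ _) (by
      simp only [mul_tr, mul_lin, Units.val_mul]; ring))
    (fun a => AffineUnit.ext (one_mul _) (by simp [mul_tr, one_lin, one_tr]))
    (fun a => AffineUnit.ext (inv_mul_cancel _) (neg_add_cancel _))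

end AffineUnit

variable {ι : Type*}

instance : One (Wedge ι) := ⟨⟨fun _ => 1, fun _ _ _ => Or.inl rfl⟩⟩

/-- The point of the `i`-th circle of the wedge with a given coordinate. -/
def wedgePoint [DecidableEq ι] (i : ι) : C(Circle, Wedge ι) where
  toFun u := ⟨Pi.mulSingle (M := fun _ => Circle) i u, fun j k hjk => by
    by_cases h : j = i
    · right
      rw [Pi.mulSingle_eq_of_ne (by rintro rfl; exact hjk h)]
    · left
      rw [Pi.mulSingle_eq_of_ne h]⟩
  continuous_toFun := Continuous.subtype_mk (continuous_mulSingle (A := fun _ => Circle) i) _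

theorem wedgePoint_one [DecidableEq ι] (i : ι) : wedgePoint i 1 = 1 :=
  Subtype.ext (Pi.mulSingle_one (M := fun _ => Circle) i)

theorem one_ne_neg_one_complex : ((1 : Circle) : ℂ) ≠ -1 := by
  intro h
  have := congrArg Complex.re h
  norm_num at this

/-- The loop is cut at `1/4` and `3/4`. The outer arcs avoid `-1` and contribute `1`; the middle arc
goes from the upper to the lower half circle and contributes an inverse, so the inverses of the `γ
i` are prescribed at the start. -/
theorem exists_wedge_holonomy_circle [Finite ι] [DecidableEq ι] {Γ : Type*} [Group Γ] (γ : ι → Γ) :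
    ∃ hol : ∀ {a b : Wedge ι}, Path.Homotopic.Quotient a b → Γ,
      (∀ {a b c : Wedge ι} (p : Path.Homotopic.Quotient a b) (q : Path.Homotopic.Quotient b c),
        hol (p.trans q) = hol p * hol q) ∧
      (∀ {a b : Wedge ι} (p : Path a b), (∀ t, p t = 1) → hol (.mk p) = 1) ∧
      (∀ {a b : Wedge ι} (p : Path a b) (i : ι),
        (∀ t : I, p t = wedgePoint i (Circle.exp (2 * Real.pi * t))) → hol (.mk p) = γ i) := by
  obtain ⟨hol, h1, h2, h3, -⟩ := exists_wedge_holonomy fun i => (γ i)⁻¹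
  refine ⟨hol, h1, fun p hp => h2 p fun t i => ?_, fun {a b} p i hp => ?_⟩
  · rw [hp]
    exact one_ne_neg_one_complex
  let c : C(ℝ, Wedge ι) := ⟨fun s => wedgePoint i (Circle.exp (2 * Real.pi * s)), by fun_prop⟩
  have hc : ∀ s j, j ≠ i → (c s).1 j = 1 := fun s j hj =>
    Pi.mulSingle_eq_of_ne (M := fun _ => Circle) hj _
  have hci : ∀ s, (c s).1 i = Circle.exp (2 * Real.pi * s) := fun s =>
    Pi.mulSingle_eq_same (M := fun _ => Circle) i _
  have him : ∀ s, ((c s).1 i : ℂ).im = Real.sin (2 * Real.pi * s) := fun s => by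
    rw [hci, Circle.coe_exp, Complex.exp_ofReal_mul_I_im]
  have hre : ∀ s, ((c s).1 i : ℂ).re = Real.cos (2 * Real.pi * s) := fun s => by
    rw [hci, Circle.coe_exp, Complex.exp_ofReal_mul_I_re]
  have ha : a = c 0 := by rw [← p.source, hp]; rfl
  have hb : b = c 1 := by rw [← p.target, hp]; rfl
  let q₁ : Path a (c (1 / 4)) :=
    ⟨⟨fun t : I => c (0 + t * (1 / 4 - 0)), by fun_prop⟩, by simp [ha], by simp⟩
  let q₂ : Path (c (1 / 4)) (c (3 / 4)) :=
    ⟨⟨fun t : I => c (1 / 4 + t * (3 / 4 - 1 / 4)), by fun_prop⟩, by simp, by simp⟩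
  let q₃ : Path (c (3 / 4)) b :=
    ⟨⟨fun t : I => c (3 / 4 + t * (1 - 3 / 4)), by fun_prop⟩, by simp, by simp [hb]⟩
  let q₂₃ : Path (c (1 / 4)) b :=
    ⟨⟨fun t : I => c (1 / 4 + t * (1 - 1 / 4)), by fun_prop⟩, by simp, by simp [hb]⟩
  have e1 : Path.Homotopic.Quotient.mk p = (Path.Homotopic.Quotient.mk q₁).trans (.mk q₂₃) :=
    mk_eq_trans_of_real c 0 (1 / 4) 1 p q₁ q₂₃ (fun t => by simp [hp, c]) (fun _ => rfl)
      fun _ => rfl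
  have e2 : Path.Homotopic.Quotient.mk q₂₃ = (Path.Homotopic.Quotient.mk q₂).trans (.mk q₃) :=
    mk_eq_trans_of_real c (1 / 4) (3 / 4) 1 q₂₃ q₂ q₃ (fun _ => rfl) (fun _ => rfl) fun _ => rfl
  have hbase : ∀ s, 0 ≤ Real.cos (2 * Real.pi * s) → ∀ j, ((c s).1 j : ℂ) ≠ -1 := by
    intro s hs j hj
    by_cases hji : j = i
    · subst hji
      have := hre s
      rw [hj] at this
      norm_num at this
      linarith
    · rw [hc s j hji] at hj
      exact one_ne_neg_one_complex hj
  have f1 : hol (.mk q₁) = 1 := by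
    refine h2 q₁ fun t => hbase _ (cos_nonneg_of_le_quarter ?_ ?_) <;> linarith [t.2.1, t.2.2]
  have f3 : hol (.mk q₃) = 1 := by
    refine h2 q₃ fun t => hbase _ (cos_nonneg_of_three_quarters_le ?_ ?_) <;>
      linarith [t.2.1, t.2.2]
  have f2 : hol (.mk q₂) = γ i := by
    refine (h3 q₂ i ?_ ?_ fun t ht => ?_).trans (inv_inv _)
    · rw [him, show 2 * Real.pi * (1 / 4) = Real.pi / 2 by ring, Real.sin_pi_div_two]
      exact one_pos
    · rw [him, show 2 * Real.pi * (3 / 4) = Real.pi / 2 + Real.pi by ring, Real.sin_add_pi,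
        Real.sin_pi_div_two]
      norm_num
    · have h4 := hre (1 / 4 + t * (3 / 4 - 1 / 4))
      have h5 : (c (1 / 4 + t * (3 / 4 - 1 / 4))).1 i = 1 := ht
      have h6 := cos_nonpos_of_mem_middle (s := 1 / 4 + t * (3 / 4 - 1 / 4))
        (by linarith [t.2.1]) (by linarith [t.2.2])
      rw [h5] at h4
      norm_num at h4
      linarith
  rw [e1, e2]
  refine (h1 _ _).trans ?_
  rw [f1, one_mul]
  refine (h1 _ _).trans ?_
  rw [f2, f3, mul_one]

variable {Y : Type*} [TopologicalSpace Y] {y₀ : Y}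

/-- The class `l` is represented by a loop which `θ` maps to the loop that runs once through the
`i`-th circle of the wedge, up to constant paths. -/
def IsWedgeLoop [DecidableEq ι] (θ : C(Y, Wedge ι)) (i : ι)
    (l : Path.Homotopic.Quotient y₀ y₀) : Prop :=
  ∃ (a b : Y) (u : Path y₀ a) (p : Path a b) (v : Path b y₀),
    l = ((Path.Homotopic.Quotient.mk u).trans (.mk p)).trans (.mk v) ∧ (∀ t, θ (u t) = 1) ∧
      (∀ t : I, θ (p t) = wedgePoint i (Circle.exp (2 * Real.pi * t))) ∧ ∀ t, θ (v t) = 1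

/-- The loops `m i` generate the fundamental group. -/
def LoopsGenerate {κ : Type*} (m : κ → Path.Homotopic.Quotient y₀ y₀) : Prop :=
  ∀ S : Path.Homotopic.Quotient y₀ y₀ → Prop, S (.refl y₀) →
    (∀ l l', S l → S l' → S (l.trans l')) → (∀ l, S l → S l.symm) → (∀ i, S (m i)) → ∀ l, S l

variable {R : Type*} [CommRing R] {G : Subgroup Rˣ}

/-- If `θ` maps generators of the fundamental group to the circles of a wedge, then there is a
linear form on twisted homology with prescribed values on the generators. -/
theorem exists_wedge_form [Finite ι] [DecidableEq ι] (θ : C(Y, Wedge ι)) (A : Set Y)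
    (hA : ∀ x ∈ A, θ x = 1) (m : ι → Path.Homotopic.Quotient y₀ y₀) (hm : LoopsGenerate m)
    (hθ : ∀ i, IsWedgeLoop θ i (m i)) (φ : H1 Y y₀ →* G) (c : ι → R) :
    ∃ (F : ChainModBoundaries A φ →ₗ[R] R) (T : Path.Homotopic.Quotient y₀ y₀ → R),
      (∀ i, T (m i) = c i) ∧
      ∀ (a : Y) (w : Path y₀ a) (p : Path a a), (∀ t, θ (w t) = 1) →
        F (edge A φ (.mk w) p) =
          T (((Path.Homotopic.Quotient.mk w).trans (.mk p)).trans (.mk w.symm)) := by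
  -- The generator `m i` is to act by the affine map with linear part `φ (m i)` and translation part
  -- `c i`.
  obtain ⟨hol, h1, h2, h3⟩ := exists_wedge_holonomy_circle (ι := ι) (Γ := AffineUnit R) fun i =>
    ⟨(φ (Abelianization.of (FundamentalGroup.fromPath (m i))) : Rˣ), c i⟩
  let H : ∀ {a b : Y}, Path.Homotopic.Quotient a b → AffineUnit R := fun p => hol (p.map θ)
  have H_trans : ∀ {a b c : Y} (p : Path.Homotopic.Quotient a b) (q : Path.Homotopic.Quotient b c),
      H (p.trans q) = H p * H q := by
    intro a b c p q
    change hol _ = _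
    rw [map_trans']
    exact h1 _ _
  have H_one : ∀ {a b : Y} (p : Path a b), (∀ t, θ (p t) = 1) → H (.mk p) = 1 := fun p hp =>
    h2 (p.map θ.continuous) hp
  have H_gen : ∀ i, H (m i) =
      ⟨(φ (Abelianization.of (FundamentalGroup.fromPath (m i))) : Rˣ), c i⟩ := by
    intro i
    obtain ⟨a, b, u, p, v, hl, hu, hp, hv⟩ := hθ i
    conv_lhs => rw [hl]
    rw [H_trans, H_trans, H_one u hu, H_one v hv, one_mul, mul_one]
    exact h3 (p.map θ.continuous) i hp
  have H_refl : ∀ y : Y, H (.refl y) = 1 := by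
    intro y
    have := H_trans (.refl y) (.refl y)
    rwa [Path.Homotopic.Quotient.refl_trans, left_eq_mul] at this
  have H_symm : ∀ {a b : Y} (p : Path.Homotopic.Quotient a b), H p * H p.symm = 1 := by
    intro a b p
    rw [← H_trans, Path.Homotopic.Quotient.trans_symm, H_refl]
  -- Both sides are multiplicative and agree on the `m i`; this is where generation is needed.
  have hφ : ∀ l : Path.Homotopic.Quotient y₀ y₀, weight φ l = ((H l).lin : R) := by
    refine hm _ ?_ ?_ ?_ ?_
    · rw [weight_refl, H_refl]
      rfl
    · intro l l' hl hl'
      rw [weight_trans, H_trans, hl, hl']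
      rfl
    · intro l hl
      have e1 : weight φ l * weight φ l.symm = 1 := by
        rw [← weight_trans, Path.Homotopic.Quotient.trans_symm, weight_refl]
      have e2 : ((H l).lin : R) * ((H l.symm).lin : R) = 1 := by
        rw [← Units.val_mul, ← AffineUnit.mul_lin, H_symm]
        rfl
      rw [hl] at e1
      exact (Units.isUnit (H l).lin).mul_left_cancel (e1.trans e2.symm)
    · intro i
      rw [H_gen]
      rfl
  obtain ⟨F, hF⟩ := exists_linearForm A φ (fun p => ((H p).lin : R)) (fun p => (H p).tr)
    (fun p q => by rw [H_trans]; rfl) (fun p q => by rw [H_trans]; rfl) hφ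
    (fun p hp => by rw [H_one p fun t => hA _ (hp t)]; rfl)
  refine ⟨F, fun l => (H l).tr, fun i => congrArg AffineUnit.tr (H_gen i), fun a w p hw => ?_⟩
  rw [hF]
  simp only
  rw [H_trans, H_trans, H_one w hw, H_one w.symm fun t => hw _, one_mul, mul_one]
  simp [AffineUnit.one_lin]

end WedgeForms

/-! ### The collapse of the surface to a wedge of circles -/

section Collapse

open Topology unitInterval Metric

variable {g : ℕ}

/-- The sign that relates the orientation of the loop through a band to that of its core. -/
def bandSign : BandIndex g → ℝ
  | .inl _ => 1
  | .inr _ => -1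

/-- The meridians and the parallels. -/
def bandRep (g : ℕ) : BandIndex g → Path (star g) (star g)
  | .inl i => loopA g i
  | .inr i => loopB g i

/-- The coordinate `z` along the core, in `[-1, 1]`, is wrapped once around the circle, so both feet
go to the wedge point. The sign `bandSign` makes meridians and parallels alike run positively around
their circles. -/
theorem exists_collapse (g : ℕ) : ∃ θ : C(Surface g, Wedge (BandIndex g)),
    (∀ x, θ (baseIncl g x) = 1) ∧ ∀ b z t, θ (bandMap g (b, z, t)) =
      wedgePoint b (Circle.exp (Real.pi * (1 + bandSign b * z))) := by
  obtain ⟨θ, h0, h1⟩ := (isHandleAttachment_surface g).exists_lift (Z := Wedge (BandIndex g))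
    (fun _ => 1) (fun x => wedgePoint x.1 (Circle.exp (Real.pi * (1 + bandSign x.1 * x.2.1)))) (by
      intro b u t
      have hu := mem_sphere_zero_iff_norm.1 u.2
      rw [Real.norm_eq_abs] at hu
      have h : bandSign b * (u : ℝ) = 1 ∨ bandSign b * (u : ℝ) = -1 := by
        rcases eq_or_eq_neg_of_abs_eq hu with h | h <;> rcases b with i | i <;> simp [bandSign, h]
      simp only
      rcases h with h | h <;> rw [h]
      · rw [show Real.pi * (1 + 1) = 2 * Real.pi by ring, Circle.exp_two_pi, wedgePoint_one]
      · rw [show Real.pi * (1 + -1) = 0 by ring, Circle.exp_zero, wedgePoint_one])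
  refine ⟨⟨θ, (isHandleAttachment_surface g).continuous ?_ ?_⟩, h0, fun b z t => h1 (b, z, t)⟩
  · simp only [h0]
    exact continuous_const
  · simp only [h1]
    refine continuous_prod_of_discrete_left.2 fun b => ?_
    fun_prop

/-- The map from `F_g` to a wedge of circles that collapses the rectangle and the directions
transverse to the cores of the bands. -/
def collapse (g : ℕ) : C(Surface g, Wedge (BandIndex g)) := (exists_collapse g).choose

theorem collapse_baseIncl (x : Base g) : collapse g (baseIncl g x) = 1 :=
  (exists_collapse g).choose_spec.1 x

theorem collapse_of_inBase {x : Surface g} (hx : InBase g x.1) : collapse g x = 1 :=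
  collapse_baseIncl ⟨x.1, hx⟩

theorem collapse_bandMap (b : BandIndex g) (z : closedBall (0 : ℝ) 1) (t : Icc (2 : ℝ) 4) :
    collapse g (bandMap g (b, z, t)) =
      wedgePoint b (Circle.exp (Real.pi * (1 + bandSign b * z))) :=
  (exists_collapse g).choose_spec.2 b z t

theorem symm_trans_trans_symm {X : Type*} [TopologicalSpace X] {x y a b : X} (u : Path x a)
    (p : Path a b) (v : Path y b) :
    (((Path.Homotopic.Quotient.mk u).trans (.mk p)).trans (.mk v.symm)).symm =
      ((Path.Homotopic.Quotient.mk v).trans (.mk p.symm)).trans (.mk u.symm) := by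
  rw [← Path.Homotopic.Quotient.mk_trans, ← Path.Homotopic.Quotient.mk_trans,
    ← Path.Homotopic.Quotient.mk_symm, Path.trans_symm, Path.trans_symm, Path.symm_symm,
    Path.Homotopic.Quotient.mk_trans, Path.Homotopic.Quotient.mk_trans,
    Path.Homotopic.Quotient.trans_assoc]

/-- Away from segments in the rectangle, a representative is the core of its band, run backwards for
the parallels, which `bandSign` compensates. -/
theorem exists_bandRep_eq (b : BandIndex g) : ∃ (x y : Base g)
    (p : Path (baseIncl g x) (baseIncl g y)), Path.Homotopic.Quotient.mk (bandRep g b) =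
      ((baseClass x).trans (.mk p)).trans (baseClass y).symm ∧
      ∀ t : I, collapse g (p t) = wedgePoint b (Circle.exp (2 * Real.pi * t)) := by
  rcases b with i | i
  · refine ⟨_, _, bandPath (Sum.inl i), mk_loopA i, fun t => ?_⟩
    refine (collapse_bandMap _ _ _).trans ?_
    congr 2
    simp only [bandSign]
    change Real.pi * (1 + 1 * (2 * (t : ℝ) - 1)) = _
    ring
  · refine ⟨_, _, (bandPath (Sum.inr i)).symm, ?_, fun t => ?_⟩
    · have h := congrArg Path.Homotopic.Quotient.symm (mk_loopB_symm i)
      rw [← Path.Homotopic.Quotient.mk_symm, Path.symm_symm] at h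
      refine h.trans ?_
      exact symm_trans_trans_symm _ _ _
    · refine (collapse_bandMap _ _ _).trans ?_
      congr 2
      simp only [bandSign]
      change Real.pi * (1 + -1 * (2 * ((σ t : I) : ℝ) - 1)) = _
      rw [unitInterval.coe_symm_eq]
      ring

theorem loopsGenerate_bandRep (g : ℕ) :
    LoopsGenerate fun b => Path.Homotopic.Quotient.mk (bandRep g b) := by
  intro S S_refl S_trans S_symm hS
  refine surface_loop_induction S S_refl S_trans S_symm fun b => ?_
  rcases b with i | i
  · rw [← mk_loopA]
    exact hS (Sum.inl i)
  · rw [← mk_loopB_symm]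
    exact S_symm _ (hS (Sum.inr i))

theorem isWedgeLoop_bandRep (b : BandIndex g) :
    IsWedgeLoop (collapse g) b (.mk (bandRep g b)) := by
  obtain ⟨x, y, p, h, hp⟩ := exists_bandRep_eq b
  exact ⟨_, _, baseSegment _ _ (inBase_star g) x.2, p, (baseSegment _ _ (inBase_star g) y.2).symm,
    h, fun t => collapse_of_inBase (inBase_baseSegment (inBase_star g) x.2 t), hp,
    fun t => collapse_of_inBase (inBase_baseSegment (inBase_star g) y.2 (σ t))⟩

end Collapse

/-! ### A basis of the twisted homology of the surface -/

section Independence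

variable {R : Type*} [CommRing R] {G : Subgroup Rˣ}

/-- A family with a dual family of linear forms is linearly independent. -/
theorem linearIndependent_of_forms {H κ : Type*} [AddCommGroup H] [Module R H] [DecidableEq κ]
    (e : κ → H) (F : κ → H →ₗ[R] R) (hF : ∀ i j, F i (e j) = (Pi.single i 1 : κ → R) j) :
    LinearIndependent R e := by
  refine LinearIndependent.of_comp (LinearMap.pi F) ?_
  have h : LinearMap.pi F ∘ e = fun j => (Pi.single j 1 : κ → R) := by
    ext j i
    simp [hF, Pi.single_apply, eq_comm]
  rw [h]
  exact Pi.linearIndependent_single_one κ R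

/-- The forms with values `Pi.single b 1` on the generators are dual to the family. -/
theorem linearIndependent_bandRep {g : ℕ} (φ : H1 (Surface g) (star g) →* G) :
    LinearIndependent R fun b => loopClass φ (bandRep g b) := by
  choose F T h1 h3 using fun b => exists_wedge_form (collapse g) {star g}
    (by rintro _ rfl; exact collapse_of_inBase (inBase_star g)) _ (loopsGenerate_bandRep g)
    isWedgeLoop_bandRep φ (Pi.single b 1 : BandIndex g → R)
  refine linearIndependent_of_forms _ (fun b => F b ∘ₗ homologyToChains {star g} φ) fun b b' => ?_
  rw [LinearMap.comp_apply, homologyToChains_loopClass, ← h1]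
  refine (h3 b _ (Path.refl _) (bandRep g b') fun t => collapse_of_inBase (inBase_star g)).trans ?_
  rw [Path.refl_symm, Path.Homotopic.Quotient.mk_refl, Path.Homotopic.Quotient.refl_trans,
    Path.Homotopic.Quotient.trans_refl]

/-- By the crossed homomorphism rule, the loops whose class lies in a fixed submodule are closed
under products and inverses, so generators of the fundamental group suffice. -/
theorem span_bandRep {g : ℕ} (φ : H1 (Surface g) (star g) →* G) :
    Submodule.span R (range fun b => loopClass φ (bandRep g b)) = ⊤ := by
  rw [← span_loopClass_eq_top φ]
  refine le_antisymm (Submodule.span_mono ?_) (Submodule.span_le.2 ?_)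
  · rintro _ ⟨b, rfl⟩
    exact ⟨_, rfl⟩
  set N := Submodule.span R (range fun b => loopClass φ (bandRep g b))
  have key := loopsGenerate_bandRep g (fun l => ∀ p, Path.Homotopic.Quotient.mk p = l →
    loopClass φ p ∈ N) ?_ ?_ ?_ ?_
  · rintro _ ⟨p, rfl⟩
    exact key (.mk p) p rfl
  · intro p hp
    rw [loopClass_homotopic φ (q := Path.refl _) (Path.Homotopic.Quotient.eq.1 hp), loopClass_refl]
    exact N.zero_mem
  · intro l l' hl hl' p hp
    induction l using Path.Homotopic.Quotient.ind with | mk q =>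
    induction l' using Path.Homotopic.Quotient.ind with | mk q' =>
    rw [loopClass_homotopic φ (q := q.trans q') (Path.Homotopic.Quotient.eq.1 hp), loopClass_trans]
    exact N.add_mem (hl q rfl) (N.smul_mem _ (hl' q' rfl))
  · intro l hl p hp
    induction l using Path.Homotopic.Quotient.ind with | mk q =>
    rw [loopClass_homotopic φ (q := q.symm) (Path.Homotopic.Quotient.eq.1 hp), loopClass_symm]
    exact N.neg_mem (N.smul_mem _ (hl q rfl))
  · intro b p hp
    rw [loopClass_homotopic φ (q := bandRep g b) (Path.Homotopic.Quotient.eq.1 hp)]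
    exact Submodule.subset_span ⟨b, rfl⟩

theorem subsingleton_twistedH1_disk (φ : H1 (Surface 0) (star 0) →* G) :
    Subsingleton (TwistedH1 {star 0} φ) := by
  have h := span_bandRep φ
  rw [range_eq_empty, Submodule.span_empty] at h
  exact (Submodule.subsingleton_iff R).1 (subsingleton_of_bot_eq_top h)

end Independence

/-! ## The handlebodies as handle attachments -/

section HandlebodyTopology

open Topology unitInterval Metric

variable {g : ℕ} (c : Fin g → C(Circle × J, Surface g)) (e : J)

instance : ContractibleSpace J := (convex_Icc (-1 : ℝ) 1).contractibleSpace ⟨0, by norm_num⟩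

/-- The unit sphere of `ℂ`, as the circle group. -/
def sphereToCircle : C(sphere (0 : ℂ) 1, Circle) where
  toFun u := ⟨u.1, u.2⟩
  continuous_toFun := Continuous.subtype_mk continuous_subtype_val _

/-- The handles of a handlebody. -/
def Handlebody.handle : C(Fin g × closedBall (0 : ℂ) 1 × J, Handlebody c e) where
  toFun x := Quot.mk _ (Sum.inr x)
  continuous_toFun := continuous_quot_mk.comp continuous_inr

/-- The attaching map of the handles of a handlebody. -/
def Handlebody.attach : C(Fin g × sphere (0 : ℂ) 1 × J, Surface g × J) where
  toFun x := (c x.1 (sphereToCircle x.2.1, x.2.2), e)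
  continuous_toFun := by
    refine Continuous.prodMk (continuous_prod_of_discrete_left.2 fun i => ?_) continuous_const
    fun_prop

theorem isHandleAttachment_handlebody :
    IsHandleAttachment (Handlebody.cyl c e) (Handlebody.handle c e) (Handlebody.attach c e) := by
  classical
  -- `N` is a normal form that moves boundary points of the handles to the cylinder. It respects the
  -- gluing, hence descends to the quotient and tells its points apart.
  let N : (Surface g × J) ⊕ (Fin g × closedBall (0 : ℂ) 1 × J) →
      (Surface g × J) ⊕ (Fin g × closedBall (0 : ℂ) 1 × J)
    | .inl x => .inl x
    | .inr z => if h : ‖(z.2.1 : ℂ)‖ = 1 then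
        .inl (Handlebody.attach c e (z.1, ⟨z.2.1, mem_sphere_zero_iff_norm.2 h⟩, z.2.2)) else .inr z
  have hN : ∀ x y, HandleRel c e x y → N x = N y := by
    rintro _ _ ⟨i, u, t⟩
    simp only [N, Circle.norm_coe, dite_true]
    rfl
  let N' : Handlebody c e → (Surface g × J) ⊕ (Fin g × closedBall (0 : ℂ) 1 × J) := Quot.lift N hN
  have hcyl : ∀ x, N' (Handlebody.cyl c e x) = .inl x := fun _ => rfl
  have hhandle : ∀ z, N' (Handlebody.handle c e z) = N (.inr z) := fun _ => rfl
  refine ⟨?_, ?_, ?_, ?_, ?_⟩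
  · have h : Sum.elim (Handlebody.cyl c e) (Handlebody.handle c e) = Quot.mk (HandleRel c e) := by
      funext x
      rcases x with x | x <;> rfl
    rw [h]
    exact isQuotientMap_quot_mk
  · intro i u t
    exact (Quot.sound (HandleRel.glue (c := c) (e := e) i (sphereToCircle u) t)).symm
  · intro x y hxy
    have h := congrArg N' hxy
    rwa [hcyl, hcyl, Sum.inl.injEq] at h
  · intro x z hxz
    have h := congrArg N' hxz
    rw [hcyl, hhandle] at h
    by_contra hz
    simp [N, hz] at h
  · intro z z' hz heq
    have h := congrArg N' heq
    rw [hhandle, hhandle] at h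
    simp only [N, dif_neg hz.ne] at h
    split_ifs at h with hz'
    exact Sum.inr.inj h

variable {c e}

/-- The class of a loop of `F_g`, placed in the handlebody at height `t` and joined to a base point
by a path. -/
def Handlebody.conj {t : J} {y₀ : Handlebody c e} (w : Path y₀ (Handlebody.level c e t (star g)))
    (p : Path (star g) (star g)) : Path.Homotopic.Quotient y₀ y₀ :=
  ((Path.Homotopic.Quotient.mk w).trans (.mk (p.map (Handlebody.level c e t).continuous))).trans
    (.mk w.symm)

/-- The second coordinate is a loop in the contractible interval `J`. -/
theorem mk_eq_mk_level_fst {t : J} {x y : Surface g} (L : Path (x, t) (y, t)) :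
    Path.Homotopic.Quotient.mk L = .mk ((L.map continuous_fst).map
      (f := fun x => (x, t)) (by fun_prop)) := by
  let q : Path t t := L.map continuous_snd
  have h1 : L = (L.map continuous_fst).prod q := Path.ext (funext fun _ => rfl)
  have h2 : (L.map continuous_fst).map (f := fun x => (x, t)) (by fun_prop) =
      (L.map continuous_fst).prod (Path.refl t) := Path.ext (funext fun _ => rfl)
  have h3 : Path.Homotopic.Quotient.mk q = .mk (Path.refl t) :=
    Path.Homotopic.Quotient.eq.2 (SimplyConnectedSpace.paths_homotopic _ _)
  rw [h2]
  refine (congrArg Path.Homotopic.Quotient.mk h1).trans ?_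
  rw [← Path.Homotopic.prod_lift, ← Path.Homotopic.prod_lift, h3]

/-- A loop of `F_g` in an annulus along which a handle is attached is contractible in the
handlebody. -/
theorem mk_level_eq_refl (i : Fin g) (t : J) {x : Surface g} (p : Path x x) (γ : C(I, Circle))
    (hγ : γ 0 = γ 1) (hp : ∀ r, p r = c i (γ r, jMid)) :
    Path.Homotopic.Quotient.mk (p.map (Handlebody.level c e t).continuous) = .refl _ := by
  -- The loop is slid vertically to the level `e` of the attaching region. There it is the image of
  -- a loop in the handle, where it contracts.
  let s : Path t e := PathConnectedSpace.somePath t e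
  let v : Path (Handlebody.level c e t x) (Handlebody.level c e e x) :=
    s.map (f := fun r => Handlebody.cyl c e (x, r)) (by fun_prop)
  have h1 := mk_trans_eq_of_square
    (⟨fun y => Handlebody.cyl c e (p y.2, s y.1), by fun_prop⟩ : C(I × I, Handlebody c e))
    (p.map (Handlebody.level c e t).continuous) v v (p.map (Handlebody.level c e e).continuous)
    (fun r => by simp [Handlebody.level]; rfl) (fun r => by simp [v]; rfl)
    (fun r => by simp [v]; rfl) (fun r => by simp [Handlebody.level]; rfl)
  have h2 : Path.Homotopic.Quotient.mk (p.map (Handlebody.level c e e).continuous) =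
      .mk (Path.refl _) := by
    let d : C(I, closedBall (0 : ℂ) 1 × J) :=
      ⟨fun r => (⟨γ r, by simp [Circle.norm_coe]⟩, jMid), by
        refine Continuous.prodMk (Continuous.subtype_mk ?_ _) continuous_const
        exact continuous_subtype_val.comp γ.continuous⟩
    have hd : ∀ r, Handlebody.handle c e (i, d r) = Handlebody.level c e e (p r) := by
      intro r
      rw [hp]
      exact (Quot.sound (HandleRel.glue (c := c) (e := e) i (γ r) jMid)).symm
    refine IsHandleAttachment.mk_eq_mk_of_handle (k := Handlebody.handle c e) i _ _ d
      (ContinuousMap.const _ (d 0)) (fun r => (hd r).symm) (fun r => ?_) rfl ?_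
    · change Handlebody.level c e e x = Handlebody.handle c e (i, d 0)
      rw [hd, p.source]
    · change d 1 = d 0
      simp [d, hγ]
  rw [h2, Path.Homotopic.Quotient.mk_refl, Path.Homotopic.Quotient.trans_refl] at h1
  have h3 := congrArg (fun l => l.trans (Path.Homotopic.Quotient.mk v).symm) h1
  simpa only [Path.Homotopic.Quotient.trans_assoc, Path.Homotopic.Quotient.trans_symm,
    Path.Homotopic.Quotient.trans_refl] using h3

theorem trans_trans_symm_eq_refl {X : Type*} [TopologicalSpace X] {a b : X}
    (u : Path.Homotopic.Quotient a b) {p : Path.Homotopic.Quotient b b} (hp : p = .refl b) :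
    (u.trans p).trans u.symm = .refl a := by
  rw [hp, Path.Homotopic.Quotient.trans_refl, Path.Homotopic.Quotient.trans_symm]

theorem trans_symm_conj_trans {X : Type*} [TopologicalSpace X] {a b : X}
    (u : Path.Homotopic.Quotient a b) (l : Path.Homotopic.Quotient a a) :
    (u.trans ((u.symm.trans l).trans u)).trans u.symm = l := by
  rw [Path.Homotopic.Quotient.trans_assoc, Path.Homotopic.Quotient.trans_assoc,
    Path.Homotopic.Quotient.trans_symm, Path.Homotopic.Quotient.trans_refl,
    ← Path.Homotopic.Quotient.trans_assoc, Path.Homotopic.Quotient.trans_symm,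
    Path.Homotopic.Quotient.refl_trans]

theorem trans_conj_trans_symm {X : Type*} [TopologicalSpace X] {a b c d : X}
    (w : Path.Homotopic.Quotient a b) (x : Path.Homotopic.Quotient b c)
    (q : Path.Homotopic.Quotient c d) (y : Path.Homotopic.Quotient b d) :
    (w.trans ((x.trans q).trans y.symm)).trans w.symm =
      ((w.trans x).trans q).trans (w.trans y).symm := by
  have h : (w.trans y).symm = y.symm.trans w.symm := by
    induction w using Path.Homotopic.Quotient.ind with | mk w =>
    induction y using Path.Homotopic.Quotient.ind with | mk y =>
    rw [← Path.Homotopic.Quotient.mk_trans, ← Path.Homotopic.Quotient.mk_symm, Path.trans_symm,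
      Path.Homotopic.Quotient.mk_trans, Path.Homotopic.Quotient.mk_symm,
      Path.Homotopic.Quotient.mk_symm]
  rw [h]
  simp only [Path.Homotopic.Quotient.trans_assoc]

/-- The loop is the core of an attaching annulus conjugated by a segment. -/
theorem mk_level_bandRep_eq_refl (i : Fin g) (b : BandIndex g) (hc : c i = bandAnnulus g b)
    (t : J) :
    Path.Homotopic.Quotient.mk ((bandRep g b).map (Handlebody.level c e t).continuous) =
      .refl _ := by
  rcases b with k | k
  · change Path.Homotopic.Quotient.mk ((loopA g k).map _) = _
    rw [loopA, Path.map_trans, Path.map_trans, Path.Homotopic.Quotient.mk_trans,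
      Path.Homotopic.Quotient.mk_trans]
    refine trans_trans_symm_eq_refl _ (mk_level_eq_refl i t (coreA g k)
      ⟨fun r => Circle.exp (-(Real.pi / 2) - 2 * Real.pi * r), by fun_prop⟩ (by simp) ?_)
    intro r
    rw [hc]
    rfl
  · change Path.Homotopic.Quotient.mk ((loopB g k).map _) = _
    rw [loopB, Path.map_trans, Path.map_trans, Path.Homotopic.Quotient.mk_trans,
      Path.Homotopic.Quotient.mk_trans]
    refine trans_trans_symm_eq_refl _ (mk_level_eq_refl i t (coreB g k)
      ⟨fun r => Circle.exp (-(Real.pi / 2) + 2 * Real.pi * r), by fun_prop⟩ (by simp) ?_)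
    intro r
    rw [hc]
    rfl

/-- The fundamental group of a handlebody is generated by the meridians and parallels which are not
contractible in it. -/
theorem loopsGenerate_handlebody {κ : Type*} {t : J} {y₀ : Handlebody c e}
    (w : Path y₀ (Handlebody.level c e t (star g))) (m : κ → Path.Homotopic.Quotient y₀ y₀)
    (hm : ∀ b, Handlebody.conj w (bandRep g b) = .refl y₀ ∨
      ∃ i, m i = Handlebody.conj w (bandRep g b)) : LoopsGenerate m := by
  intro S S_refl S_trans S_symm hS
  have hconj : ∀ l : Path.Homotopic.Quotient (star g) (star g),
      S (((Path.Homotopic.Quotient.mk w).trans (l.map (Handlebody.level c e t))).trans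
        (Path.Homotopic.Quotient.mk w).symm) := by
    refine loopsGenerate_bandRep g _ ?_ ?_ ?_ ?_
    · exact (congrArg S (trans_trans_symm_eq_refl _ rfl)).mpr S_refl
    · intro l l' h h'
      convert S_trans _ _ h h' using 1
      rw [map_trans']
      simp only [Path.Homotopic.Quotient.trans_assoc, symm_trans_cancel]
    · intro l h
      convert S_symm _ h using 1
      induction l using Path.Homotopic.Quotient.ind with | mk q =>
      exact (symm_trans_trans_symm w (q.map (Handlebody.level c e t).continuous) w).symm
    · intro b
      rcases hm b with h | ⟨i, h⟩
      · exact (congrArg S h).mpr S_refl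
      · exact (congrArg S h).mp (hS i)
  let η : ∀ x : Surface g × J, Path (star g, t) x := fun x => PathConnectedSpace.somePath _ x
  let w₀ : ∀ x, Path.Homotopic.Quotient y₀ (Handlebody.cyl c e x) := fun x =>
    (Path.Homotopic.Quotient.mk w).trans (.mk ((η x).map (Handlebody.cyl c e).continuous))
  have key := (isHandleAttachment_handlebody c e).generation S S_refl S_trans S_symm w₀ (by
      intro x x' q
      -- A loop of the cylinder at `(⋆, t)` is homotopic to its projection to the level `t`, to
      -- which `hconj` applies.
      have h := hconj (.mk ((((η x).trans q).trans (η x').symm).map continuous_fst))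
      have h2 := mk_eq_mk_level_fst (((η x).trans q).trans (η x').symm)
      have h3 := congrArg (Path.Homotopic.Quotient.map · (Handlebody.cyl c e)) h2
      refine (congrArg S ?_).mp h
      refine (congrArg (fun l => ((Path.Homotopic.Quotient.mk w).trans l).trans
        (Path.Homotopic.Quotient.mk w).symm) h3.symm).trans ?_
      simp only [Path.Homotopic.Quotient.mk_trans, map_trans']
      exact trans_conj_trans_symm (.mk w) (.mk ((η x).map (Handlebody.cyl c e).continuous))
        (.mk (q.map (Handlebody.cyl c e).continuous))
        (.mk ((η x').map (Handlebody.cyl c e).continuous)))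
    -- The attaching region, a circle times `J`, is path connected, so the constant crossing
    -- suffices: a two-handle adds no generator.
    (fun _ => (⟨1, by simp⟩, jMid)) (by
      intro i u
      have : PathConnectedSpace (sphere (0 : ℂ) 1) := by
        refine isPathConnected_iff_pathConnectedSpace.1 (isPathConnected_sphere ?_ _ zero_le_one)
        rw [Complex.rank_real_complex]
        exact Cardinal.one_lt_two
      refine ⟨_, PathConnectedSpace.joined _ _, Path.refl _, ContinuousMap.const _ _, rfl, rfl,
        fun r => ((isHandleAttachment_handlebody c e).glue i _ _).symm, ?_⟩
      exact (congrArg S (trans_trans_symm_eq_refl _ rfl)).mpr S_refl)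
    (x := (star g, t)) (x' := (star g, t))
  intro l
  have key' : ∀ l' : Path.Homotopic.Quotient (Handlebody.cyl c e (star g, t))
      (Handlebody.cyl c e (star g, t)), S (((w₀ _).trans l').trans (w₀ _).symm) := by
    intro l'
    induction l' using Path.Homotopic.Quotient.ind with | mk p => exact key p
  -- Every loop at `y₀` is conjugate, by the reference path, to a loop at `(⋆, t)`.
  refine (congrArg S ?_).mp (key' (((w₀ _).symm.trans l).trans (w₀ _)))
  exact trans_symm_conj_trans _ _

end HandlebodyTopology

/-! ### The collapse of a handlebody and its dual forms -/

section HandlebodyCollapse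

open Topology unitInterval Metric

/-- The map between wedges that forgets the circles that are not indexed by `κ`. -/
def wedgeRestrict {ι κ : Type*} (f : κ → ι) (hf : Function.Injective f) :
    C(Wedge ι, Wedge κ) where
  toFun θ := ⟨fun k => θ.1 (f k), fun _ _ h => θ.2 _ _ (hf.ne h)⟩
  continuous_toFun := by
    refine Continuous.subtype_mk (continuous_pi fun k => ?_) _
    exact (continuous_apply (f k)).comp continuous_subtype_val

theorem wedgeRestrict_one {ι κ : Type*} (f : κ → ι) (hf : Function.Injective f) :
    wedgeRestrict f hf 1 = 1 := rfl

theorem wedgeRestrict_wedgePoint {ι κ : Type*} [DecidableEq ι] [DecidableEq κ] (f : κ → ι)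
    (hf : Function.Injective f) (k : κ) (u : Circle) :
    wedgeRestrict f hf (wedgePoint (f k) u) = wedgePoint k u := by
  refine Subtype.ext (funext fun k' => ?_)
  change (Pi.mulSingle (f k) u : ι → Circle) (f k') = (Pi.mulSingle k u : κ → Circle) k'
  simp only [Pi.mulSingle_apply, hf.eq_iff]

theorem wedgeRestrict_wedgePoint_of_ne {ι κ : Type*} [DecidableEq ι] (f : κ → ι)
    (hf : Function.Injective f) {i : ι} (hi : ∀ k, f k ≠ i) (u : Circle) :
    wedgeRestrict f hf (wedgePoint i u) = 1 := by
  refine Subtype.ext (funext fun k => ?_)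
  exact Pi.mulSingle_eq_of_ne (M := fun _ : ι => Circle) (hi k) u

variable {g : ℕ} {c : Fin g → C(Circle × J, Surface g)} {e : J} {kill keep : Fin g → BandIndex g}

/-- The map from a handlebody to a wedge of circles, which collapses the bands `kill i` along which
the handles are attached. -/
theorem exists_handlebody_collapse (hc : ∀ i, c i = bandAnnulus g (kill i))
    (hkeep : Function.Injective keep) (hne : ∀ i k, keep k ≠ kill i) :
    ∃ θ : C(Handlebody c e, Wedge (Fin g)), ∀ x t,
      θ (Handlebody.cyl c e (x, t)) = wedgeRestrict keep hkeep (collapse g x) := by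
  have h := isHandleAttachment_handlebody c e
  obtain ⟨θ, h0, h1⟩ := h.exists_lift (Z := Wedge (Fin g))
    (fun x => wedgeRestrict keep hkeep (collapse g x.1)) (fun _ => 1) (by
      intro i u t
      change _ = wedgeRestrict keep hkeep (collapse g (c i (sphereToCircle u, t)))
      rw [hc]
      -- The lower half of the attaching annulus is in the rectangle, and its upper half maps to a
      -- circle that is forgotten, so the constant map on the handle is compatible.
      rcases le_total ((sphereToCircle u : Circle) : ℂ).im 0 with hu | hu
      · rw [collapse_of_inBase (inBase_bandAnnulus _ t hu), wedgeRestrict_one]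
      · rw [bandAnnulus_eq_bandMap _ t hu, collapse_bandMap,
          wedgeRestrict_wedgePoint_of_ne _ _ (hne i)])
  refine ⟨⟨θ, h.continuous ?_ ?_⟩, fun x t => h0 (x, t)⟩
  · simp only [h0]
    fun_prop
  · simp only [h1]
    exact continuous_const

variable {R : Type*} [CommRing R] {G : Subgroup Rˣ}

theorem map_loopClass_eq_zero (hc : ∀ i, c i = bandAnnulus g (kill i)) {t : J}
    {y₀ : Handlebody c e} (w : Path y₀ (Handlebody.level c e t (star g))) {A : Set (Handlebody c e)}
    (hf : MapsTo (Handlebody.level c e t) {star g} A) (φ : H1 (Handlebody c e) y₀ →* G)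
    (i : Fin g) :
    TwistedH1.map φ (Handlebody.level c e t) w hf (loopClass _ (bandRep g (kill i))) = 0 := by
  apply homologyToChains_injective
  rw [map_zero, homologyToChains_map_loopClass, edge_homotopic A φ (.mk w)
    (q := Path.refl _) (Path.Homotopic.Quotient.eq.1 (mk_level_bandRep_eq_refl i _ (hc i) t)),
    edge_refl]

/-- The kept loops generate because the killed ones are contractible, and the collapse of the
handlebody takes them to the circles of the wedge. Since `A` lies on the vertical segment over `⋆`,
the collapse is constant on it, as forms relative to `A` require. -/
theorem exists_forms (hc : ∀ i, c i = bandAnnulus g (kill i))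
    (hkeep : Function.Injective keep) (hne : ∀ i k, keep k ≠ kill i)
    (hsurj : ∀ b, b ∈ range kill ∨ b ∈ range keep) {t : J}
    {y₀ : Handlebody c e} (w : Path y₀ (Handlebody.level c e t (star g))) {A : Set (Handlebody c e)}
    (hA : ∀ y ∈ A, ∃ r, Handlebody.cyl c e (star g, r) = y) (hw : ∀ r, w r ∈ A)
    (hf : MapsTo (Handlebody.level c e t) {star g} A) (φ : H1 (Handlebody c e) y₀ →* G)
    (k : Fin g) : ∃ F : TwistedH1 A φ →ₗ[R] R, ∀ k',
      F (TwistedH1.map φ (Handlebody.level c e t) w hf (loopClass _ (bandRep g (keep k')))) =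
        (Pi.single k 1 : Fin g → R) k' := by
  obtain ⟨θ, hθ⟩ := exists_handlebody_collapse (e := e) hc hkeep hne
  have hA' : ∀ y ∈ A, θ y = 1 := by
    rintro y hy
    obtain ⟨r, rfl⟩ := hA y hy
    rw [hθ, collapse_of_inBase (inBase_star g), wedgeRestrict_one]
  have hgen : LoopsGenerate fun k => Handlebody.conj w (bandRep g (keep k)) := by
    refine loopsGenerate_handlebody w _ fun b => ?_
    rcases hsurj b with ⟨i, rfl⟩ | ⟨k, rfl⟩
    · exact Or.inl (trans_trans_symm_eq_refl _ (mk_level_bandRep_eq_refl i _ (hc i) t))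
    · exact Or.inr ⟨k, rfl⟩
  have hwedge : ∀ k, IsWedgeLoop θ k (Handlebody.conj w (bandRep g (keep k))) := by
    intro k
    obtain ⟨x, y, p, h, hp⟩ := exists_bandRep_eq (keep k)
    have hseg : ∀ (x : Base g) r, θ (Handlebody.level c e t
        (baseSegment (star g) (baseIncl g x) (inBase_star g) x.2 r)) = 1 := fun x r => by
      refine (hθ (baseSegment (star g) (baseIncl g x) (inBase_star g) x.2 r) t).trans ?_
      exact congrArg (wedgeRestrict keep hkeep)
        (collapse_of_inBase (inBase_baseSegment (inBase_star g) x.2 r))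
    have htr : ∀ {a b d : Handlebody c e} (p : Path a b) (q : Path b d), (∀ r, θ (p r) = 1) →
        (∀ r, θ (q r) = 1) → ∀ r, θ ((p.trans q) r) = 1 := by
      intro a b d p q hp hq r
      rw [Path.trans_apply]
      split_ifs
      exacts [hp _, hq _]
    refine ⟨_, _, w.trans ((baseSegment _ _ (inBase_star g) x.2).map
        (Handlebody.level c e t).continuous), p.map (Handlebody.level c e t).continuous,
      (w.trans ((baseSegment _ _ (inBase_star g) y.2).map
        (Handlebody.level c e t).continuous)).symm, ?_, ?_, ?_, ?_⟩
    · have h' := congrArg (Path.Homotopic.Quotient.map · (Handlebody.level c e t)) h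
      simp only [map_trans'] at h'
      refine (congrArg (fun l => ((Path.Homotopic.Quotient.mk w).trans l).trans
        (Path.Homotopic.Quotient.mk w).symm) h').trans ?_
      rw [Path.Homotopic.Quotient.mk_symm, Path.Homotopic.Quotient.mk_trans,
        Path.Homotopic.Quotient.mk_trans]
      exact trans_conj_trans_symm (.mk w)
        (.mk ((baseSegment _ _ (inBase_star g) x.2).map (Handlebody.level c e t).continuous))
        (.mk (p.map (Handlebody.level c e t).continuous))
        (.mk ((baseSegment _ _ (inBase_star g) y.2).map (Handlebody.level c e t).continuous))
    · exact htr _ _ (fun r => hA' _ (hw r)) (hseg x)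
    · intro r
      refine (hθ (p r) t).trans ?_
      rw [hp, wedgeRestrict_wedgePoint]
    · exact fun r => htr _ _ (fun r => hA' _ (hw r)) (hseg y) (σ r)
  obtain ⟨F, T, h1, h2⟩ := exists_wedge_form θ A hA' _ hgen hwedge φ (Pi.single k 1 : Fin g → R)
  refine ⟨F ∘ₗ homologyToChains A φ, fun k' => ?_⟩
  rw [LinearMap.comp_apply, homologyToChains_map_loopClass, h2 _ w _ fun r => hA' _ (hw r), ← h1]
  rfl

end HandlebodyCollapse

/-! ### Closures of kernels -/

section LinearAlgebra

variable {R : Type*} [CommRing R] [IsDomain R] {H K L : Type*} [AddCommGroup H] [Module R H]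
  [AddCommGroup K] [Module R K] [AddCommGroup L] [Module R L]

/-- The closure of the kernel of a map that kills a part of a generating family and maps the
other part to a family with a dual family of linear forms. -/
theorem closure_ker_eq_span {ι κ : Type*} [Fintype κ] [DecidableEq κ] (f : H →ₗ[R] L) (a : ι → H)
    (b : κ → H) (hspan : Submodule.span R (range a ∪ range b) = ⊤) (ha : ∀ i, f (a i) = 0)
    (F : κ → L →ₗ[R] R) (hF : ∀ k k', F k (f (b k')) = (Pi.single k 1 : κ → R) k') :
    closure (LinearMap.ker f) = Submodule.span R (range a) := by
  apply le_antisymm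
  · rintro x ⟨r, hr, hx⟩
    have hx' : x ∈ Submodule.span R (range a) ⊔ Submodule.span R (range b) := by
      rw [← Submodule.span_union, hspan]
      trivial
    obtain ⟨y, hy, z, hz, rfl⟩ := Submodule.mem_sup.1 hx'
    have hy' : f y = 0 := by
      have h : Submodule.span R (range a) ≤ LinearMap.ker f :=
        Submodule.span_le.2 (by rintro _ ⟨i, rfl⟩; exact ha i)
      exact h hy
    obtain ⟨d, rfl⟩ := (Submodule.mem_span_range_iff_exists_fun R).1 hz
    -- The `k`-th dual form applied to `f (r • (y + z)) = 0` leaves `r * d k = 0`, and `R` is a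
    -- domain.
    have hd : ∀ k, d k = 0 := by
      intro k
      have h := congrArg (F k) (LinearMap.mem_ker.1 hx)
      simp only [map_smul, map_add, hy', zero_add, map_sum, hF, map_zero, smul_eq_mul,
        Pi.single_apply, mul_ite, mul_one, mul_zero, Finset.sum_ite_eq', Finset.mem_univ,
        if_true] at h
      exact (mul_eq_zero.1 h).resolve_left hr
    simpa [hd] using hy
  · refine Submodule.span_le.2 ?_
    rintro _ ⟨i, rfl⟩
    exact ⟨1, one_ne_zero, by rw [one_smul]; exact ha i⟩

theorem closure_ker_coprod_of_subsingleton_left [Subsingleton K] (f₀ : K →ₗ[R] L) (f : H →ₗ[R] L) :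
    closure (LinearMap.ker (f₀.coprod f)) = Submodule.prod ⊥ (closure (LinearMap.ker f)) := by
  ext ⟨x, y⟩
  obtain rfl : x = 0 := Subsingleton.elim _ _
  simp [closure, Submodule.mem_prod]

theorem closure_ker_coprod_of_subsingleton_right [Subsingleton K] (f₀ : K →ₗ[R] L)
    (f : H →ₗ[R] L) :
    closure (LinearMap.ker ((-f).coprod f₀)) = Submodule.prod (closure (LinearMap.ker f)) ⊥ := by
  ext ⟨x, y⟩
  obtain rfl : y = 0 := Subsingleton.elim _ _
  simp [closure, Submodule.mem_prod]

end LinearAlgebra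

/-! ### The kernel for both handlebodies at once -/

section Main

variable {R : Type*} [CommRing R] [IsDomain R] {G : Subgroup Rˣ}
  {g : ℕ} {c : Fin g → C(Circle × J, Surface g)} {e : J} {kill keep : Fin g → BandIndex g}

/-- Killed and kept loops together run over the basis of the surface, so `closure_ker_eq_span`
applies. -/
theorem closure_ker_map_level (hc : ∀ i, c i = bandAnnulus g (kill i))
    (hkeep : Function.Injective keep) (hne : ∀ i k, keep k ≠ kill i)
    (hsurj : ∀ b, b ∈ range kill ∨ b ∈ range keep) {t : J}
    {y₀ : Handlebody c e} (w : Path y₀ (Handlebody.level c e t (star g))) {A : Set (Handlebody c e)}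
    (hA : ∀ y ∈ A, ∃ r, Handlebody.cyl c e (star g, r) = y) (hw : ∀ r, w r ∈ A)
    (hf : MapsTo (Handlebody.level c e t) {star g} A) (φ : H1 (Handlebody c e) y₀ →* G) :
    closure (LinearMap.ker (TwistedH1.map φ (Handlebody.level c e t) w hf)) =
      Submodule.span R (range fun i => loopClass (φ.comp (H1.map (Handlebody.level c e t) w))
        (bandRep g (kill i))) := by
  choose F hF using exists_forms (R := R) hc hkeep hne hsurj w hA hw hf φ
  refine closure_ker_eq_span _ _ (fun k => loopClass _ (bandRep g (keep k))) ?_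
    (map_loopClass_eq_zero hc w hf φ) F hF
  rw [← span_bandRep]
  congr 1
  ext x
  constructor
  · rintro (⟨i, rfl⟩ | ⟨i, rfl⟩)
    exacts [⟨_, rfl⟩, ⟨_, rfl⟩]
  · rintro ⟨b, rfl⟩
    rcases hsurj b with ⟨i, rfl⟩ | ⟨k, rfl⟩
    exacts [Or.inl ⟨i, rfl⟩, Or.inr ⟨k, rfl⟩]

end Main

end Magnus

end

theorem lemma5p3 {R : Type*} [CommRing R] [IsDomain R] (G : Subgroup Rˣ) (g : ℕ) :
    (∀ (d : C(Magnus.Surface 0, Magnus.LowerSpace g))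
        (hd : d (Magnus.star 0) =
          Magnus.Handlebody.level (Magnus.annulusA g) Magnus.jBot Magnus.jBot (Magnus.star g))
        (φ : (Magnus.lowerHandlebody g d hd).H1M →* G),
      let φTop := (Magnus.lowerHandlebody g d hd).phiTop φ
      let a : Fin g → Magnus.TwistedH1 {Magnus.star g} φTop :=
        fun i => Magnus.loopClass φTop (Magnus.loopA g i)
      LinearIndependent R a ∧
        (Magnus.lowerHandlebody g d hd).Mag φ =
          Submodule.prod ⊥ (Submodule.span R (Set.range a))) ∧
    (∀ (d : C(Magnus.Surface 0, Magnus.UpperSpace g))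
        (hd : d (Magnus.star 0) =
          Magnus.Handlebody.level (Magnus.annulusB g) Magnus.jTop Magnus.jTop (Magnus.star g))
        (φ : (Magnus.upperHandlebody g d hd).H1M →* G),
      let φBot := (Magnus.upperHandlebody g d hd).phiBot φ
      let b : Fin g → Magnus.TwistedH1 {Magnus.star g} φBot :=
        fun i => Magnus.loopClass φBot (Magnus.loopB g i)
      LinearIndependent R b ∧
        (Magnus.upperHandlebody g d hd).Mag φ =
          Submodule.prod (Submodule.span R (Set.range b)) ⊥) := by
  refine ⟨fun d hd φ => ⟨?_, ?_⟩, fun d hd φ => ⟨?_, ?_⟩⟩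
  · exact (Magnus.linearIndependent_bandRep _).comp Sum.inl Sum.inl_injective
  -- The summand of the disk is zero, so the parametrization `d` does not affect the kernel.
  · have := Magnus.subsingleton_twistedH1_disk ((Magnus.lowerHandlebody g d hd).phiBot φ)
    refine (Magnus.closure_ker_coprod_of_subsingleton_left _ _).trans ?_
    congr 1
    refine Magnus.closure_ker_map_level (kill := Sum.inl) (keep := Sum.inr) (fun _ => rfl)
      Sum.inr_injective (fun _ _ => by simp) (fun b => by rcases b with i | i <;> simp) _ ?_
      Set.mem_range_self _ φ
    rintro _ ⟨r, rfl⟩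
    exact ⟨_, rfl⟩
  · exact (Magnus.linearIndependent_bandRep _).comp Sum.inr Sum.inr_injective
  · have := Magnus.subsingleton_twistedH1_disk ((Magnus.upperHandlebody g d hd).phiTop φ)
    refine (Magnus.closure_ker_coprod_of_subsingleton_right _ _).trans ?_
    congr 1
    -- For the upper handlebody, the surface carries the base point of the cobordism: the connecting
    -- path is constant, at the lower end of the vertical segment.
    refine Magnus.closure_ker_map_level (kill := Sum.inr) (keep := Sum.inl) (fun _ => rfl)
      Sum.inl_injective (fun _ _ => by simp) (fun b => by rcases b with i | i <;> simp) _ ?_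
      (fun _ => Set.mem_range.2 ⟨0, (Magnus.upperHandlebody g d hd).side.source⟩) _ φ
    rintro _ ⟨r, rfl⟩
    exact ⟨_, rfl⟩
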